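/- Let $\Omega\subset\mathbb R^2$ be (the interior of) an equilateral triangle with sides of length $\ell>0$. A real number $\lambda$ is a Dirichlet eigenvalue of $\Omega$ if there is a function $u\neq 0$ in $H^2(\Omega)$, of class $C^2$ in $\Omega$ and continuous on $\overline\Omega$, with $\Delta u+\lambda u=0$ in $\Omega$ and $u=0$ on $\partial\Omega$; its multiplicity is the dimension of the space of such functions $u$ (together with $0$). All Dirichlet eigenvalues are positive and of finite multiplicity, the series $$\zeta(s)=\sum_{\lambda}\lambda^{-s}\qquad(\operatorname{Re}s>1),$$ over the eigenvalues counted with multiplicity, converges absolutely, and it has a unique meromorphic continuation $\zeta$ to $\mathbb C$, the spectral zeta function of $\Omega$. It is holomorphic at $s=0$, and $$\zeta'(0)=\frac23\log\Big(\frac{3\ell}{2}\Big)+\frac{\pi\sqrt3}{36}+\frac23\sum_{n=1}^\infty\frac{(-1)^n}{n\,e^{\pi n\sqrt3}}\sum_{d\mid n}d ,$$ where the series converges absolutely. Equivalently, $$\zeta'(0)=\frac23\log\Big(\frac{3\ell}{2|\eta(z)|}\Big),\qquad z=\frac{-3+i\sqrt3}{2},$$ where $\eta(\tau)=e^{\pi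 i\tau/12}\prod_{n=1}^\infty(1-e^{2\pi i n\tau})$, $\operatorname{Im}\tau>0$, is the Dedekind eta function. Consequently the zeta-regularized determinant of the Dirichlet Laplacian on $\Omega$ is $$e^{-\zeta'(0)}=\exp\Big(-\frac23\log\Big(\frac{3\ell}{2|\eta(z)|}\Big)\Big).$$ -/

import Mathlib

/-- The open triangle with vertices `A`, `B`, `C` in the Euclidean plane. -/
def openTriangle (A B C : EuclideanSpace ℝ (Fin 2)) :
    TopologicalSpace.Opens (EuclideanSpace ℝ (Fin 2)) where
  carrier := interior (convexHull ℝ {A, B, C})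
  is_open' := isOpen_interior

/-- `u` solves the Dirichlet problem `Δ u + μ u = 0` in the planar domain `Ω`, `u = 0` on `∂Ω`.
The function is of class `H²` in `Ω` (it is represented there by its `C²` version, whose weak
derivatives are the ordinary ones) and continuous up to the boundary.
It is extended by zero outside `Ω`, so that distinct elements of the eigenspace
below are distinct functions on the closure of `Ω`. -/
structure IsDirichletSolution (Ω : Set (EuclideanSpace ℝ (Fin 2))) (μ : ℝ)
    (u : EuclideanSpace ℝ (Fin 2) → ℂ) : Prop where
  contDiffOn : ContDiffOn ℝ 2 u Ω
  sobolev : ∀ k : ℕ, k ≤ 2 →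
    MeasureTheory.MemLp (iteratedFDeriv ℝ k u) 2 (MeasureTheory.volume.restrict Ω)
  continuousOn : ContinuousOn u (closure Ω)
  helmholtz : ∀ x ∈ Ω, Laplacian.laplacian u x + (μ : ℂ) * u x = 0
  eq_zero : ∀ x, x ∉ Ω → u x = 0

/-- The zero function is a solution. -/
theorem IsDirichletSolution.zero (Ω : Set (EuclideanSpace ℝ (Fin 2))) (μ : ℝ) :
    IsDirichletSolution Ω μ 0 where
  contDiffOn := contDiffOn_const
  sobolev k _ := by
    have h : iteratedFDeriv ℝ k (0 : EuclideanSpace ℝ (Fin 2) → ℂ) = 0 := iteratedFDeriv_fun_zero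
    rw [h]
    exact MeasureTheory.MemLp.zero
  continuousOn := continuousOn_const
  helmholtz x _ := by
    have h : Laplacian.laplacian (0 : EuclideanSpace ℝ (Fin 2) → ℂ) x = 0 := by
      have := InnerProductSpace.laplacian_const (E := EuclideanSpace ℝ (Fin 2)) (c := (0 : ℂ))
      exact congrFun this x
    simp [h]
  eq_zero _ _ := rfl

/-- Sums of solutions are solutions. -/
theorem IsDirichletSolution.add {Ω : Set (EuclideanSpace ℝ (Fin 2))} (hΩ : IsOpen Ω) {μ : ℝ}
    {u v : EuclideanSpace ℝ (Fin 2) → ℂ} (hu : IsDirichletSolution Ω μ u)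
    (hv : IsDirichletSolution Ω μ v) : IsDirichletSolution Ω μ (u + v) where
  contDiffOn := hu.contDiffOn.add hv.contDiffOn
  sobolev k hk := by
    refine ((hu.sobolev k hk).add (hv.sobolev k hk)).ae_eq ?_
    refine (MeasureTheory.ae_restrict_iff' hΩ.measurableSet).2 (Filter.Eventually.of_forall ?_)
    intro x hx
    have hk' : ((k : ℕ) : WithTop ℕ∞) ≤ 2 := by exact_mod_cast hk
    have h1 := (hu.contDiffOn.contDiffAt (hΩ.mem_nhds hx)).of_le hk'
    have h2 := (hv.contDiffOn.contDiffAt (hΩ.mem_nhds hx)).of_le hk'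
    exact (iteratedFDeriv_add_apply h1 h2).symm
  continuousOn := hu.continuousOn.add hv.continuousOn
  helmholtz x hx := by
    have h1 := hu.contDiffOn.contDiffAt (hΩ.mem_nhds hx)
    have h2 := hv.contDiffOn.contDiffAt (hΩ.mem_nhds hx)
    rw [h1.laplacian_add h2, Pi.add_apply]
    linear_combination hu.helmholtz x hx + hv.helmholtz x hx
  eq_zero x hx := by simp [hu.eq_zero x hx, hv.eq_zero x hx]

/-- Complex multiples of solutions are solutions. -/
theorem IsDirichletSolution.smul {Ω : Set (EuclideanSpace ℝ (Fin 2))} (hΩ : IsOpen Ω) {μ : ℝ}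
    (c : ℂ) {u : EuclideanSpace ℝ (Fin 2) → ℂ} (hu : IsDirichletSolution Ω μ u) :
    IsDirichletSolution Ω μ (c • u) where
  contDiffOn := hu.contDiffOn.const_smul c
  sobolev k hk := by
    refine ((hu.sobolev k hk).const_smul c).ae_eq ?_
    refine (MeasureTheory.ae_restrict_iff' hΩ.measurableSet).2 (Filter.Eventually.of_forall ?_)
    intro x hx
    have hk' : ((k : ℕ) : WithTop ℕ∞) ≤ 2 := by exact_mod_cast hk
    have h1 := (hu.contDiffOn.contDiffAt (hΩ.mem_nhds hx)).of_le hk'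
    exact (iteratedFDeriv_const_smul_apply h1).symm
  continuousOn := hu.continuousOn.const_smul c
  helmholtz x hx := by
    have h1 := hu.contDiffOn.contDiffAt (hΩ.mem_nhds hx)
    have h2 : Laplacian.laplacian (c • u) x = c * Laplacian.laplacian u x := by
      rw [InnerProductSpace.laplacian_smul c h1, smul_eq_mul]
    rw [h2, Pi.smul_apply, smul_eq_mul]
    linear_combination c * hu.helmholtz x hx
  eq_zero x hx := by simp [hu.eq_zero x hx]

/-- The eigenspace of the Dirichlet Laplacian of the planar domain `Ω` for the value `μ`. -/
def dirichletEigenspace (Ω : TopologicalSpace.Opens (EuclideanSpace ℝ (Fin 2))) (μ : ℝ) :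
    Submodule ℂ (EuclideanSpace ℝ (Fin 2) → ℂ) where
  carrier := {u | IsDirichletSolution Ω μ u}
  zero_mem' := IsDirichletSolution.zero Ω μ
  add_mem' hu hv := IsDirichletSolution.add Ω.isOpen hu hv
  smul_mem' c _ hu := IsDirichletSolution.smul Ω.isOpen c hu

/-- The set of Dirichlet eigenvalues of `Ω`. -/
def dirichletSpectrum (Ω : TopologicalSpace.Opens (EuclideanSpace ℝ (Fin 2))) : Set ℝ :=
  {μ | dirichletEigenspace Ω μ ≠ ⊥}

/-- `ζ` is the spectral zeta function of `Ω` with the Dirichlet boundary condition: all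
eigenvalues are positive and of finite multiplicity, `ζ(s) = ∑ μ⁻ˢ` for `Re s > 1`, the sum being
over the eigenvalues counted with multiplicity, and `ζ` is the meromorphic continuation of this
sum to the complex plane (in normal form: removable singularities are removed, and the value at
a pole is `0`). -/
structure IsSpectralZeta (Ω : TopologicalSpace.Opens (EuclideanSpace ℝ (Fin 2)))
    (ζ : ℂ → ℂ) : Prop where
  pos : ∀ μ ∈ dirichletSpectrum Ω, 0 < μ
  finite : ∀ μ ∈ dirichletSpectrum Ω, FiniteDimensional ℂ (dirichletEigenspace Ω μ)
  hasSum : ∀ s : ℂ, 1 < s.re →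
    HasSum (fun μ : dirichletSpectrum Ω =>
      (Module.finrank ℂ (dirichletEigenspace Ω μ) : ℂ) * ((μ : ℝ) : ℂ) ^ (-s)) (ζ s)
  meromorphic : MeromorphicNFOn ζ Set.univ

/-- The zeta-regularized determinant `exp (-ζ'(0))` attached to a spectral zeta function. -/
noncomputable def zetaDet (ζ : ℂ → ℂ) : ℂ := Complex.exp (-deriv ζ 0)

/-! ### Gaussian bounds and the rapidly decaying theta series -/

section

/-! The proof has an arithmetic half and a spectral half, joined by Lamé's description of the
spectrum: the eigenvalues are `c * (m² + mn + n²)` with `c = 16π² / (9l²)`, one for each pair of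
positive integers.

Arithmetic half. The quadratic form has sixfold symmetry, so its sum over a half-plane of the
lattice is three times the sum over positive pairs plus `2 ζ(2s)` from two boundary rays
(`tsum_half_hexForm`). The half-plane sum is the Mellin transform of a theta series. Completing the
square and applying Poisson summation in one variable (`tsum_exp_half_hexForm`) splits that series
in two. The zero frequency gives a completed Riemann zeta function. The nonzero frequencies give
`hexTheta`, which decays faster than every power at both 0 and ∞, so its Mellin transform is entire.
This is the Chowla–Selberg continuation. Since `1 / Γ` has a simple zero at 0, the derivative there
needs only the value of `mellin hexTheta` at 0. Its terms are Bessel integrals of half-integral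
order, hence elementary, and they sum to `2 ∑ qⁿ σ(n) / n` with `q = -exp (-π√3)`
(`hasSum_mellin_hexTheta_zero`). Up to the factor 2 and a linear term, this is minus the logarithm
of the eta product (`log_norm_eta`): Kronecker's limit formula at one point.

Spectral half. Antisymmetrizing plane waves under the symmetric group of the triangle gives Lamé's
functions, which vanish on all three edges. Two facts show that there are no other eigenfunctions.
Solutions with different spectral parameters are orthogonal by Green's formula
(`IsEquilateral.integral_mul_eq_zero`), where dilation into the interior replaces boundary
regularity. Lamé's functions are complete (`eq_zero_of_integral_mul_lame_eq_zero`): their span is a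
module over the star algebra generated by one invariant function that separates the points of the
triangle, so Stone–Weierstrass applies. Multiplicities follow from the linear independence of
characters. -/

/-- Raise `x / a ≤ exp (x / a)` to the power `a`. -/
theorem Real.exp_neg_le_mul_rpow {a x : ℝ} (ha : 0 < a) (hx : 0 < x) :
    Real.exp (-x) ≤ a ^ a * x ^ (-a) := by
  have h1 : (x / a) ^ a ≤ Real.exp x := by
    calc (x / a) ^ a ≤ (Real.exp (x / a)) ^ a := by
          apply Real.rpow_le_rpow (by positivity) _ ha.le
          linarith [Real.add_one_le_exp (x / a)]
      _ = Real.exp x := by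
          rw [← Real.exp_mul]; congr 1; field_simp
  rw [Real.exp_neg, Real.rpow_neg hx.le, inv_eq_one_div, div_le_iff₀ (Real.exp_pos x)]
  rw [Real.div_rpow hx.le ha.le, div_le_iff₀ (by positivity)] at h1
  have : 0 < x ^ a := by positivity
  rw [mul_assoc, mul_comm, mul_assoc, inv_mul_eq_div, le_div_iff₀ this]
  linarith

theorem exists_exp_neg_sq_le {c a : ℝ} (hc : 0 < c) (ha : 0 < a) :
    ∃ C : ℝ, 0 ≤ C ∧ ∀ t : ℝ, 0 < t → ∀ n : ℕ+,
      Real.exp (-(c * t * (n : ℝ) ^ 2)) ≤ C * t ^ (-a) * ((n : ℝ) ^ (2 * a))⁻¹ := by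
  refine ⟨a ^ a * c ^ (-a), by positivity, fun t ht n => ?_⟩
  have hn : (0 : ℝ) < n := by exact_mod_cast n.pos
  refine (Real.exp_neg_le_mul_rpow ha (by positivity)).trans (le_of_eq ?_)
  rw [Real.mul_rpow (by positivity) (by positivity), Real.mul_rpow hc.le ht.le,
    ← Real.rpow_natCast (n : ℝ) 2, ← Real.rpow_mul hn.le, ← Real.rpow_neg hn.le]
  push_cast
  ring_nf

theorem summable_pnat_rpow_inv {a : ℝ} (ha : 1 < a) :
    Summable fun n : ℕ+ => ((n : ℝ) ^ a)⁻¹ :=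
  (Real.summable_nat_rpow_inv.2 ha).comp_injective PNat.coe_injective

/-- The general term of the theta series `hexTheta`. -/
noncomputable def hexThetaTerm (p : ℕ+ × ℕ+) (t : ℝ) : ℝ :=
  2 * (-1) ^ ((p.1 : ℕ) * p.2) * t ^ (-(1 / 2) : ℝ) *
    (Real.exp (-(Real.pi * (3 / 4) * t * (p.1 : ℝ) ^ 2)) *
      Real.exp (-(Real.pi * t⁻¹ * (p.2 : ℝ) ^ 2)))

/-- The nonconstant part of the theta series of the hexagonal lattice after a partial Poisson
summation. -/
noncomputable def hexTheta (t : ℝ) : ℂ := ∑' p : ℕ+ × ℕ+, (hexThetaTerm p t : ℂ)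

theorem abs_hexThetaTerm (p : ℕ+ × ℕ+) {t : ℝ} (ht : 0 < t) :
    |hexThetaTerm p t| = 2 * t ^ (-(1 / 2) : ℝ) *
    (Real.exp (-(Real.pi * (3 / 4) * t * (p.1 : ℝ) ^ 2)) *
      Real.exp (-(Real.pi * t⁻¹ * (p.2 : ℝ) ^ 2))) := by
  have : 0 ≤ t ^ (-(1 / 2) : ℝ) := by positivity
  rw [hexThetaTerm, abs_mul, abs_mul, abs_mul, abs_pow, abs_of_nonneg this]
  simp [abs_mul]

/-- The two Gaussians are bounded with independent exponents because they pull the power of `t` in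
opposite directions. Any real power of `t` can then be reached while both sums still converge. -/
theorem exists_abs_hexThetaTerm_le {a b : ℝ} (ha : 0 < a) (hb : 0 < b) :
    ∃ C : ℝ, 0 ≤ C ∧ ∀ t : ℝ, 0 < t → ∀ p : ℕ+ × ℕ+, |hexThetaTerm p t| ≤
      C * t ^ (-(1 / 2) - a + b) * (((p.1 : ℝ) ^ (2 * a))⁻¹ * ((p.2 : ℝ) ^ (2 * b))⁻¹) := by
  obtain ⟨C, hC, h1⟩ := exists_exp_neg_sq_le (c := Real.pi * (3 / 4)) (by positivity) ha
  obtain ⟨D, hD, h2⟩ := exists_exp_neg_sq_le (c := Real.pi) (by positivity) hb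
  refine ⟨2 * C * D, by positivity, fun t ht p => ?_⟩
  rw [abs_hexThetaTerm p ht]
  have h3 := h2 t⁻¹ (by positivity) p.2
  rw [Real.inv_rpow ht.le, Real.rpow_neg ht.le, inv_inv] at h3
  refine (mul_le_mul_of_nonneg_left (mul_le_mul (h1 t ht p.1) h3 (by positivity) (by positivity))
    (by positivity)).trans (le_of_eq ?_)
  rw [Real.rpow_add ht, Real.rpow_sub ht, Real.rpow_neg ht.le a]
  ring

theorem summable_pnat_prod_rpow_inv {a b : ℝ} (ha : 1 < a) (hb : 1 < b) :
    Summable fun p : ℕ+ × ℕ+ => ((p.1 : ℝ) ^ a)⁻¹ * ((p.2 : ℝ) ^ b)⁻¹ :=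
  (summable_pnat_rpow_inv ha).mul_of_nonneg (summable_pnat_rpow_inv hb)
    (fun _ => by positivity) (fun _ => by positivity)

theorem summable_abs_hexThetaTerm {t : ℝ} (ht : 0 < t) :
    Summable fun p : ℕ+ × ℕ+ => |hexThetaTerm p t| := by
  obtain ⟨C, -, h⟩ := exists_abs_hexThetaTerm_le one_pos one_pos
  exact Summable.of_nonneg_of_le (fun _ => abs_nonneg _) (h t ht)
    ((summable_pnat_prod_rpow_inv (by norm_num) (by norm_num)).mul_left _)

theorem exists_norm_hexTheta_le (r : ℝ) :
    ∃ C : ℝ, ∀ t : ℝ, 0 < t → ‖hexTheta t‖ ≤ C * t ^ (-r) := by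
  -- Both exponents are kept at least 1 so that the series of `n ^ (-2a)` and `n ^ (-2b)` converge.
  obtain ⟨a, b, ha, hb, hr⟩ : ∃ a b : ℝ, 1 ≤ a ∧ 1 ≤ b ∧ -r = -(1 / 2) - a + b := by
    rcases le_total (1 / 2) r with h | h
    · exact ⟨r + 1 / 2, 1, by linarith, le_rfl, by ring⟩
    · exact ⟨1, 3 / 2 - r, le_rfl, by linarith, by ring⟩
  obtain ⟨C, -, h⟩ := exists_abs_hexThetaTerm_le (a := a) (b := b) (by linarith) (by linarith)
  have hs := summable_pnat_prod_rpow_inv (a := 2 * a) (b := 2 * b) (by linarith) (by linarith)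
  refine ⟨C * ∑' p : ℕ+ × ℕ+, ((p.1 : ℝ) ^ (2 * a))⁻¹ * ((p.2 : ℝ) ^ (2 * b))⁻¹, fun t ht => ?_⟩
  have := tsum_of_norm_bounded (f := fun p => (hexThetaTerm p t : ℂ))
    (hs.mul_left (C * t ^ (-(1 / 2) - a + b))).hasSum
    (fun p => by simpa using h t ht p)
  rw [tsum_mul_left, ← hr] at this
  refine this.trans (le_of_eq (by ring))

/-- Near `t₀` the antitone factor is at most `g (t₀ / 2)`, so the Weierstrass test applies on `(t₀ /
2, ∞)`. -/
theorem continuousOn_tsum_Ioi {ι : Type*} {f : ι → ℝ → ℂ}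
    (hf : ∀ i, ContinuousOn (f i) (Set.Ioi 0)) {u : ι → ℝ} (hu : Summable u) (g : ℝ → ℝ)
    (hg : AntitoneOn g (Set.Ioi 0)) (hu0 : ∀ i, 0 ≤ u i)
    (h : ∀ i, ∀ t : ℝ, 0 < t → ‖f i t‖ ≤ g t * u i) :
    ContinuousOn (fun t => ∑' i, f i t) (Set.Ioi 0) := by
  intro t₀ ht₀
  have ht : (0 : ℝ) < t₀ / 2 := half_pos ht₀
  have hc : ContinuousOn (fun t => ∑' i, f i t) (Set.Ioi (t₀ / 2)) := by
    refine continuousOn_tsum (fun i => (hf i).mono (Set.Ioi_subset_Ioi ht.le))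
      (hu.mul_left (g (t₀ / 2))) fun i t (hti : t₀ / 2 < t) => ?_
    exact (h i t (ht.trans hti)).trans
      (mul_le_mul_of_nonneg_right (hg ht (ht.trans hti) hti.le) (hu0 i))
  exact (hc.continuousAt (Ioi_mem_nhds (half_lt_self ht₀))).continuousWithinAt

theorem antitoneOn_const_mul_rpow {C a : ℝ} (hC : 0 ≤ C) (ha : 0 ≤ a) :
    AntitoneOn (fun t : ℝ => C * t ^ (-a)) (Set.Ioi 0) := fun s hs _ _ hst =>
  mul_le_mul_of_nonneg_left (Real.rpow_le_rpow_of_nonpos hs hst (by linarith)) hC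

theorem continuousOn_hexThetaTerm (p : ℕ+ × ℕ+) : ContinuousOn (hexThetaTerm p) (Set.Ioi 0) := by
  unfold hexThetaTerm
  have h0 : ∀ x ∈ Set.Ioi (0 : ℝ), x ≠ 0 := fun x hx => ne_of_gt hx
  have h1 : ContinuousOn (fun t : ℝ => t ^ (-(1 / 2) : ℝ)) (Set.Ioi 0) :=
    continuousOn_id.rpow_const fun x hx => Or.inl (h0 x hx)
  have h2 : ContinuousOn (fun t : ℝ => t⁻¹) (Set.Ioi 0) := continuousOn_inv₀.mono h0
  fun_prop

theorem continuousOn_hexTheta : ContinuousOn hexTheta (Set.Ioi 0) := by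
  obtain ⟨C, hC, h⟩ := exists_abs_hexThetaTerm_le one_pos one_pos
  refine continuousOn_tsum_Ioi
    (fun p => Complex.continuous_ofReal.comp_continuousOn (continuousOn_hexThetaTerm p))
    (summable_pnat_prod_rpow_inv (a := 2 * 1) (b := 2 * 1) (by norm_num) (by norm_num))
    (fun t => C * t ^ (-(1 / 2) : ℝ)) (antitoneOn_const_mul_rpow hC (by norm_num))
    (fun _ => by positivity) fun p t ht => ?_
  have := h t ht p
  simpa using this

theorem locallyIntegrableOn_hexTheta :
    MeasureTheory.LocallyIntegrableOn hexTheta (Set.Ioi 0) :=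
  continuousOn_hexTheta.locallyIntegrableOn measurableSet_Ioi

open Filter Asymptotics in
theorem hexTheta_isBigO_atTop (r : ℝ) : hexTheta =O[atTop] fun t : ℝ => t ^ (-r) := by
  obtain ⟨C, h⟩ := exists_norm_hexTheta_le r
  refine IsBigO.of_bound C ?_
  filter_upwards [eventually_gt_atTop 0] with t ht
  simpa [abs_of_nonneg (Real.rpow_nonneg ht.le _)] using h t ht

open Filter Asymptotics Topology in
theorem hexTheta_isBigO_zero (r : ℝ) : hexTheta =O[𝓝[>] 0] fun t : ℝ => t ^ (-r) := by
  obtain ⟨C, h⟩ := exists_norm_hexTheta_le r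
  refine IsBigO.of_bound C ?_
  filter_upwards [self_mem_nhdsWithin] with t (ht : 0 < t)
  simpa [abs_of_nonneg (Real.rpow_nonneg ht.le _)] using h t ht

/-- Power bounds of every order at both ends leave no restriction on `s`. -/
theorem differentiable_mellin_hexTheta : Differentiable ℂ (mellin hexTheta) := fun s =>
  mellin_differentiableAt_of_isBigO_rpow locallyIntegrableOn_hexTheta
    (hexTheta_isBigO_atTop (s.re + 1)) (lt_add_one _) (hexTheta_isBigO_zero (s.re - 1))
    (sub_one_lt _)

theorem mellinConvergent_hexTheta (s : ℂ) : MellinConvergent hexTheta s :=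
  mellinConvergent_of_isBigO_rpow locallyIntegrableOn_hexTheta
    (hexTheta_isBigO_atTop (s.re + 1)) (lt_add_one _) (hexTheta_isBigO_zero (s.re - 1))
    (sub_one_lt _)

end

/-! ### The hexagonal quadratic form and Poisson summation -/

section

/-- The quadratic form `m² + mn + n²`. -/
def hexForm (m n : ℤ) : ℤ := m ^ 2 + m * n + n ^ 2

theorem hexForm_pos {m n : ℤ} (h : m ≠ 0 ∨ n ≠ 0) : 0 < hexForm m n := by
  unfold hexForm
  rcases h with h | h
  · nlinarith [sq_nonneg (m + 2 * n), sq_pos_of_ne_zero h]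
  · nlinarith [sq_nonneg (2 * m + n), sq_pos_of_ne_zero h]

/-- Since `4 (m² + mn + n²) = 3m² + (m + 2n)²`, and symmetrically in `n`, the form dominates a
quarter of the squared sup norm. The series is then compared with the norm sum for Eisenstein series
of weight `2σ`. The term at the origin is `(0 ^ σ)⁻¹ = 0`. -/
theorem summable_hexForm_rpow {σ : ℝ} (hσ : 1 < σ) :
    Summable fun x : ℤ × ℤ => ((hexForm x.1 x.2 : ℝ) ^ σ)⁻¹ := by
  have h := (EisensteinSeries.summable_one_div_norm_rpow (k := 2 * σ) (by linarith)).mul_left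
    (4 ^ σ)
  rw [← (finTwoArrowEquiv ℤ).symm.summable_iff] at h
  refine Summable.of_nonneg_of_le (fun x => ?_) (fun x => ?_) h
  · by_cases hx : x.1 ≠ 0 ∨ x.2 ≠ 0
    · have : (0 : ℝ) < hexForm x.1 x.2 := by exact_mod_cast hexForm_pos hx
      positivity
    · push Not at hx
      simp [hexForm, hx.1, hx.2, (by linarith : σ ≠ 0)]
  · by_cases hx : x.1 ≠ 0 ∨ x.2 ≠ 0
    · have h0 : (0 : ℝ) < hexForm x.1 x.2 := by exact_mod_cast hexForm_pos hx
      simp only [Function.comp_apply, finTwoArrowEquiv_symm_apply]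
      set v : Fin 2 → ℤ := ![x.1, x.2]
      have hv : ‖v‖ ^ 2 ≤ 4 * (hexForm x.1 x.2 : ℝ) := by
        have : ‖v‖ ≤ √(4 * (hexForm x.1 x.2 : ℝ)) := by
          refine (pi_norm_le_iff_of_nonneg (Real.sqrt_nonneg _)).2 fun i => ?_
          refine Real.le_sqrt_of_sq_le ?_
          fin_cases i
          · simp only [v, Int.norm_eq_abs, hexForm]
            simp only [Fin.zero_eta, Matrix.cons_val_zero, sq_abs]
            push_cast
            nlinarith [sq_nonneg ((x.1 : ℝ) + 2 * x.2), sq_nonneg (x.1 : ℝ)]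
          · simp only [v, Int.norm_eq_abs, hexForm]
            simp only [Fin.mk_one, Matrix.cons_val_one, Matrix.cons_val_fin_one, sq_abs]
            push_cast
            nlinarith [sq_nonneg (2 * (x.1 : ℝ) + x.2), sq_nonneg (x.2 : ℝ)]
        calc ‖v‖ ^ 2 ≤ (√(4 * (hexForm x.1 x.2 : ℝ))) ^ 2 :=
              pow_le_pow_left₀ (norm_nonneg _) this 2
          _ = _ := Real.sq_sqrt (by positivity)
      have hv0 : 0 < ‖v‖ := by
        rw [norm_pos_iff]
        intro hv
        have h1 := congrFun hv 0
        have h2 := congrFun hv 1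
        simp [v] at h1 h2
        tauto
      rw [Real.rpow_neg hv0.le, ← div_eq_mul_inv, le_div_iff₀ (by positivity),
        inv_mul_le_iff₀ (by positivity), Real.rpow_mul hv0.le, ← Real.mul_rpow h0.le (by norm_num)]
      apply Real.rpow_le_rpow (by positivity) _ (by linarith)
      rw [Real.rpow_two]
      linarith
    · push Not at hx
      simp only [hexForm, hx.1, hx.2]
      norm_num
      rw [Real.zero_rpow (by linarith)]
      simp only [inv_zero]
      positivity

theorem summable_half_hexForm_rpow {σ : ℝ} (hσ : 1 < σ) :
    Summable fun x : ℕ+ × ℤ => ((hexForm x.2 (x.1 : ℕ) : ℝ) ^ σ)⁻¹ :=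
  (summable_hexForm_rpow hσ).comp_injective (i := fun x : ℕ+ × ℤ => (x.2, ((x.1 : ℕ) : ℤ)))
    fun x y h => by
      simp only [Prod.mk.injEq, Nat.cast_inj, PNat.coe_inj] at h
      exact Prod.ext h.2 h.1

theorem half_hexForm_pos (x : ℕ+ × ℤ) : (0 : ℝ) < hexForm x.2 (x.1 : ℕ) := by
  exact_mod_cast hexForm_pos (Or.inr (by exact_mod_cast x.1.ne_zero))

theorem summable_exp_half_hexForm {t : ℝ} (ht : 0 < t) :
    Summable fun x : ℕ+ × ℤ => Real.exp (-Real.pi * hexForm x.2 (x.1 : ℕ) * t) := by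
  refine Summable.of_nonneg_of_le (fun _ => (Real.exp_pos _).le) (fun x => ?_)
    ((summable_half_hexForm_rpow (σ := 2) one_lt_two).mul_left (2 ^ (2 : ℝ) * (Real.pi * t) ^ (-2 : ℝ)))
  have h0 := half_hexForm_pos x
  have := Real.exp_neg_le_mul_rpow (a := 2) two_pos
    (x := Real.pi * t * hexForm x.2 (x.1 : ℕ)) (by positivity)
  rw [Real.mul_rpow (by positivity) h0.le, Real.rpow_neg h0.le] at this
  refine (le_of_eq ?_).trans (this.trans (le_of_eq ?_))
  · congr 1; ring
  · ring

theorem half_hexForm_eq (x : ℕ+ × ℤ) :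
    (hexForm x.2 (x.1 : ℕ) : ℝ) = ((x.2 : ℝ) + (x.1 : ℝ) / 2) ^ 2 + 3 / 4 * (x.1 : ℝ) ^ 2 := by
  unfold hexForm
  push_cast
  ring

/-- Poisson summation for a Gaussian shifted by `n / 2`: the shift becomes the character `exp (-π i
n k) = (-1) ^ (n k)` on the dual side. -/
theorem tsum_exp_shift_eq {t : ℝ} (ht : 0 < t) (n : ℤ) :
    ∑' m : ℤ, Real.exp (-Real.pi * t * ((m : ℝ) + n / 2) ^ 2) =
      t ^ (-(1 / 2) : ℝ) *
        ∑' k : ℤ, (-1 : ℝ) ^ (n * k) * Real.exp (-(Real.pi * t⁻¹ * (k : ℝ) ^ 2)) := by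
  have h := Complex.tsum_exp_neg_quadratic (a := ((t⁻¹ : ℝ) : ℂ))
    (by rw [Complex.ofReal_re]; positivity) (-Complex.I * n / 2)
  have h1 : ∀ k : ℤ, Complex.exp (-Real.pi * ((t⁻¹ : ℝ) : ℂ) * (k : ℂ) ^ 2 +
      2 * Real.pi * (-Complex.I * n / 2) * k) =
      (((-1 : ℝ) ^ (n * k) * Real.exp (-(Real.pi * t⁻¹ * (k : ℝ) ^ 2)) : ℝ) : ℂ) := by
    intro k
    rw [Complex.exp_add]
    have : Complex.exp (2 * Real.pi * (-Complex.I * n / 2) * k) = (-1) ^ (n * k) := by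
      rw [← Complex.exp_neg_pi_mul_I, ← Complex.exp_int_mul]
      congr 1
      push_cast
      ring
    rw [this]
    push_cast
    rw [mul_comm]
    congr 2
    ring
  have h2 : ∀ m : ℤ, Complex.exp (-Real.pi / ((t⁻¹ : ℝ) : ℂ) *
      ((m : ℂ) + Complex.I * (-Complex.I * n / 2)) ^ 2) =
      ((Real.exp (-Real.pi * t * ((m : ℝ) + n / 2) ^ 2) : ℝ) : ℂ) := by
    intro m
    push_cast
    congr 1
    have : Complex.I * (-Complex.I * n / 2) = n / 2 := by
      linear_combination (-(n : ℂ) / 2) * Complex.I_mul_I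
    rw [this, div_inv_eq_mul]
  simp_rw [h1, h2] at h
  have h3 : (((t⁻¹ : ℝ) : ℂ)) ^ (1 / 2 : ℂ) = ((t ^ (-(1 / 2) : ℝ) : ℝ) : ℂ) := by
    rw [Real.rpow_neg ht.le, ← Real.inv_rpow ht.le, Complex.ofReal_cpow (by positivity)]
    norm_num
  rw [h3, ← Complex.ofReal_tsum, ← Complex.ofReal_tsum] at h
  have h4 : ((t ^ (-(1 / 2) : ℝ) : ℝ) : ℂ) ≠ 0 := by
    exact_mod_cast (Real.rpow_pos_of_pos ht _).ne'
  rw [one_div, eq_inv_mul_iff_mul_eq₀ h4, ← Complex.ofReal_mul, Complex.ofReal_inj] at h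
  exact h.symm

end

/-! ### Splitting the theta series and its Mellin transform -/

section

theorem tsum_int_mul_exp_neg_sq {t : ℝ} (ht : 0 < t) (n : ℤ) :
    ∑' k : ℤ, (-1 : ℝ) ^ (n * k) * Real.exp (-(Real.pi * t⁻¹ * (k : ℝ) ^ 2)) =
      1 + 2 * ∑' k : ℕ+, (-1 : ℝ) ^ (n * (k : ℕ)) *
        Real.exp (-(Real.pi * t⁻¹ * ((k : ℕ) : ℝ) ^ 2)) := by
  have hs : Summable fun k : ℕ+ => (-1 : ℝ) ^ (n * (k : ℕ)) *
        Real.exp (-(Real.pi * t⁻¹ * ((k : ℕ) : ℝ) ^ 2)) := by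
    obtain ⟨C, hC, h⟩ := exists_exp_neg_sq_le Real.pi_pos one_pos
    refine Summable.of_norm_bounded (g := fun k : ℕ+ =>
      C * t⁻¹ ^ (-1 : ℝ) * ((k : ℝ) ^ (2 * 1 : ℝ))⁻¹)
      ((summable_pnat_rpow_inv (by norm_num)).mul_left _) fun k => ?_
    have := h t⁻¹ (by positivity) k
    simpa [abs_mul, abs_zpow] using this
  have he : ∀ k : ℤ, (-1 : ℝ) ^ (n * (-k)) * Real.exp (-(Real.pi * t⁻¹ * ((-k : ℤ) : ℝ) ^ 2)) =
      (-1 : ℝ) ^ (n * k) * Real.exp (-(Real.pi * t⁻¹ * (k : ℝ) ^ 2)) := by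
    intro k
    rw [mul_neg, zpow_neg, ← inv_zpow]
    push_cast
    norm_num
  have hsz : Summable fun k : ℤ => (-1 : ℝ) ^ (n * k) *
      Real.exp (-(Real.pi * t⁻¹ * (k : ℝ) ^ 2)) := by
    have hn : Summable fun k : ℕ => (-1 : ℝ) ^ (n * (k : ℤ)) *
        Real.exp (-(Real.pi * t⁻¹ * ((k : ℤ) : ℝ) ^ 2)) := by
      rw [← summable_nat_add_iff 1]
      exact (summable_pnat_iff_summable_succ (f := fun k : ℕ => (-1 : ℝ) ^ (n * (k : ℤ)) *
        Real.exp (-(Real.pi * t⁻¹ * ((k : ℤ) : ℝ) ^ 2)))).1 hs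
    exact Summable.of_nat_of_neg hn (hn.congr fun k => (he k).symm)
  rw [tsum_int_eq_zero_add_two_mul_tsum_pnat (fun k => (he k)) hsz]
  simp

/-- The sum `∑ exp (-3π n² t / 4)` over positive `n`. -/
noncomputable def hexPsi (t : ℝ) : ℂ :=
  ∑' n : ℕ+, ((Real.exp (-Real.pi * (3 / 4 * (n : ℝ) ^ 2) * t) : ℝ) : ℂ)

theorem exists_exp_hexPsi_le {a : ℝ} (ha : 0 < a) : ∃ C : ℝ, 0 ≤ C ∧ ∀ t : ℝ, 0 < t → ∀ n : ℕ+,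
    Real.exp (-Real.pi * (3 / 4 * (n : ℝ) ^ 2) * t) ≤ C * t ^ (-a) * ((n : ℝ) ^ (2 * a))⁻¹ := by
  obtain ⟨C, hC, h⟩ := exists_exp_neg_sq_le (c := Real.pi * (3 / 4)) (by positivity) ha
  refine ⟨C, hC, fun t ht n => (le_of_eq ?_).trans (h t ht n)⟩
  congr 1
  ring

theorem summable_exp_hexPsi {t : ℝ} (ht : 0 < t) :
    Summable fun n : ℕ+ => Real.exp (-Real.pi * (3 / 4 * (n : ℝ) ^ 2) * t) := by
  obtain ⟨C, hC, h⟩ := exists_exp_hexPsi_le one_pos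
  exact Summable.of_nonneg_of_le (fun _ => (Real.exp_pos _).le) (h t ht)
    ((summable_pnat_rpow_inv (by norm_num)).mul_left _)

theorem exists_norm_hexPsi_le {a : ℝ} (ha : 1 / 2 < a) :
    ∃ C : ℝ, ∀ t : ℝ, 0 < t → ‖hexPsi t‖ ≤ C * t ^ (-a) := by
  obtain ⟨C, hC, h⟩ := exists_exp_hexPsi_le (a := a) (by linarith)
  refine ⟨C * ∑' n : ℕ+, ((n : ℝ) ^ (2 * a))⁻¹, fun t ht => ?_⟩
  have := tsum_of_norm_bounded
    (f := fun n : ℕ+ => ((Real.exp (-Real.pi * (3 / 4 * (n : ℝ) ^ 2) * t) : ℝ) : ℂ))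
    ((summable_pnat_rpow_inv (a := 2 * a) (by linarith)).mul_left (C * t ^ (-a))).hasSum
    (fun n => by
      rw [Complex.norm_real, Real.norm_of_nonneg (Real.exp_pos _).le]
      exact h t ht n)
  rw [tsum_mul_left] at this
  exact this.trans (le_of_eq (by ring))

theorem continuousOn_hexPsi : ContinuousOn hexPsi (Set.Ioi 0) := by
  obtain ⟨C, hC, h⟩ := exists_exp_hexPsi_le one_pos
  refine continuousOn_tsum_Ioi (fun n => by fun_prop)
    (summable_pnat_rpow_inv (a := 2 * 1) (by norm_num))
    (fun t => C * t ^ (-1 : ℝ)) (antitoneOn_const_mul_rpow hC (by norm_num))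
    (fun _ => by positivity) fun n t ht => ?_
  rw [Complex.norm_real, Real.norm_of_nonneg (Real.exp_pos _).le]
  exact h t ht n

open Filter Asymptotics Topology in
theorem mellinConvergent_hexPsi {s : ℂ} (hs : 1 / 2 < s.re) : MellinConvergent hexPsi s := by
  obtain ⟨C, h⟩ := exists_norm_hexPsi_le (a := s.re + 1) (by linarith)
  -- The bound at 0 needs an exponent strictly between 1/2 and `s.re`: above 1/2 for its constant to
  -- be finite, below `s.re` for the integral to converge.
  obtain ⟨D, h'⟩ := exists_norm_hexPsi_le (a := (1 / 2 + s.re) / 2) (by linarith)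
  refine mellinConvergent_of_isBigO_rpow
    (continuousOn_hexPsi.locallyIntegrableOn measurableSet_Ioi)
    (a := s.re + 1) (b := (1 / 2 + s.re) / 2) (IsBigO.of_bound C ?_) (lt_add_one _)
    (IsBigO.of_bound D ?_) (by linarith)
  · filter_upwards [eventually_gt_atTop 0] with t ht
    simpa only [Real.norm_of_nonneg (Real.rpow_nonneg ht.le _)] using h t ht
  · filter_upwards [self_mem_nhdsWithin] with t (ht : 0 < t)
    simpa only [Real.norm_of_nonneg (Real.rpow_nonneg ht.le _)] using h' t ht

/-- Write the form as `(m + n/2)² + (3/4) n²` and apply Poisson summation in `m`. The frequency `k =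
0` gives `t ^ (-1/2) • hexPsi t`; the frequencies `±k` combine into the terms of `hexTheta`, whence
the factor 2 there. -/
theorem tsum_exp_half_hexForm {t : ℝ} (ht : 0 < t) :
    ((∑' x : ℕ+ × ℤ, Real.exp (-Real.pi * hexForm x.2 (x.1 : ℕ) * t) : ℝ) : ℂ) =
      hexTheta t + (t : ℂ) ^ (-(1 / 2) : ℂ) • hexPsi t := by
  have e1 : ∀ n : ℕ+, ∑' m : ℤ, Real.exp (-Real.pi * hexForm m (n : ℕ) * t) =
      ∑' k : ℕ+, hexThetaTerm (n, k) t +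
      t ^ (-(1 / 2) : ℝ) * Real.exp (-Real.pi * (3 / 4 * (n : ℝ) ^ 2) * t) := by
    intro n
    have h1 : ∀ m : ℤ, Real.exp (-Real.pi * hexForm m (n : ℕ) * t) =
        Real.exp (-Real.pi * (3 / 4 * (n : ℝ) ^ 2) * t) *
        Real.exp (-Real.pi * t * ((m : ℝ) + ((n : ℕ) : ℤ) / 2) ^ 2) := by
      intro m
      rw [← Real.exp_add, half_hexForm_eq (n, m)]
      congr 1
      push_cast
      ring
    simp_rw [h1]
    rw [tsum_mul_left, tsum_exp_shift_eq ht, tsum_int_mul_exp_neg_sq ht]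
    have h2 : ∀ k : ℕ+, hexThetaTerm (n, k) t =
        2 * t ^ (-(1 / 2) : ℝ) * Real.exp (-Real.pi * (3 / 4 * (n : ℝ) ^ 2) * t) *
        ((-1 : ℝ) ^ ((((n : ℕ) : ℤ)) * ((k : ℕ) : ℤ)) *
        Real.exp (-(Real.pi * t⁻¹ * ((k : ℕ) : ℝ) ^ 2))) := by
      intro k
      have e : (-1 : ℝ) ^ ((((n : ℕ) : ℤ)) * ((k : ℕ) : ℤ)) = (-1) ^ ((n : ℕ) * (k : ℕ)) := by
        rw [← Nat.cast_mul, zpow_natCast]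
      rw [e, hexThetaTerm, show -Real.pi * (3 / 4 * (n : ℝ) ^ 2) * t =
        -(Real.pi * (3 / 4) * t * (n : ℝ) ^ 2) by ring]
      ring
    simp_rw [h2]
    rw [tsum_mul_left]
    ring
  rw [(summable_exp_half_hexForm ht).tsum_prod]
  simp_rw [e1]
  have hs := (summable_abs_hexThetaTerm ht).of_abs
  rw [Summable.tsum_add hs.prod ((summable_exp_hexPsi ht).mul_left _), ← hs.tsum_prod,
    tsum_mul_left, hexTheta, hexPsi, Complex.ofReal_add, Complex.ofReal_tsum, Complex.ofReal_mul,
    Complex.ofReal_tsum, Complex.ofReal_cpow ht.le]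
  simp

/-- The factor `t ^ (-1/2)` of `hexPsi` shifts its Mellin variable by 1/2. -/
theorem mellin_hexTheta_add {s : ℂ} (hs : 1 < s.re) :
    HasSum (fun x : ℕ+ × ℤ => (Real.pi : ℂ) ^ (-s) * Complex.Gamma s * 1 /
        ((hexForm x.2 (x.1 : ℕ) : ℝ) : ℂ) ^ s)
      (mellin hexTheta s + mellin hexPsi (s - 1 / 2)) := by
  have h := hasSum_mellin_pi_mul (ι := ℕ+ × ℤ) (a := fun _ => 1)
    (q := fun x => (hexForm x.2 (x.1 : ℕ) : ℝ))
    (F := fun t => hexTheta t + (t : ℂ) ^ (-(1 / 2) : ℂ) • hexPsi t) (s := s)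
    (fun x => Or.inr (half_hexForm_pos x)) (by linarith) (fun t (ht : 0 < t) => ?_) ?_
  · convert h using 1
    rw [(hasMellin_add (mellinConvergent_hexTheta s) ?_).2, mellin_cpow_smul]
    · congr 2
    · rw [MellinConvergent.cpow_smul]
      apply mellinConvergent_hexPsi
      norm_num
      linarith
  · rw [← tsum_exp_half_hexForm ht, Complex.ofReal_tsum]
    have := (summable_exp_half_hexForm ht)
    have := (Complex.hasSum_ofReal.2 this.hasSum)
    rw [Complex.ofReal_tsum] at this
    simpa only [one_mul] using this
  · simpa using summable_half_hexForm_rpow hs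

/-- Termwise integration gives `(3/4) ^ (-s)` times the Gamma factor of `ζ(2s)` times its Dirichlet
series. -/
theorem mellin_hexPsi {s : ℂ} (hs : 1 / 2 < s.re) :
    mellin hexPsi s = ((3 / 4 : ℝ) : ℂ) ^ (-s) * completedRiemannZeta (2 * s) := by
  have hs0 : (2 * s) ≠ 0 := fun h => by
    have := congrArg Complex.re h
    simp at this
    linarith
  have h := hasSum_mellin_pi_mul (ι := ℕ+) (a := fun _ => 1)
    (q := fun n => 3 / 4 * (n : ℝ) ^ 2) (F := hexPsi) (s := s)
    (fun n => Or.inr (by have : (0 : ℝ) < n := by exact_mod_cast n.pos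
                         positivity)) (by linarith) (fun t (ht : 0 < t) => ?_) ?_
  · rw [← h.tsum_eq]
    have e : ∀ n : ℕ+, (Real.pi : ℂ) ^ (-s) * Complex.Gamma s * 1 /
        ((3 / 4 * (n : ℝ) ^ 2 : ℝ) : ℂ) ^ s = ((3 / 4 : ℝ) : ℂ) ^ (-s) * Complex.Gammaℝ (2 * s) *
        (1 / (n : ℂ) ^ (2 * s)) := by
      intro n
      rw [Complex.ofReal_mul, Complex.mul_cpow_ofReal_nonneg (by norm_num) (by positivity),
        Complex.Gammaℝ_def, Complex.cpow_neg ((3 / 4 : ℝ) : ℂ)]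
      have e2 : (((n : ℝ) ^ 2 : ℝ) : ℂ) ^ s = (n : ℂ) ^ (2 * s) := by
        have := Complex.natCast_cpow_natCast_mul n 2 s
        push_cast at this ⊢
        exact this.symm
      rw [e2, show -(2 * s) / 2 = -s by ring, show 2 * s / 2 = s by ring]
      field_simp
    simp_rw [e]
    rw [tsum_mul_left]
    have hz : riemannZeta (2 * s) = ∑' n : ℕ+, 1 / (n : ℂ) ^ (2 * s) := by
      rw [zeta_eq_tsum_one_div_nat_add_one_cpow (by simp; linarith),
        tsum_pnat_eq_tsum_succ (f := fun n : ℕ => 1 / (n : ℂ) ^ (2 * s))]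
      push_cast
      rfl
    rw [← hz, riemannZeta_def_of_ne_zero hs0, mul_assoc, mul_div_cancel₀]
    exact Complex.Gammaℝ_ne_zero_of_re_pos (by simp; linarith)
  · have := (summable_exp_hexPsi ht)
    have := (Complex.hasSum_ofReal.2 this.hasSum)
    rw [Complex.ofReal_tsum] at this
    simpa only [one_mul, hexPsi] using this
  · have := (summable_pnat_rpow_inv (a := 2 * s.re) (by linarith)).mul_left ((3 / 4 : ℝ) ^ s.re)⁻¹
    refine this.congr fun n => ?_
    rw [norm_one, one_div, Real.mul_rpow (by norm_num) (by positivity), mul_inv,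
      ← Real.rpow_natCast, ← Real.rpow_mul (by positivity)]
    norm_num

end

/-! ### An elementary Bessel integral -/

section

open MeasureTheory Set

theorem bijOn_mul_sub_div {k b : ℝ} (hk : 0 < k) (hb : 0 < b) :
    InjOn (fun u : ℝ => k * u - b / u) (Ioi 0) ∧ (fun u : ℝ => k * u - b / u) '' Ioi 0 = univ := by
  constructor
  · have : StrictMonoOn (fun u : ℝ => k * u - b / u) (Ioi 0) := by
      intro x (hx : 0 < x) y (hy : 0 < y) hxy
      have h1 : b / y < b / x := div_lt_div_of_pos_left hb hx hxy
      have h2 : k * x < k * y := mul_lt_mul_of_pos_left hxy hk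
      simp only
      linarith
    exact this.injOn
  · refine eq_univ_of_forall fun y => ?_
    have hs : y ^ 2 < y ^ 2 + 4 * k * b := by nlinarith [mul_pos hk hb]
    have hy : |y| < √(y ^ 2 + 4 * k * b) := by
      rw [← Real.sqrt_sq_eq_abs]
      exact Real.sqrt_lt_sqrt (sq_nonneg y) hs
    have hq := Real.sq_sqrt ((sq_nonneg y).trans hs.le)
    set w := √(y ^ 2 + 4 * k * b)
    have hp : 0 < y + w := by linarith [neg_abs_le y]
    -- The positive root of `k u² - y u - b = 0`.
    refine ⟨(y + w) / (2 * k), by simp only [mem_Ioi]; positivity, ?_⟩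
    simp only
    field_simp
    nlinarith

/-- The Cauchy–Schlömilch substitution. The map `v = k u - b / u` carries the half-line onto the
real line with density `k + b / u²`, so against that density the Gaussian integrates to 1. The
involution `u ↦ b / (k u)` changes the sign of `v` and exchanges the two parts of the density, so
each part contributes 1/2. -/
theorem integral_exp_neg_sq_sub {k b : ℝ} (hk : 0 < k) (hb : 0 < b) :
    ∫ u in Ioi (0 : ℝ), Real.exp (-Real.pi * (k * u - b / u) ^ 2) = 1 / (2 * k) := by
  obtain ⟨hi, hs⟩ := bijOn_mul_sub_div hk hb
  set g : ℝ → ℝ := fun u => Real.exp (-Real.pi * (k * u - b / u) ^ 2) with hg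
  have hd : ∀ u ∈ Ioi (0 : ℝ), HasDerivWithinAt (fun u : ℝ => k * u - b / u)
      (k + b / u ^ 2) (Ioi 0) u := by
    intro u (hu : 0 < u)
    have h1 := ((hasDerivAt_id u).const_mul k).sub ((hasDerivAt_inv hu.ne').const_mul b)
    refine HasDerivAt.hasDerivWithinAt ?_
    convert! h1 using 1
    simp
    field_simp
  have h1 := integral_image_eq_integral_abs_deriv_smul measurableSet_Ioi hd hi
    (fun y => Real.exp (-Real.pi * y ^ 2))
  rw [hs, Measure.restrict_univ, integral_gaussian, div_self Real.pi_ne_zero, Real.sqrt_one] at h1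
  have h2 : ∫ u in Ioi (0 : ℝ), (k + b / u ^ 2) * g u = 1 := by
    rw [h1]
    refine setIntegral_congr_fun measurableSet_Ioi fun u (hu : 0 < u) => ?_
    simp only [hg, smul_eq_mul]
    rw [abs_of_pos (by positivity)]
  -- The Bochner integral of a non-integrable function is 0, so the value 1 already proves
  -- integrability.
  have hint : IntegrableOn (fun u => (k + b / u ^ 2) * g u) (Ioi 0) := by
    by_contra h
    rw [integral_undef h] at h2
    exact zero_ne_one h2
  have hm : Measurable g := by fun_prop
  have hint1 : IntegrableOn (fun u => k * g u) (Ioi 0) := by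
    refine Integrable.mono' hint (by fun_prop) ((ae_restrict_iff' measurableSet_Ioi).2
      (ae_of_all _ fun u (hu : 0 < u) => ?_))
    have : 0 < g u := Real.exp_pos _
    rw [Real.norm_of_nonneg (by positivity)]
    exact mul_le_mul_of_nonneg_right (by have : 0 < b / u ^ 2 := by positivity
                                         linarith) this.le
  have hint2 : IntegrableOn (fun u => b / u ^ 2 * g u) (Ioi 0) := by
    refine (hint.sub hint1).congr (ae_of_all _ fun u => ?_)
    simp only [Pi.sub_apply]
    ring
  have h3 : ∫ u in Ioi (0 : ℝ), b / u ^ 2 * g u = ∫ u in Ioi (0 : ℝ), k * g u := by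
    have hbij : (fun u : ℝ => b / k / u) '' Ioi 0 = Ioi 0 := by
      ext v
      constructor
      · rintro ⟨u, hu : 0 < u, rfl⟩
        simp only [mem_Ioi]
        positivity
      · intro (hv : 0 < v)
        refine ⟨b / k / v, by simp only [mem_Ioi]; positivity, ?_⟩
        simp only
        field_simp
    have hinj : InjOn (fun u : ℝ => b / k / u) (Ioi 0) := by
      intro x (hx : 0 < x) y (hy : 0 < y) hxy
      simp only at hxy
      field_simp at hxy
      exact hxy.symm
    have hder : ∀ u ∈ Ioi (0 : ℝ), HasDerivWithinAt (fun u : ℝ => b / k / u)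
        (-(b / k / u ^ 2)) (Ioi 0) u := by
      intro u (hu : 0 < u)
      refine HasDerivAt.hasDerivWithinAt ?_
      convert! (hasDerivAt_inv hu.ne').const_mul (b / k) using 1
      field_simp
    have h := integral_image_eq_integral_abs_deriv_smul measurableSet_Ioi hder hinj
      (fun u => k * g u)
    rw [hbij] at h
    rw [h]
    refine setIntegral_congr_fun measurableSet_Ioi fun u (hu : 0 < u) => ?_
    have e : g (b / k / u) = g u := by
      simp only [hg]
      congr 2
      have : k * (b / k / u) - b / (b / k / u) = -(k * u - b / u) := by
        field_simp
        ring
      rw [this, neg_sq]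
    simp only [smul_eq_mul]
    rw [abs_neg, abs_of_pos (by positivity), e]
    field_simp
  have h4 : ∫ u in Ioi (0 : ℝ), (k + b / u ^ 2) * g u =
      (∫ u in Ioi (0 : ℝ), k * g u) + ∫ u in Ioi (0 : ℝ), b / u ^ 2 * g u := by
    rw [← integral_add hint1 hint2]
    refine integral_congr_ae (ae_of_all _ fun u => ?_)
    simp only
    ring
  rw [h2, h3, integral_const_mul] at h4
  rw [eq_div_iff (by positivity)]
  linarith

/-- Substitute `u = t ^ (-1/2)` and use `k²/t + b² t = (k u - b/u)² + 2 b k`. This is the closed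
form of the Bessel function `K` of order 1/2. -/
theorem integral_rpow_mul_exp_mul_exp {k b : ℝ} (hk : 0 < k) (hb : 0 < b) :
    ∫ t in Ioi (0 : ℝ), t ^ (-(3 / 2) : ℝ) * (Real.exp (-(Real.pi * b ^ 2 * t)) *
      Real.exp (-(Real.pi * t⁻¹ * k ^ 2))) = Real.exp (-(2 * Real.pi * b * k)) / k := by
  have h := integral_comp_rpow_Ioi (fun u => Real.exp (-Real.pi * (k * u - b / u) ^ 2))
    (p := -(1 / 2)) (by norm_num)
  rw [integral_exp_neg_sq_sub hk hb] at h
  have e : ∀ t ∈ Ioi (0 : ℝ), t ^ (-(3 / 2) : ℝ) * (Real.exp (-(Real.pi * b ^ 2 * t)) *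
      Real.exp (-(Real.pi * t⁻¹ * k ^ 2))) = 2 * Real.exp (-(2 * Real.pi * b * k)) *
      ((|(-(1 / 2) : ℝ)| * t ^ ((-(1 / 2) : ℝ) - 1)) • Real.exp (-Real.pi *
        (k * t ^ (-(1 / 2) : ℝ) - b / t ^ (-(1 / 2) : ℝ)) ^ 2)) := by
    intro t (ht : 0 < t)
    have h1 : (t ^ (-(1 / 2) : ℝ)) = (√t)⁻¹ := by
      rw [Real.rpow_neg ht.le, Real.sqrt_eq_rpow]
    have h2 := Real.sq_sqrt ht.le
    have h3 : 0 < √t := Real.sqrt_pos.2 ht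
    have h4 : (k * (√t)⁻¹ - b / (√t)⁻¹) ^ 2 = k ^ 2 * t⁻¹ + b ^ 2 * t - 2 * b * k := by
      have : ∀ w : ℝ, 0 < w →
          (k * w⁻¹ - b / w⁻¹) ^ 2 = k ^ 2 * (w ^ 2)⁻¹ + b ^ 2 * w ^ 2 - 2 * b * k := by
        intro w hw
        field_simp
        ring
      have := this √t h3
      rwa [h2] at this
    rw [h1, h4, show (-(1 / 2) : ℝ) - 1 = -(3 / 2) by norm_num, smul_eq_mul,
      show |(-(1 / 2) : ℝ)| = 1 / 2 by rw [abs_neg]; norm_num, ← Real.exp_add]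
    rw [show 2 * Real.exp (-(2 * Real.pi * b * k)) * (1 / 2 * t ^ (-(3 / 2) : ℝ) *
      Real.exp (-Real.pi * (k ^ 2 * t⁻¹ + b ^ 2 * t - 2 * b * k))) = t ^ (-(3 / 2) : ℝ) *
      (Real.exp (-(2 * Real.pi * b * k)) *
      Real.exp (-Real.pi * (k ^ 2 * t⁻¹ + b ^ 2 * t - 2 * b * k))) by ring, ← Real.exp_add]
    congr 2
    ring
  rw [setIntegral_congr_fun measurableSet_Ioi e, integral_const_mul, h]
  field_simp

theorem integrableOn_rpow_mul_exp_mul_exp {k b : ℝ} (hk : 0 < k) (hb : 0 < b) :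
    IntegrableOn (fun t : ℝ => t ^ (-(3 / 2) : ℝ) * (Real.exp (-(Real.pi * b ^ 2 * t)) *
      Real.exp (-(Real.pi * t⁻¹ * k ^ 2)))) (Ioi 0) := by
  by_contra h
  have := integral_rpow_mul_exp_mul_exp hk hb
  rw [integral_undef h] at this
  have h2 : 0 < Real.exp (-(2 * Real.pi * b * k)) / k := by positivity
  linarith

end

/-! ### The value of the Mellin transform at zero, and the eta function -/

section

open MeasureTheory Set

/-- The value `-exp (-π √3)` of `exp (2 π i z)` at `z = (-3 + i √3) / 2`. -/
noncomputable def hexNome : ℝ := -Real.exp (-(Real.pi * √3))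

theorem abs_hexNome_lt_one : |hexNome| < 1 := by
  rw [hexNome, abs_neg, abs_of_pos (Real.exp_pos _), Real.exp_lt_one_iff]
  have : 0 < Real.pi * √3 := by positivity
  linarith

theorem summable_pow_mul_div {r : ℝ} (hr : |r| < 1) :
    Summable fun p : ℕ+ × ℕ+ => r ^ ((p.1 : ℕ) * p.2) / p.2 := by
  have h := summable_prod_mul_pow (𝕜 := ℝ) 0 (r := |r|) (by simpa using hr)
  refine Summable.of_norm_bounded h fun p => ?_
  have hp : (1 : ℝ) ≤ p.2 := by exact Nat.one_le_cast.2 p.2.pos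
  rw [norm_div, norm_pow, Real.norm_eq_abs, Real.norm_of_nonneg (by positivity)]
  simp only [pow_zero, one_mul]
  exact div_le_self (by positivity) hp

/-- Lambert series: group the pairs by their product `n = a b`, where `1 / b = a / n`. -/
theorem hasSum_pow_mul_div {r : ℝ} (hr : |r| < 1) :
    HasSum (fun n : ℕ+ => r ^ (n : ℕ) / n * ∑ d ∈ (n : ℕ).divisors, (d : ℝ))
      (∑' p : ℕ+ × ℕ+, r ^ ((p.1 : ℕ) * p.2) / p.2) := by
  have h := (summable_pow_mul_div hr).hasSum
  rw [← sigmaAntidiagonalEquivProd.hasSum_iff] at h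
  refine h.sigma fun n => ?_
  have h2 := hasSum_fintype (fun x : Nat.divisorsAntidiagonal n =>
    r ^ (n : ℕ) / n * ((x.1.1 : ℕ) : ℝ))
  rw [← Finset.mul_sum, Finset.sum_coe_sort (Nat.divisorsAntidiagonal n)
    (fun x => ((x.1 : ℕ) : ℝ)), Nat.sum_divisorsAntidiagonal (fun d _ => (d : ℝ))] at h2
  refine h2.congr_fun fun x => ?_
  obtain ⟨⟨a, b⟩, hx⟩ := x
  rw [Nat.mem_divisorsAntidiagonal] at hx
  have hab : a * b = n := hx.1
  have hb : (b : ℝ) ≠ 0 := by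
    rintro h
    have : b = 0 := by exact_mod_cast h
    rw [this, mul_zero] at hab
    exact hx.2 hab.symm
  have ha : (a : ℝ) ≠ 0 := by
    rintro h
    have : a = 0 := by exact_mod_cast h
    rw [this, zero_mul] at hab
    exact hx.2 hab.symm
  have hn : ((n : ℕ) : ℝ) = a * b := by exact_mod_cast hab.symm
  simp only [Function.comp_apply, sigmaAntidiagonalEquivProd, divisorsAntidiagonalFactors,
    Equiv.coe_fn_mk, PNat.mk_coe, hab]
  rw [hn]
  field_simp

/-- Termwise integration with parameters `√3/2 * p.1` and `p.2` in the Bessel integral. The sign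
`(-1) ^ (p.1 p.2)` joins `exp (-π√3 p.1 p.2)` to form a power of `hexNome`. The interchange is
justified by the same series with `|hexNome|`. -/
theorem hasSum_mellin_hexTheta_zero :
    HasSum (fun p : ℕ+ × ℕ+ => ((2 * (hexNome ^ ((p.1 : ℕ) * p.2) / p.2) : ℝ) : ℂ))
      (mellin hexTheta 0) := by
  have e0 : ∀ p : ℕ+ × ℕ+, ∀ t ∈ Ioi (0 : ℝ), (t : ℂ) ^ ((0 : ℂ) - 1) • (hexThetaTerm p t : ℂ) =
      ((2 * (-1) ^ ((p.1 : ℕ) * p.2) * (t ^ (-(3 / 2) : ℝ) *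
        (Real.exp (-(Real.pi * ((√3 / 2) * p.1) ^ 2 * t)) *
          Real.exp (-(Real.pi * t⁻¹ * (p.2 : ℝ) ^ 2)))) : ℝ) : ℂ) := by
    intro p t (ht : 0 < t)
    have h1 : (t : ℂ) ^ ((0 : ℂ) - 1) = ((t ^ (-1 : ℝ) : ℝ) : ℂ) := by
      rw [Complex.ofReal_cpow ht.le]
      norm_num
    rw [h1, smul_eq_mul, ← Complex.ofReal_mul, Complex.ofReal_inj, hexThetaTerm,
      show (-(3 / 2) : ℝ) = -1 + -(1 / 2) by norm_num, Real.rpow_add ht, mul_pow, div_pow,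
      Real.sq_sqrt (by norm_num : (0 : ℝ) ≤ 3),
      show Real.pi * (3 / 2 ^ 2 * (p.1 : ℝ) ^ 2) * t = Real.pi * (3 / 4) * t * (p.1 : ℝ) ^ 2 by
        ring]
    ring
  have pos1 : ∀ p : ℕ+ × ℕ+, (0 : ℝ) < √3 / 2 * p.1 := fun p => by
    have : (0 : ℝ) < p.1 := by exact_mod_cast p.1.pos
    positivity
  have pos2 : ∀ p : ℕ+ × ℕ+, (0 : ℝ) < p.2 := fun p => by exact_mod_cast p.2.pos
  have ev : ∀ p : ℕ+ × ℕ+, Real.exp (-(2 * Real.pi * (√3 / 2 * p.1) * p.2)) =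
      Real.exp (-(Real.pi * √3)) ^ ((p.1 : ℕ) * p.2) := by
    intro p
    rw [← Real.exp_nat_mul]
    congr 1
    push_cast
    ring
  have h := hasSum_integral_of_summable_integral_norm (μ := volume.restrict (Ioi (0 : ℝ)))
    (F := fun (p : ℕ+ × ℕ+) (t : ℝ) => (t : ℂ) ^ ((0 : ℂ) - 1) • (hexThetaTerm p t : ℂ))
    (fun p => ?_) ?_
  · convert! h using 1
    · funext p
      rw [setIntegral_congr_fun measurableSet_Ioi (e0 p), integral_complex_ofReal,
        integral_const_mul, integral_rpow_mul_exp_mul_exp (pos2 p) (pos1 p), ev, hexNome,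
        neg_pow (Real.exp _)]
      congr 1
      ring
    · rw [mellin]
      refine integral_congr_ae (ae_of_all _ fun t => ?_)
      simp only [hexTheta, smul_eq_mul]
      rw [tsum_mul_left]
  · refine IntegrableOn.congr_fun ?_ (fun t ht => (e0 p t ht).symm) measurableSet_Ioi
    exact ((integrableOn_rpow_mul_exp_mul_exp (pos2 p) (pos1 p)).const_mul _).ofReal
  · have hs := (summable_pow_mul_div (r := Real.exp (-(Real.pi * √3))) (by
      have := abs_hexNome_lt_one
      rwa [hexNome, abs_neg] at this)).mul_left 2
    refine hs.congr fun p => ?_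
    rw [setIntegral_congr_fun measurableSet_Ioi (g := fun t : ℝ => 2 * (t ^ (-(3 / 2) : ℝ) *
        (Real.exp (-(Real.pi * ((√3 / 2) * p.1) ^ 2 * t)) *
          Real.exp (-(Real.pi * t⁻¹ * (p.2 : ℝ) ^ 2)))))]
    · rw [integral_const_mul, integral_rpow_mul_exp_mul_exp (pos2 p) (pos1 p), ev]
    · intro t (ht : 0 < t)
      simp only
      rw [e0 p t ht, Complex.norm_real, norm_mul, norm_mul, norm_pow]
      have : 0 < t ^ (-(3 / 2) : ℝ) := by positivity
      rw [Real.norm_of_nonneg (by positivity : 0 ≤ t ^ (-(3 / 2) : ℝ) *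
        (Real.exp (-(Real.pi * ((√3 / 2) * p.1) ^ 2 * t)) *
          Real.exp (-(Real.pi * t⁻¹ * (p.2 : ℝ) ^ 2))))]
      norm_num

theorem hexNome_pow_div (n : ℕ+) : hexNome ^ (n : ℕ) / n =
    (-1 : ℝ) ^ (n : ℕ) / (n * Real.exp (Real.pi * n * √3)) := by
  rw [hexNome, neg_pow, ← Real.exp_nat_mul, mul_comm (n : ℝ) (Real.exp _), ← div_div]
  congr 1
  rw [div_eq_mul_inv, ← Real.exp_neg]
  congr 2
  ring

theorem hasSum_hexNome : HasSum (fun n : ℕ+ => (-1 : ℝ) ^ (n : ℕ) /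
      (n * Real.exp (Real.pi * n * √3)) * ∑ d ∈ (n : ℕ).divisors, (d : ℝ))
      (∑' p : ℕ+ × ℕ+, hexNome ^ ((p.1 : ℕ) * p.2) / p.2) := by
  have := hasSum_pow_mul_div abs_hexNome_lt_one
  simpa only [hexNome_pow_div] using this

theorem mellin_hexTheta_zero : mellin hexTheta 0 =
    ((2 * ∑' n : ℕ+, (-1 : ℝ) ^ (n : ℕ) / (n * Real.exp (Real.pi * n * √3)) *
      ∑ d ∈ (n : ℕ).divisors, (d : ℝ) : ℝ) : ℂ) := by
  rw [hasSum_hexNome.tsum_eq, ← hasSum_mellin_hexTheta_zero.tsum_eq, ← Complex.ofReal_tsum,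
    tsum_mul_left]

/-- Expand each `log (1 - qⁿ)` of the eta product in powers of `q`, which gives minus the double
series evaluated above. The prefactor `exp (2πi z / 24)` contributes the linear term because `Im z =
√3 / 2`. -/
theorem log_norm_eta :
    Real.log ‖ModularForm.eta ((-3 + Complex.I * (√3 : ℝ)) / 2)‖ = -(Real.pi * √3 / 24) -
      ∑' n : ℕ+, (-1 : ℝ) ^ (n : ℕ) / (n * Real.exp (Real.pi * n * √3)) *
        ∑ d ∈ (n : ℕ).divisors, (d : ℝ) := by
  set z : ℂ := (-3 + Complex.I * (√3 : ℝ)) / 2 with hz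
  have hq : ∀ n, 1 - ModularForm.eta_q n z = ((1 - hexNome ^ (n + 1) : ℝ) : ℂ) := by
    intro n
    rw [ModularForm.eta_q_eq_pow]
    have : Complex.exp (2 * Real.pi * Complex.I * z) = (hexNome : ℂ) := by
      -- Here `-3πi` is split as `πi - 2 * (2πi)`, so the exponential has sign -1 and the nome is
      -- real.
      rw [hz, hexNome, show 2 * (Real.pi : ℂ) * Complex.I * ((-3 + Complex.I * (√3 : ℝ)) / 2) =
        Real.pi * Complex.I + ((-(Real.pi * √3) : ℝ) : ℂ) + ((-2 : ℤ) : ℂ) * (2 * Real.pi * Complex.I) by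
          push_cast
          linear_combination (Real.pi : ℂ) * (√3 : ℝ) * Complex.I_mul_I,
        Complex.exp_add, Complex.exp_add, Complex.exp_int_mul_two_pi_mul_I, Complex.exp_pi_mul_I]
      push_cast
      ring
    rw [this]
    push_cast
    rfl
  have hlt : ∀ n : ℕ, |hexNome ^ (n + 1)| < 1 := fun n => by
    rw [abs_pow]
    exact pow_lt_one₀ (abs_nonneg _) abs_hexNome_lt_one (Nat.succ_ne_zero n)
  have hpos : ∀ n : ℕ, 0 < 1 - hexNome ^ (n + 1) := fun n => by
    linarith [(abs_lt.1 (hlt n)).2]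
  have hs : Summable fun p : ℕ × ℕ => hexNome ^ ((p.1 + 1) * (p.2 + 1)) / ((p.2 : ℝ) + 1) := by
    have := (summable_pow_mul_div abs_hexNome_lt_one)
    rw [← (Equiv.pnatEquivNat.symm.prodCongr Equiv.pnatEquivNat.symm).summable_iff] at this
    refine this.congr fun p => ?_
    simp [Equiv.pnatEquivNat]
  have hinner : ∀ n : ℕ, HasSum (fun k : ℕ => hexNome ^ ((n + 1) * (k + 1)) / ((k : ℝ) + 1))
      (-Real.log (1 - hexNome ^ (n + 1))) := fun n => by
    simpa only [← pow_mul] using Real.hasSum_pow_div_log_of_abs_lt_one (hlt n)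
  have hsum := hs.hasSum.prod_fiberwise hinner
  have htot : ∑' p : ℕ × ℕ, hexNome ^ ((p.1 + 1) * (p.2 + 1)) / ((p.2 : ℝ) + 1) =
      ∑' p : ℕ+ × ℕ+, hexNome ^ ((p.1 : ℕ) * p.2) / p.2 := by
    rw [← (Equiv.pnatEquivNat.symm.prodCongr Equiv.pnatEquivNat.symm).tsum_eq]
    refine tsum_congr fun p => ?_
    simp [Equiv.pnatEquivNat]
  rw [htot, ← hasSum_hexNome.tsum_eq] at hsum
  have hlog : HasSum (fun n : ℕ => Real.log (1 - hexNome ^ (n + 1)))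
      (-∑' n : ℕ+, (-1 : ℝ) ^ (n : ℕ) / (n * Real.exp (Real.pi * n * √3)) *
        ∑ d ∈ (n : ℕ).divisors, (d : ℝ)) := by
    simpa using hsum.neg
  have hprod := Real.hasProd_of_hasSum_log hpos hlog
  have hprodC : ∏' n, (1 - ModularForm.eta_q n z) =
      ((Real.exp (-∑' n : ℕ+, (-1 : ℝ) ^ (n : ℕ) / (n * Real.exp (Real.pi * n * √3)) *
        ∑ d ∈ (n : ℕ).divisors, (d : ℝ)) : ℝ) : ℂ) := by
    simp_rw [hq]
    exact (hprod.map Complex.ofRealHom Complex.continuous_ofReal).tprod_eq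
  have hqp : ‖Function.Periodic.qParam 24 z‖ = Real.exp (-(Real.pi * √3 / 24)) := by
    rw [Function.Periodic.norm_qParam, hz]
    congr 1
    have : ((-3 + Complex.I * (√3 : ℝ)) / 2 : ℂ).im = √3 / 2 := by
      simp
    rw [this]
    ring
  rw [ModularForm.eta, hprodC, norm_mul, hqp, Complex.norm_real,
    Real.norm_of_nonneg (Real.exp_pos _).le, ← Real.exp_add, Real.log_exp]
  ring

end

/-! ### Continuation of the lattice zeta function and its derivative at zero -/

section

open Filter Topology

theorem hexForm_pnat_pos (p : ℕ+ × ℕ+) : 0 < hexForm (p.1 : ℕ) (p.2 : ℕ) :=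
  hexForm_pos (Or.inl (by exact_mod_cast p.1.ne_zero))

/-- With `n > 0` the half-plane is cut by the rays `m = 0` and `m = -n` into the sectors `m > 0`,
`-n < m < 0` and `m < -n`. An automorphism of the form takes each open sector to the positive
quadrant, and on the two rays the form equals `n²`. -/
theorem tsum_half_hexForm {F : ℤ → ℂ}
    (hF : Summable fun x : ℕ+ × ℤ => F (hexForm x.2 (x.1 : ℕ))) :
    (Summable fun p : ℕ+ × ℕ+ => F (hexForm (p.1 : ℕ) (p.2 : ℕ))) ∧
    ∑' x : ℕ+ × ℤ, F (hexForm x.2 (x.1 : ℕ)) =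
      3 * ∑' p : ℕ+ × ℕ+, F (hexForm (p.1 : ℕ) (p.2 : ℕ)) +
      2 * ∑' n : ℕ+, F (((n : ℕ) : ℤ) ^ 2) := by
  set f : ℕ+ × ℤ → ℂ := fun x => F (hexForm x.2 (x.1 : ℕ)) with hf
  set P : ℂ := ∑' p : ℕ+ × ℕ+, F (hexForm (p.1 : ℕ) (p.2 : ℕ)) with hP
  set N : ℂ := ∑' n : ℕ+, F (((n : ℕ) : ℤ) ^ 2) with hN
  -- An injective parametrization of a piece `S` turns the parameter sum into the sum of the
  -- indicator of `S` times `f`; the five indicators will add up to `f`.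
  have key : ∀ {ι : Type} (g : ι → ℕ+ × ℤ) (S : Set (ℕ+ × ℤ)), Function.Injective g →
      (∀ i, g i ∈ S) → (∀ x ∈ S, ∃ i, g i = x) →
      HasSum (S.indicator f) (∑' i, f (g i)) := by
    intro ι g S hg h1 h2
    have e : ∑' i, f (g i) = ∑' x, S.indicator f x := by
      rw [← hg.tsum_eq (f := S.indicator f)]
      · exact tsum_congr fun i => (Set.indicator_of_mem (h1 i) f).symm
      · intro x hx
        exact h2 x (Set.mem_of_indicator_ne_zero hx)
    rw [e]
    exact (hF.indicator S).hasSum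
  have e1 := key (fun p : ℕ+ × ℕ+ => (p.2, ((p.1 : ℕ) : ℤ))) {x | 0 < x.2}
    (fun p q h => by
      simp only [Prod.mk.injEq, Nat.cast_inj, PNat.coe_inj] at h
      exact Prod.ext h.2 h.1)
    (fun p => by simp)
    (fun x (hx : 0 < x.2) => ⟨(⟨x.2.toNat, by omega⟩, x.1), by
      ext <;> simp [hx.le]⟩)
  have e2 := key (fun n : ℕ+ => (n, (0 : ℤ))) {x | x.2 = 0}
    (fun p q h => by simpa using h) (fun p => by simp)
    (fun x (hx : x.2 = 0) => ⟨x.1, by ext <;> simp [hx]⟩)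
  have e3 := key (fun p : ℕ+ × ℕ+ => (p.1 + p.2, -((p.1 : ℕ) : ℤ)))
    {x | x.2 < 0 ∧ 0 < x.2 + (x.1 : ℕ)}
    (fun p q h => by
      simp only [Prod.mk.injEq, neg_inj, Nat.cast_inj, PNat.coe_inj] at h
      refine Prod.ext h.2 ?_
      have := h.1
      rw [h.2] at this
      exact add_left_cancel this)
    (fun p => by simp)
    (fun x hx => by
      obtain ⟨h1, h2⟩ := hx
      refine ⟨(⟨(-x.2).toNat, by omega⟩, ⟨(x.2 + (x.1 : ℕ)).toNat, by omega⟩), ?_⟩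
      ext
      · refine PNat.coe_injective ?_
        change (-x.2).toNat + (x.2 + (x.1 : ℕ)).toNat = (x.1 : ℕ)
        omega
      · simp only [PNat.mk_coe]
        omega)
  have e4 := key (fun n : ℕ+ => (n, -((n : ℕ) : ℤ))) {x | x.2 + (x.1 : ℕ) = 0}
    (fun p q h => by
      simp only [Prod.mk.injEq] at h
      exact h.1) (fun p => by simp)
    (fun x (hx : x.2 + (x.1 : ℕ) = 0) => ⟨x.1, by
      ext
      · rfl
      · simp only
        omega⟩)
  have e5 := key (fun p : ℕ+ × ℕ+ => (p.2, -((p.1 : ℕ) : ℤ) - ((p.2 : ℕ) : ℤ)))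
    {x | x.2 + (x.1 : ℕ) < 0}
    (fun p q h => by
      simp only [Prod.mk.injEq] at h
      obtain ⟨h1, h2⟩ := h
      rw [h1] at h2
      refine Prod.ext ?_ h1
      have : ((p.1 : ℕ) : ℤ) = (q.1 : ℕ) := by omega
      exact PNat.coe_injective (by exact_mod_cast this))
    (fun p => by simp)
    (fun x (hx : x.2 + (x.1 : ℕ) < 0) => ⟨(⟨(-(x.2 + (x.1 : ℕ))).toNat, by omega⟩, x.1), by
      ext
      · rfl
      · simp only [PNat.mk_coe]
        omega⟩)
  have s1 : Summable fun p : ℕ+ × ℕ+ => F (hexForm (p.1 : ℕ) (p.2 : ℕ)) :=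
    hF.comp_injective (i := fun p : ℕ+ × ℕ+ => (p.2, ((p.1 : ℕ) : ℤ))) fun p q h => by
      simp only [Prod.mk.injEq, Nat.cast_inj, PNat.coe_inj] at h
      exact Prod.ext h.2 h.1
  refine ⟨s1, ?_⟩
  have r3 : ∀ p : ℕ+ × ℕ+, f (p.1 + p.2, -((p.1 : ℕ) : ℤ)) = F (hexForm (p.1 : ℕ) (p.2 : ℕ)) := by
    intro p
    simp only [hf]
    congr 1
    simp only [hexForm, PNat.add_coe]
    push_cast
    ring
  have r5 : ∀ p : ℕ+ × ℕ+, f (p.2, -((p.1 : ℕ) : ℤ) - ((p.2 : ℕ) : ℤ)) =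
      F (hexForm (p.1 : ℕ) (p.2 : ℕ)) := by
    intro p
    simp only [hf]
    congr 1
    simp only [hexForm]
    ring
  have r2 : ∀ n : ℕ+, f (n, (0 : ℤ)) = F (((n : ℕ) : ℤ) ^ 2) := by
    intro n
    simp [hf, hexForm]
  have r4 : ∀ n : ℕ+, f (n, -((n : ℕ) : ℤ)) = F (((n : ℕ) : ℤ) ^ 2) := by
    intro n
    simp only [hf]
    congr 1
    simp only [hexForm]
    ring
  simp_rw [r2] at e2
  simp_rw [r3] at e3
  simp_rw [r4] at e4
  simp_rw [r5] at e5
  have htot := (((e1.add e2).add e3).add e4).add e5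
  have hfun : (fun x => {x : ℕ+ × ℤ | 0 < x.2}.indicator f x +
      {x : ℕ+ × ℤ | x.2 = 0}.indicator f x +
      {x : ℕ+ × ℤ | x.2 < 0 ∧ 0 < x.2 + (x.1 : ℕ)}.indicator f x +
      {x : ℕ+ × ℤ | x.2 + (x.1 : ℕ) = 0}.indicator f x +
      {x : ℕ+ × ℤ | x.2 + (x.1 : ℕ) < 0}.indicator f x) = f := by
    funext x
    have hx : (0 : ℤ) < (x.1 : ℕ) := by exact_mod_cast x.1.pos
    simp only [Set.indicator_apply, Set.mem_ofPred_eq]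
    rcases lt_trichotomy x.2 0 with h | h | h
    · rcases lt_trichotomy (x.2 + (x.1 : ℕ)) 0 with h' | h' | h'
      · simp [h, h', h.not_gt, h.ne, h'.ne, h'.not_gt]
      · simp [h, h', h.not_gt, h.ne]
      · simp [h, h', h.not_gt, h.ne, h'.ne', h'.not_gt]
    · have h1 : x.2 + (x.1 : ℕ) ≠ 0 := by omega
      have h2 : ¬ x.2 + (x.1 : ℕ) < 0 := by omega
      simp [h, hx.not_gt]
    · have h1 : x.2 + (x.1 : ℕ) ≠ 0 := by omega
      have h2 : ¬ x.2 + (x.1 : ℕ) < 0 := by omega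
      simp [h, h.ne', h.not_gt, h1, h2]
  rw [hfun] at htot
  rw [htot.tsum_eq]
  simp only [hf, ← hP, ← hN]
  ring

/-- The sum `∑ (c (m² + mn + n²))⁻ˢ` over positive `m`, `n`, continued to the complex plane. -/
noncomputable def hexZeta (c : ℝ) (s : ℂ) : ℂ :=
  (c : ℂ) ^ (-s) * (-(2 / 3) * riemannZeta (2 * s) + 1 / 3 * ((Real.pi : ℂ) ^ s *
    (Complex.Gamma s)⁻¹ * (mellin hexTheta s +
      ((3 / 4 : ℝ) : ℂ) ^ (1 / 2 - s) * completedRiemannZeta (2 * s - 1))))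

theorem hasSum_hexZeta {c : ℝ} (hc : 0 < c) {s : ℂ} (hs : 1 < s.re) :
    HasSum (fun p : ℕ+ × ℕ+ => ((c * hexForm (p.1 : ℕ) (p.2 : ℕ) : ℝ) : ℂ) ^ (-s))
      (hexZeta c s) := by
  have h := mellin_hexTheta_add hs
  have hpi : (Real.pi : ℂ) ^ s ≠ 0 := by simp [Complex.cpow_eq_zero_iff, Real.pi_ne_zero]
  have hG : Complex.Gamma s ≠ 0 := Complex.Gamma_ne_zero_of_re_pos (by linarith)
  have hpsi := mellin_hexPsi (s := s - 1 / 2) (by norm_num; linarith)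
  rw [hpsi, show -(s - 1 / 2) = 1 / 2 - s by ring, show 2 * (s - 1 / 2) = 2 * s - 1 by ring] at h
  have h' := h.mul_left ((Real.pi : ℂ) ^ s * (Complex.Gamma s)⁻¹)
  have e : ∀ x : ℕ+ × ℤ, (Real.pi : ℂ) ^ s * (Complex.Gamma s)⁻¹ *
      ((Real.pi : ℂ) ^ (-s) * Complex.Gamma s * 1 / ((hexForm x.2 (x.1 : ℕ) : ℝ) : ℂ) ^ s) =
      (((hexForm x.2 (x.1 : ℕ) : ℤ) : ℝ) : ℂ) ^ (-s) := by
    intro x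
    rw [Complex.cpow_neg, Complex.cpow_neg]
    field_simp
  simp_rw [e] at h'
  obtain ⟨h1, h2⟩ := tsum_half_hexForm (F := fun k => ((k : ℝ) : ℂ) ^ (-s)) h'.summable
  rw [h'.tsum_eq] at h2
  have hz : ∑' n : ℕ+, (((((n : ℕ) : ℤ) ^ 2 : ℤ) : ℝ) : ℂ) ^ (-s) = riemannZeta (2 * s) := by
    rw [zeta_eq_tsum_one_div_nat_add_one_cpow (by simp; linarith)]
    have := tsum_pnat_eq_tsum_succ (f := fun n : ℕ => 1 / (n : ℂ) ^ (2 * s))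
    push_cast at this
    rw [← this]
    refine tsum_congr fun n => ?_
    have := Complex.natCast_cpow_natCast_mul n 2 (-s)
    push_cast at this ⊢
    rw [← this, mul_neg, Complex.cpow_neg, one_div]
  rw [hz] at h2
  have h3 := h1.hasSum.mul_left ((c : ℂ) ^ (-s))
  convert! h3 using 1
  · funext p
    have := hexForm_pnat_pos p
    have : (0 : ℝ) ≤ hexForm (p.1 : ℕ) (p.2 : ℕ) := by exact_mod_cast this.le
    rw [Complex.ofReal_mul, Complex.mul_cpow_ofReal_nonneg hc.le this]
  · rw [hexZeta]
    congr 1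
    linear_combination (1 / 3 : ℂ) * h2

/-- The exceptional points come from the pole of `ζ` at `2s = 1` and those of the completed zeta
function at `2s - 1 = 0` and `2s - 1 = 1`. -/
theorem analyticAt_hexZeta {c : ℝ} (hc : 0 < c) {s : ℂ} (h1 : s ≠ 1) (h2 : s ≠ 1 / 2) :
    AnalyticAt ℂ (hexZeta c) s := by
  have hU : IsOpen {s : ℂ | s ≠ 1 ∧ s ≠ 1 / 2} := isOpen_ne.inter isOpen_ne
  refine DifferentiableOn.analyticAt (s := {s : ℂ | s ≠ 1 ∧ s ≠ 1 / 2}) (fun z hz => ?_)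
    (hU.mem_nhds ⟨h1, h2⟩)
  refine DifferentiableAt.differentiableWithinAt ?_
  have hc' : (c : ℂ) ≠ 0 := by exact_mod_cast hc.ne'
  have hpi : (Real.pi : ℂ) ≠ 0 := by exact_mod_cast Real.pi_ne_zero
  have d1 : DifferentiableAt ℂ (fun s : ℂ => riemannZeta (2 * s)) z :=
    DifferentiableAt.comp (g := riemannZeta) (f := fun s : ℂ => 2 * s) z (differentiableAt_riemannZeta fun h => hz.2 (by linear_combination h / 2))
      (by fun_prop)
  have d2 : DifferentiableAt ℂ (fun s : ℂ => completedRiemannZeta (2 * s - 1)) z :=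
    DifferentiableAt.comp (g := completedRiemannZeta) (f := fun s : ℂ => 2 * s - 1) z (differentiableAt_completedZeta
      (fun h => hz.2 (by linear_combination h / 2))
      (fun h => hz.1 (by linear_combination h / 2)))
      (by fun_prop)
  have d3 := Complex.differentiable_one_div_Gamma z
  have d4 := differentiable_mellin_hexTheta z
  have d5 : DifferentiableAt ℂ (fun s : ℂ => (c : ℂ) ^ (-s)) z :=
    (differentiableAt_id.neg).const_cpow (Or.inl hc')
  have d6 : DifferentiableAt ℂ (fun s : ℂ => (Real.pi : ℂ) ^ s) z :=
    differentiableAt_id.const_cpow (Or.inl hpi)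
  have d7 : DifferentiableAt ℂ (fun s : ℂ => ((3 / 4 : ℝ) : ℂ) ^ (1 / 2 - s)) z :=
    (differentiableAt_id.const_sub _).const_cpow (Or.inl (by norm_num))
  unfold hexZeta
  fun_prop

/-- Both zeta factors are expressed through the entire function `completedRiemannZeta₀` and rational
functions, which handles the poles. -/
theorem meromorphicOn_hexZeta {c : ℝ} (hc : 0 < c) : MeromorphicOn (hexZeta c) Set.univ := by
  intro z _
  have hc' : (c : ℂ) ≠ 0 := by exact_mod_cast hc.ne'
  have hpi : (Real.pi : ℂ) ≠ 0 := by exact_mod_cast Real.pi_ne_zero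
  have of_diff : ∀ {f : ℂ → ℂ}, Differentiable ℂ f → MeromorphicAt f z := fun hf =>
    (hf.analyticAt z).meromorphicAt
  have hL : Differentiable ℂ completedRiemannZeta₀ := differentiable_completedZeta₀
  have m1 : MeromorphicAt (fun s : ℂ => riemannZeta (2 * s)) z := by
    have : (fun s : ℂ => riemannZeta (2 * s)) = fun s : ℂ =>
        ((2 * s) * completedRiemannZeta₀ (2 * s) - 1 - (2 * s) / (1 - 2 * s)) *
        ((2 : ℂ)⁻¹ * (Real.pi : ℂ) ^ s * (Complex.Gamma (s + 1))⁻¹) := by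
      funext s
      rw [riemannZeta_eq_mul_completedRiemannZeta₀, div_eq_mul_inv, mul_inv, mul_inv,
        show -(2 * s) / 2 = -s by ring, show 2 * s / 2 + 1 = s + 1 by ring, Complex.cpow_neg,
        inv_inv]
    rw [this]
    have a1 : MeromorphicAt (fun s : ℂ => (2 * s) * completedRiemannZeta₀ (2 * s) - 1) z :=
      of_diff (by fun_prop)
    have a2 : MeromorphicAt (fun s : ℂ => 2 * s) z := of_diff (by fun_prop)
    have a3 : MeromorphicAt (fun s : ℂ => 1 - 2 * s) z := of_diff (by fun_prop)
    have a4 : MeromorphicAt (fun s : ℂ => (2 : ℂ)⁻¹ * (Real.pi : ℂ) ^ s *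
        (Complex.Gamma (s + 1))⁻¹) z := of_diff fun s => by
      have d3 := (Complex.differentiable_one_div_Gamma (s + 1)).comp s
        (f := fun s => s + 1) (by fun_prop)
      have d6 : DifferentiableAt ℂ (fun s : ℂ => (Real.pi : ℂ) ^ s) s :=
        differentiableAt_id.const_cpow (Or.inl hpi)
      exact (d6.const_mul _).mul d3
    exact (a1.sub (a2.div a3)).mul a4
  have m2 : MeromorphicAt (fun s : ℂ => completedRiemannZeta (2 * s - 1)) z := by
    have : (fun s : ℂ => completedRiemannZeta (2 * s - 1)) = fun s : ℂ =>
        completedRiemannZeta₀ (2 * s - 1) - 1 / (2 * s - 1) - 1 / (2 - 2 * s) := by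
      funext s
      rw [completedRiemannZeta_eq, show 1 - (2 * s - 1) = 2 - 2 * s by ring]
    rw [this]
    have a1 : MeromorphicAt (fun s : ℂ => completedRiemannZeta₀ (2 * s - 1)) z :=
      of_diff (by fun_prop)
    have a2 : MeromorphicAt (fun s : ℂ => 2 * s - 1) z := of_diff (by fun_prop)
    have a3 : MeromorphicAt (fun s : ℂ => 2 - 2 * s) z := of_diff (by fun_prop)
    have a4 : MeromorphicAt (fun _ : ℂ => (1 : ℂ)) z := of_diff (by fun_prop)
    exact (a1.sub (a4.div a2)).sub (a4.div a3)
  have m3 : MeromorphicAt (fun s : ℂ => (Complex.Gamma s)⁻¹) z :=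
    of_diff Complex.differentiable_one_div_Gamma
  have m4 := of_diff differentiable_mellin_hexTheta
  have m5 : MeromorphicAt (fun s : ℂ => (c : ℂ) ^ (-s)) z :=
    of_diff fun s => (differentiableAt_id.neg).const_cpow (Or.inl hc')
  have m6 : MeromorphicAt (fun s : ℂ => (Real.pi : ℂ) ^ s) z :=
    of_diff fun s => differentiableAt_id.const_cpow (Or.inl hpi)
  have m7 : MeromorphicAt (fun s : ℂ => ((3 / 4 : ℝ) : ℂ) ^ (1 / 2 - s)) z :=
    of_diff fun s => (differentiableAt_id.const_sub _).const_cpow (Or.inl (by norm_num))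
  have m8 : ∀ a : ℂ, MeromorphicAt (fun _ : ℂ => a) z := fun a => of_diff (by fun_prop)
  exact m5.mul (((m8 _).mul m1).add ((m8 _).mul ((m6.mul m3).mul (m4.add (m7.mul m2)))))

theorem hasDerivAt_inv_Gamma_zero : HasDerivAt (fun s : ℂ => (Complex.Gamma s)⁻¹) 1 0 := by
  have d3 := ((Complex.differentiable_one_div_Gamma (0 + 1)).comp (0 : ℂ)
        (f := fun s => s + 1) (by fun_prop)).hasDerivAt
  have := (hasDerivAt_id (0 : ℂ)).mul d3
  rw [show (fun s : ℂ => (Complex.Gamma s)⁻¹) = fun s : ℂ => s * (Complex.Gamma (s + 1))⁻¹ from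
    funext Complex.one_div_Gamma_eq_self_mul_one_div_Gamma_add_one]
  convert! this using 1
  simp

/-- The functional equation moves the point to 2, where `ζ(2) = π² / 6`. -/
theorem completedRiemannZeta_neg_one : completedRiemannZeta (-1) = Real.pi / 6 := by
  have hpi : (Real.pi : ℂ) ≠ 0 := by exact_mod_cast Real.pi_ne_zero
  rw [show (-1 : ℂ) = 1 - 2 by norm_num, completedRiemannZeta_one_sub]
  have h := riemannZeta_def_of_ne_zero (s := 2) two_ne_zero
  rw [riemannZeta_two, Complex.Gammaℝ_def] at h
  norm_num [Complex.cpow_neg_one] at h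
  field_simp at h ⊢
  linear_combination -h

/-- The function `1 / Γ` has value 0 and derivative 1 at 0, so the Mellin part contributes its value
`M 0` and none of its derivatives. The remaining terms use `ζ(0) = -1/2` and `ζ'(0) = -log (2π) /
2`. -/
theorem deriv_hexZeta_zero {c : ℝ} (hc : 0 < c) : deriv (hexZeta c) 0 =
    ((-(1 / 3) * Real.log c + 2 / 3 * Real.log (2 * Real.pi) + Real.pi * √3 / 36 +
      2 / 3 * ∑' n : ℕ+, (-1 : ℝ) ^ (n : ℕ) / (n * Real.exp (Real.pi * n * √3)) *
      ∑ d ∈ (n : ℕ).divisors, (d : ℝ) : ℝ) : ℂ) := by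
  have hc' : (c : ℂ) ≠ 0 := by exact_mod_cast hc.ne'
  have hpi : (Real.pi : ℂ) ≠ 0 := by exact_mod_cast Real.pi_ne_zero
  have g1 : HasDerivAt (fun s : ℂ => (c : ℂ) ^ (-s)) (-Complex.log c) 0 := by
    have := (hasDerivAt_neg (0 : ℂ)).const_cpow (c := (c : ℂ)) (Or.inl hc')
    simpa using this
  have g2 : HasDerivAt (fun s : ℂ => riemannZeta (2 * s))
      (-Complex.log (2 * Real.pi) / 2 * 2) 0 := by
    have h0 : HasDerivAt riemannZeta (-Complex.log (2 * Real.pi) / 2) (2 * 0) := by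
      rw [mul_zero, ← deriv_riemannZeta_zero]
      exact (differentiableAt_riemannZeta zero_ne_one).hasDerivAt
    have := h0.comp (0 : ℂ) ((hasDerivAt_id (0 : ℂ)).const_mul 2)
    simpa [Function.comp_def] using this
  set M : ℂ → ℂ := fun s => mellin hexTheta s +
      ((3 / 4 : ℝ) : ℂ) ^ (1 / 2 - s) * completedRiemannZeta (2 * s - 1) with hM
  have dM : DifferentiableAt ℂ (fun s => (Real.pi : ℂ) ^ s * M s) 0 := by
    have d2 : DifferentiableAt ℂ (fun s : ℂ => completedRiemannZeta (2 * s - 1)) 0 :=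
      DifferentiableAt.comp (g := completedRiemannZeta) (f := fun s : ℂ => 2 * s - 1) 0 (differentiableAt_completedZeta (by norm_num) (by norm_num))
        (by fun_prop)
    have d4 := differentiable_mellin_hexTheta 0
    have d6 : DifferentiableAt ℂ (fun s : ℂ => (Real.pi : ℂ) ^ s) 0 :=
      differentiableAt_id.const_cpow (Or.inl hpi)
    have d7 : DifferentiableAt ℂ (fun s : ℂ => ((3 / 4 : ℝ) : ℂ) ^ (1 / 2 - s)) 0 :=
      (differentiableAt_id.const_sub _).const_cpow (Or.inl (by norm_num))
    fun_prop
  have g3 := dM.hasDerivAt.mul hasDerivAt_inv_Gamma_zero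
  have g4 := g1.mul ((g2.const_mul (-(2 / 3))).add (g3.const_mul (1 / 3)))
  have heq : hexZeta c = (fun s : ℂ => (c : ℂ) ^ (-s)) * ((fun s => -(2 / 3) * riemannZeta (2 * s))
      + fun s => 1 / 3 * ((fun s => (Real.pi : ℂ) ^ s * M s) * fun s => (Complex.Gamma s)⁻¹) s) := by
    funext s
    simp only [hexZeta, hM, Pi.mul_apply, Pi.add_apply]
    ring
  have hM0 : M 0 = mellin hexTheta 0 + ((√3 / 2 * Real.pi / 6 : ℝ) : ℂ) := by
    simp only [hM]
    have : ((3 / 4 : ℝ) : ℂ) ^ (1 / 2 - (0 : ℂ)) = ((√3 / 2 : ℝ) : ℂ) := by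
      have h : (√3 / 2 : ℝ) = (3 / 4 : ℝ) ^ (1 / 2 : ℝ) := by
        rw [← Real.sqrt_eq_rpow, Real.sqrt_div (by norm_num),
          show (4 : ℝ) = 2 ^ 2 by norm_num, Real.sqrt_sq (by norm_num)]
      rw [h, Complex.ofReal_cpow (by norm_num)]
      norm_num
    rw [this, show 2 * (0 : ℂ) - 1 = -1 by norm_num, completedRiemannZeta_neg_one]
    push_cast
    ring
  rw [heq, g4.deriv]
  simp only [Pi.mul_apply, Pi.add_apply, mul_zero, riemannZeta_zero, Complex.Gamma_zero,
    neg_zero, Complex.cpow_zero, inv_zero]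
  rw [hM0, mellin_hexTheta_zero, ← Complex.ofReal_log hc.le,
    show (2 * Real.pi : ℂ) = ((2 * Real.pi : ℝ) : ℂ) by push_cast; rfl,
    ← Complex.ofReal_log (by positivity)]
  push_cast
  ring

theorem exists_hexZeta_continuation {c : ℝ} (hc : 0 < c) : ∃ Z : ℂ → ℂ,
    MeromorphicNFOn Z Set.univ ∧
    (∀ s : ℂ, 1 < s.re → HasSum (fun p : ℕ+ × ℕ+ =>
      ((c * hexForm (p.1 : ℕ) (p.2 : ℕ) : ℝ) : ℂ) ^ (-s)) (Z s)) ∧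
    AnalyticAt ℂ Z 0 ∧ deriv Z 0 =
    ((-(1 / 3) * Real.log c + 2 / 3 * Real.log (2 * Real.pi) + Real.pi * √3 / 36 +
      2 / 3 * ∑' n : ℕ+, (-1 : ℝ) ^ (n : ℕ) / (n * Real.exp (Real.pi * n * √3)) *
      ∑ d ∈ (n : ℕ).divisors, (d : ℝ) : ℝ) : ℂ) := by
  have hm := meromorphicOn_hexZeta hc
  have hloc : ∀ s : ℂ, s ≠ 1 → s ≠ 1 / 2 →
      toMeromorphicNFOn (hexZeta c) Set.univ =ᶠ[𝓝 s] hexZeta c := fun s h1 h2 => by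
    have h := toMeromorphicNFOn_eq_toMeromorphicNFAt_on_nhds hm (Set.mem_univ s)
    rwa [toMeromorphicNFAt_eq_self.2 (analyticAt_hexZeta hc h1 h2).meromorphicNFAt] at h
  have h0 := hloc 0 (by norm_num) (by norm_num)
  refine ⟨toMeromorphicNFOn (hexZeta c) Set.univ, meromorphicNFOn_toMeromorphicNFOn _ _,
    fun s hs => ?_, (analyticAt_hexZeta hc (by norm_num) (by norm_num)).congr h0.symm, ?_⟩
  · rw [(hloc s (fun h => by simp [h] at hs) (fun h => by norm_num [h] at hs)).eq_of_nhds]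
    exact hasSum_hexZeta hc hs
  · rw [h0.deriv_eq, deriv_hexZeta_zero hc]

/-- The difference has infinite order at `z`, hence everywhere by connectedness. Equality on
punctured neighbourhoods extends to their centres because both functions are in normal form. -/
theorem MeromorphicNFOn.eq_of_eventuallyEq {f g : ℂ → ℂ} (hf : MeromorphicNFOn f Set.univ)
    (hg : MeromorphicNFOn g Set.univ) {z : ℂ} (h : f =ᶠ[𝓝 z] g) : f = g := by
  have hm : MeromorphicOn (f - g) Set.univ := hf.meromorphicOn.sub hg.meromorphicOn
  have hz : meromorphicOrderAt (f - g) z = ⊤ := by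
    rw [meromorphicOrderAt_eq_top_iff]
    filter_upwards [h.filter_mono nhdsWithin_le_nhds] with x hx
    simp [hx]
  funext w
  have hw : meromorphicOrderAt (f - g) w = ⊤ := by
    by_contra hne
    exact hm.meromorphicOrderAt_ne_top_of_isPreconnected isPreconnected_univ (Set.mem_univ w)
      (Set.mem_univ z) hne hz
  rw [meromorphicOrderAt_eq_top_iff] at hw
  refine (((hf (Set.mem_univ w)).eventuallyEq_nhdsNE_iff_eventuallyEq_nhds
    (hg (Set.mem_univ w))).1 ?_).eq_of_nhds
  filter_upwards [hw] with x hx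
  exact sub_eq_zero.1 hx

end

/-! ### Triangles in barycentric coordinates and integration over them -/

section

open MeasureTheory Set

/-- The Euclidean plane. -/
abbrev Plane := EuclideanSpace ℝ (Fin 2)

namespace AffineBasis

variable (b : AffineBasis (Fin 3) ℝ Plane)

/-- The closed triangle spanned by an affine basis of the plane. -/
def triangle : Set Plane := convexHull ℝ (range b)

theorem triangle_eq : b.triangle = {x | ∀ i, 0 ≤ b.coord i x} := b.convexHull_eq_nonneg_coord

theorem interior_triangle : interior b.triangle = {x | ∀ i, 0 < b.coord i x} :=
  b.interior_convexHull

theorem isCompact_triangle : IsCompact b.triangle := (finite_range b).isCompact_convexHull ℝ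

theorem convex_triangle : Convex ℝ b.triangle := convex_convexHull ℝ _

theorem measurableSet_triangle : MeasurableSet b.triangle := b.isCompact_triangle.measurableSet

theorem sum_coord (x : Plane) : b.coord 0 x + b.coord 1 x + b.coord 2 x = 1 := by
  have := b.sum_coord_apply_eq_one x
  rwa [Fin.sum_univ_three] at this

theorem eq_combination (x : Plane) : x = b 0 + (b.coord 1 x • (b 1 - b 0) +
    b.coord 2 x • (b 2 - b 0)) := by
  have h := b.linear_combination_coord_eq_self x
  rw [Fin.sum_univ_three] at h
  have h0 : b.coord 0 x = 1 - b.coord 1 x - b.coord 2 x := by linarith [b.sum_coord x]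
  conv_lhs => rw [← h]
  rw [h0]
  module

theorem ext_coord {x y : Plane} (h1 : b.coord 1 x = b.coord 1 y) (h2 : b.coord 2 x = b.coord 2 y) :
    x = y := by
  rw [b.eq_combination x, b.eq_combination y, h1, h2]

/-- The linear part of a barycentric coordinate. -/
noncomputable def coordL (i : Fin 3) : Plane →L[ℝ] ℝ :=
  LinearMap.toContinuousLinearMap (b.coord i).linear

theorem coord_add (i : Fin 3) (x v : Plane) : b.coord i (x + v) = b.coord i x + b.coordL i v := by
  have := (b.coord i).map_vadd x v
  simp only [vadd_eq_add] at this
  rw [add_comm x v, this, add_comm]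
  rfl

theorem coordL_sub (i : Fin 3) (x y : Plane) : b.coordL i (x - y) = b.coord i x - b.coord i y := by
  have := b.coord_add i y (x - y)
  rw [add_sub_cancel] at this
  linarith

theorem coordL_vertex (i j k : Fin 3) : b.coordL i (b j - b k) =
    (if i = j then 1 else 0) - if i = k then 1 else 0 := by
  rw [coordL_sub, b.coord_apply, b.coord_apply]

/-- The linear parametrization of the plane by two edges of a triangle. -/
noncomputable def edgeEquiv : (ℝ × ℝ) ≃ₗ[ℝ] Plane where
  toFun z := z.1 • (b 1 - b 0) + z.2 • (b 2 - b 0)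
  map_add' z w := by simp only [Prod.fst_add, Prod.snd_add]; module
  map_smul' c z := by simp only [Prod.smul_fst, Prod.smul_snd, smul_eq_mul, RingHom.id_apply]; module
  invFun x := (b.coordL 1 x, b.coordL 2 x)
  left_inv z := by
    ext <;> simp [b.coordL_vertex]
  right_inv x := by
    have h := b.eq_combination (b 0 + x)
    rw [b.coord_add, b.coord_add] at h
    have h1 : b.coord 1 (b 0) = 0 := b.coord_apply_ne (by decide)
    have h2 : b.coord 2 (b 0) = 0 := b.coord_apply_ne (by decide)
    rw [h1, h2, zero_add, zero_add] at h
    exact (add_left_cancel h).symm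

/-- The affine parametrization of the plane by two edges of a triangle. -/
noncomputable def edgePoint (s t : ℝ) : Plane := b 0 + b.edgeEquiv (s, t)

theorem edgePoint_eq (s t : ℝ) :
    b.edgePoint s t = b 0 + s • (b 1 - b 0) + t • (b 2 - b 0) := by
  rw [edgePoint, add_assoc]
  rfl

theorem coord_edgePoint (s t : ℝ) : b.coord 1 (b.edgePoint s t) = s ∧
    b.coord 2 (b.edgePoint s t) = t ∧ b.coord 0 (b.edgePoint s t) = 1 - s - t := by
  have h1 : b.coord 1 (b.edgePoint s t) = s := by
    rw [edgePoint_eq, b.coord_add, b.coord_add, map_smul, map_smul, b.coordL_vertex,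
      b.coordL_vertex, b.coord_apply_ne (by decide)]
    simp
  have h2 : b.coord 2 (b.edgePoint s t) = t := by
    rw [edgePoint_eq, b.coord_add, b.coord_add, map_smul, map_smul, b.coordL_vertex,
      b.coordL_vertex, b.coord_apply_ne (by decide)]
    simp
  refine ⟨h1, h2, ?_⟩
  have := b.sum_coord (b.edgePoint s t)
  linarith

theorem edgePoint_mem_triangle {s t : ℝ} :
    b.edgePoint s t ∈ b.triangle ↔ 0 ≤ s ∧ 0 ≤ t ∧ s + t ≤ 1 := by
  obtain ⟨h1, h2, h0⟩ := b.coord_edgePoint s t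
  rw [triangle_eq]
  constructor
  · intro (h : ∀ i, 0 ≤ b.coord i (b.edgePoint s t))
    have a0 := h 0
    have a1 := h 1
    have a2 := h 2
    rw [h0] at a0
    rw [h1] at a1
    rw [h2] at a2
    exact ⟨a1, a2, by linarith⟩
  · rintro ⟨a1, a2, a0⟩ i
    fin_cases i
    · simp only [Fin.zero_eta, h0]; linarith
    · simpa only [Fin.mk_one, h1]
    · simpa only [Fin.reduceFinMk, h2]

theorem edgePoint_mem_interior {s t : ℝ} :
    b.edgePoint s t ∈ interior b.triangle ↔ 0 < s ∧ 0 < t ∧ s + t < 1 := by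
  obtain ⟨h1, h2, h0⟩ := b.coord_edgePoint s t
  rw [interior_triangle]
  constructor
  · intro (h : ∀ i, 0 < b.coord i (b.edgePoint s t))
    have a0 := h 0
    have a1 := h 1
    have a2 := h 2
    rw [h0] at a0
    rw [h1] at a1
    rw [h2] at a2
    exact ⟨a1, a2, by linarith⟩
  · rintro ⟨a1, a2, a0⟩ i
    fin_cases i
    · simp only [Fin.zero_eta, h0]; linarith
    · simpa only [Fin.mk_one, h1]
    · simpa only [Fin.reduceFinMk, h2]

theorem exists_mem_interior_triangle : ∃ G, G ∈ interior b.triangle :=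
  ⟨b.edgePoint (1 / 3) (1 / 3), b.edgePoint_mem_interior.2 (by norm_num)⟩

theorem closure_interior_triangle : closure (interior b.triangle) = b.triangle := by
  rw [b.convex_triangle.closure_interior_eq_closure_of_nonempty_interior
    b.exists_mem_interior_triangle, b.isCompact_triangle.isClosed.closure_eq]

theorem continuous_edgePoint : Continuous fun z : ℝ × ℝ => b.edgePoint z.1 z.2 := by
  simp_rw [edgePoint_eq]
  fun_prop

/-- Uniqueness of Haar measure. The constant is left implicit, since later only estimates up to a
constant and vanishing integrals matter. -/
theorem exists_volume_eq_smul_map : ∃ κ : NNReal, (volume : Measure Plane) =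
    κ • Measure.map (fun z : ℝ × ℝ => b.edgePoint z.1 z.2) volume := by
  set L : (ℝ × ℝ) ≃L[ℝ] Plane := b.edgeEquiv.toContinuousLinearEquiv
  have hL : (Measure.map L (volume : Measure (ℝ × ℝ))).IsAddHaarMeasure :=
    L.isAddHaarMeasure_map volume
  have h := Measure.isAddLeftInvariant_eq_smul (volume : Measure Plane)
    (Measure.map L (volume : Measure (ℝ × ℝ)))
  refine ⟨Measure.addHaarScalarFactor volume (Measure.map L (volume : Measure (ℝ × ℝ))), ?_⟩
  have : Measure.map (fun z : ℝ × ℝ => b.edgePoint z.1 z.2) volume =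
      Measure.map (fun x => b 0 + x) (Measure.map L (volume : Measure (ℝ × ℝ))) := by
    rw [Measure.map_map (by fun_prop) (by fun_prop)]
    rfl
  rw [this, map_add_left_eq_self]
  exact h

/-- The standard closed triangle in coordinates. -/
def _root_.stdTriangle : Set (ℝ × ℝ) := {z | 0 ≤ z.1 ∧ 0 ≤ z.2 ∧ z.1 + z.2 ≤ 1}

theorem _root_.isCompact_stdTriangle : IsCompact stdTriangle := by
  refine (isCompact_Icc (a := ((0 : ℝ), (0 : ℝ))) (b := (1, 1))).of_isClosed_subset ?_ ?_
  · exact (isClosed_le continuous_const continuous_fst).inter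
      ((isClosed_le continuous_const continuous_snd).inter
      (isClosed_le (continuous_fst.add continuous_snd) continuous_const))
  · rintro z ⟨h1, h2, h3⟩
    exact ⟨⟨h1, h2⟩, ⟨by linarith, by linarith⟩⟩

theorem _root_.setIntegral_stdTriangle {g : ℝ × ℝ → ℂ} (hg : ContinuousOn g stdTriangle) :
    ∫ z in stdTriangle, g z = ∫ s in (0 : ℝ)..1, ∫ t in (0 : ℝ)..(1 - s), g (s, t) := by
  have hm := isCompact_stdTriangle.measurableSet
  have hi : Integrable (stdTriangle.indicator g) (volume.prod volume) := by
    rw [integrable_indicator_iff hm]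
    exact hg.integrableOn_compact isCompact_stdTriangle
  rw [← integral_indicator hm, Measure.volume_eq_prod, integral_prod _ hi,
    intervalIntegral.integral_of_le zero_le_one, ← integral_Icc_eq_integral_Ioc,
    ← integral_indicator measurableSet_Icc]
  refine integral_congr_ae (ae_of_all _ fun s => ?_)
  simp only
  by_cases hs : s ∈ Icc (0 : ℝ) 1
  · rw [indicator_of_mem hs, intervalIntegral.integral_of_le (by linarith [hs.2]),
      ← integral_Icc_eq_integral_Ioc, ← integral_indicator measurableSet_Icc]
    refine integral_congr_ae (ae_of_all _ fun t => ?_)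
    simp only
    by_cases ht : t ∈ Icc (0 : ℝ) (1 - s)
    · rw [indicator_of_mem ht, indicator_of_mem]
      exact ⟨hs.1, ht.1, by simp only; linarith [ht.2]⟩
    · rw [indicator_of_notMem ht, indicator_of_notMem]
      rintro ⟨h1, h2, h3⟩
      exact ht ⟨h2, by simp only at h3; linarith⟩
  · rw [indicator_of_notMem hs]
    refine integral_eq_zero_of_ae (ae_of_all _ fun t => ?_)
    refine indicator_of_notMem ?_ g
    rintro ⟨h1, h2, h3⟩
    simp only at h1 h2 h3
    exact hs ⟨h1, by linarith⟩

/-- Fubini with the inner integral along segments parallel to the edge `b 2 - b 0`, so that Green's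
formula becomes integration by parts on each segment. -/
theorem exists_setIntegral_triangle : ∃ κ : ℝ, 0 ≤ κ ∧ ∀ f : Plane → ℂ,
    ContinuousOn f b.triangle → ∫ x in b.triangle, f x =
      κ • ∫ s in (0 : ℝ)..1, ∫ t in (0 : ℝ)..(1 - s), f (b.edgePoint s t) := by
  obtain ⟨κ, h⟩ := b.exists_volume_eq_smul_map
  refine ⟨κ, κ.coe_nonneg, fun f hf => ?_⟩
  have hpre : (fun z : ℝ × ℝ => b.edgePoint z.1 z.2) ⁻¹' b.triangle = stdTriangle := by
    ext z
    exact b.edgePoint_mem_triangle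
  have hemb : MeasurableEmbedding fun z : ℝ × ℝ => b.edgePoint z.1 z.2 := by
    have h1 : MeasurableEmbedding b.edgeEquiv.toContinuousLinearEquiv :=
      b.edgeEquiv.toContinuousLinearEquiv.toHomeomorph.measurableEmbedding
    exact (MeasurableEquiv.addLeft (b 0)).measurableEmbedding.comp h1
  rw [h, Measure.restrict_smul, integral_smul_nnreal_measure, hemb.setIntegral_map, hpre,
    ← setIntegral_stdTriangle (g := fun z => f (b.edgePoint z.1 z.2))]
  · rfl
  refine hf.comp b.continuous_edgePoint.continuousOn ?_
  rw [← hpre]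
  exact mapsTo_preimage _ _

end AffineBasis

end

/-! ### Plane waves and Lamé's functions -/

section

open Complex Set
open scoped ContDiff

namespace AffineBasis

variable (b : AffineBasis (Fin 3) ℝ Plane)

/-- The phase of a plane wave with wave vector in the dual of the root lattice of a triangle. -/
noncomputable def phase (m n : ℤ) (x : Plane) : ℝ :=
  2 * Real.pi / 3 * ((2 * m + n) * b.coord 1 x + (m + 2 * n) * b.coord 2 x)

/-- The linear part of `phase`. -/
noncomputable def phaseL (m n : ℤ) : Plane →L[ℝ] ℝ :=
  (2 * Real.pi / 3) • ((2 * m + n : ℝ) • b.coordL 1 + (m + 2 * n : ℝ) • b.coordL 2)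

/-- A plane wave with wave vector in the dual of the root lattice of a triangle. -/
noncomputable def wave (m n : ℤ) (x : Plane) : ℂ := cexp (b.phase m n x * I)

theorem phase_add (m n : ℤ) (x v : Plane) :
    b.phase m n (x + v) = b.phase m n x + b.phaseL m n v := by
  simp only [phase, phaseL, b.coord_add, smul_apply,
    add_apply, smul_eq_mul]
  ring

theorem wave_mul (m n m' n' : ℤ) (x : Plane) :
    b.wave m n x * b.wave m' n' x = b.wave (m + m') (n + n') x := by
  rw [wave, wave, wave, ← Complex.exp_add]
  congr 1
  simp only [phase]
  push_cast
  ring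

theorem wave_zero (x : Plane) : b.wave 0 0 x = 1 := by simp [wave, phase]

theorem star_wave (m n : ℤ) (x : Plane) : star (b.wave m n x) = b.wave (-m) (-n) x := by
  rw [wave, wave, star_def, ← Complex.exp_conj]
  congr 1
  simp only [phase, map_mul, conj_ofReal, conj_I]
  push_cast
  ring

theorem contDiff_wave (m n : ℤ) : ContDiff ℝ ω (b.wave m n) := by
  have h : b.wave m n = fun x => cexp ((b.phase m n 0 + b.phaseL m n x : ℝ) * I) := by
    funext x
    rw [wave, ← b.phase_add, zero_add]
  rw [h]
  have h1 : ContDiff ℝ ω fun x => (b.phase m n 0 + b.phaseL m n x) :=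
    contDiff_const.add (b.phaseL m n).contDiff
  exact ((ofRealCLM.contDiff.comp h1).mul contDiff_const).cexp

end AffineBasis

theorem hasDerivAt_line {g : Plane → ℂ} {y v : Plane} {t : ℝ}
    (h : ContDiffAt ℝ 2 g (y + t • v)) :
    HasDerivAt (fun t : ℝ => g (y + t • v)) (fderiv ℝ g (y + t • v) v) t ∧
    HasDerivAt (fun t : ℝ => fderiv ℝ g (y + t • v) v)
      (iteratedFDeriv ℝ 2 g (y + t • v) ![v, v]) t := by
  have hl : HasDerivAt (fun t : ℝ => y + t • v) v t := by
    simpa using ((hasDerivAt_id t).smul_const v).const_add y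
  constructor
  · have h1 := (h.differentiableAt (by norm_num)).hasFDerivAt
    exact h1.comp_hasDerivAt t hl
  · have h1 : ContDiffAt ℝ 1 (fderiv ℝ g) (y + t • v) := h.fderiv_right (by norm_num)
    have h2 := (h1.differentiableAt (by norm_num)).hasFDerivAt
    have h3 : HasDerivAt (fun t : ℝ => fderiv ℝ g (y + t • v))
        (fderiv ℝ (fderiv ℝ g) (y + t • v) v) t := h2.comp_hasDerivAt t hl
    rw [iteratedFDeriv_two_apply]
    exact (ContinuousLinearMap.apply ℝ ℂ v).hasFDerivAt.comp_hasDerivAt t h3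

namespace AffineBasis

variable (b : AffineBasis (Fin 3) ℝ Plane)

theorem iteratedFDeriv_wave (m n : ℤ) (x v : Plane) :
    iteratedFDeriv ℝ 2 (b.wave m n) x ![v, v] = -((b.phaseL m n v : ℝ) : ℂ) ^ 2 * b.wave m n x := by
  have hw : ∀ t : ℝ, b.wave m n (x + t • v) =
      b.wave m n x * cexp (((t * b.phaseL m n v : ℝ) : ℂ) * I) := by
    intro t
    rw [wave, wave, ← Complex.exp_add, b.phase_add, map_smul, smul_eq_mul]
    congr 1
    push_cast
    ring
  have hd : ∀ t : ℝ, HasDerivAt (fun t : ℝ => b.wave m n (x + t • v))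
      ((b.phaseL m n v : ℝ) * I * b.wave m n (x + t • v)) t := by
    intro t
    have h1 : HasDerivAt (fun t : ℝ => ((t * b.phaseL m n v : ℝ) : ℂ) * I)
        ((b.phaseL m n v : ℝ) * I) t := by
      have := ((hasDerivAt_id t).mul_const (b.phaseL m n v)).ofReal_comp.mul_const I
      simpa using this
    have h2 := h1.cexp.const_mul (b.wave m n x)
    simp_rw [hw]
    convert! h2 using 1
    ring
  have hc : ∀ t : ℝ, ContDiffAt ℝ 2 (b.wave m n) (x + t • v) := fun t =>
    ((b.contDiff_wave m n).of_le le_top).contDiffAt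
  have e1 : ∀ t : ℝ, fderiv ℝ (b.wave m n) (x + t • v) v =
      (b.phaseL m n v : ℝ) * I * b.wave m n (x + t • v) := fun t =>
    (hasDerivAt_line (hc t)).1.unique (hd t)
  have h2 := (hasDerivAt_line (hc 0)).2
  simp_rw [e1] at h2
  have h3 := h2.unique ((hd 0).const_mul _)
  rw [zero_smul, add_zero] at h3
  rw [h3]
  linear_combination ((b.phaseL m n v : ℝ) : ℂ) ^ 2 * b.wave m n x * I_sq

/-- The triangle spanned by an affine basis is equilateral with sides of length `l`. -/
def IsEquilateral (l : ℝ) : Prop :=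
  dist (b 0) (b 1) = l ∧ dist (b 1) (b 2) = l ∧ dist (b 2) (b 0) = l

variable {b}

theorem IsEquilateral.inner_eq {l : ℝ} (h : b.IsEquilateral l) :
    inner ℝ (b 1 - b 0) (b 1 - b 0) = l ^ 2 ∧ inner ℝ (b 2 - b 0) (b 2 - b 0) = l ^ 2 ∧
    inner ℝ (b 1 - b 0) (b 2 - b 0) = l ^ 2 / 2 := by
  obtain ⟨h1, h2, h3⟩ := h
  rw [dist_comm, dist_eq_norm] at h1
  rw [dist_comm, dist_eq_norm] at h2
  rw [dist_eq_norm] at h3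
  refine ⟨by rw [real_inner_self_eq_norm_sq, h1], by rw [real_inner_self_eq_norm_sq, h3], ?_⟩
  have h4 := norm_sub_sq_real (b 2 - b 0) (b 1 - b 0)
  rw [sub_sub_sub_cancel_right, h1, h2, h3, real_inner_comm] at h4
  linarith

/-- The three edge directions of an equilateral triangle form a tight frame. Green's formula can
therefore be proved one edge direction at a time. -/
theorem IsEquilateral.laplacian_eq {l : ℝ} (h : b.IsEquilateral l) (hl : 0 < l) (f : Plane → ℂ)
    (x : Plane) : Laplacian.laplacian f x = ((2 / (3 * l ^ 2) : ℝ) : ℂ) *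
      (iteratedFDeriv ℝ 2 f x ![b 1 - b 0, b 1 - b 0] +
        iteratedFDeriv ℝ 2 f x ![b 2 - b 1, b 2 - b 1] +
        iteratedFDeriv ℝ 2 f x ![b 0 - b 2, b 0 - b 2]) := by
  obtain ⟨h1, h2, h3⟩ := h.inner_eq
  set p := b 1 - b 0 with hp
  set q := b 2 - b 0 with hq
  have e1 : b 2 - b 1 = q - p := by rw [hp, hq]; abel
  have e2 : b 0 - b 2 = -q := by rw [hq]; abel
  have hs : √3 ^ 2 = 3 := Real.sq_sqrt (by norm_num)
  have hs0 : √3 ≠ 0 := by positivity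
  -- Gram–Schmidt applied to two edges at an angle of 60°: `2q - p` is orthogonal to `p` and has
  -- length `l√3`.
  set v : Fin 2 → Plane := ![l⁻¹ • p, (l * √3)⁻¹ • ((2 : ℝ) • q - p)] with hv
  have hvo : Orthonormal ℝ v := by
    rw [orthonormal_iff_ite]
    intro i j
    have h3' : inner ℝ q p = l ^ 2 / 2 := by rw [real_inner_comm, h3]
    fin_cases i <;> fin_cases j <;>
      simp only [hv, Fin.zero_eta, Fin.mk_one, Matrix.cons_val_zero, Matrix.cons_val_one,
        Matrix.cons_val_fin_one, inner_smul_left, inner_smul_right, inner_sub_left,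
        inner_sub_right, h1, h2, h3, h3', conj_trivial] <;> norm_num <;> field_simp <;>
      norm_num
  have hcard : Fintype.card (Fin 2) = Module.finrank ℝ Plane := by simp
  have hsp : ⊤ ≤ Submodule.span ℝ (range v) :=
    (hvo.linearIndependent.span_eq_top_of_card_eq_finrank hcard).ge
  rw [InnerProductSpace.laplacian_eq_iteratedFDeriv_orthonormalBasis f
    (OrthonormalBasis.mk hvo hsp)]
  simp only [OrthonormalBasis.coe_mk, Fin.sum_univ_two, iteratedFDeriv_two_apply, e1, e2, hv,
    Matrix.cons_val_zero, Matrix.cons_val_one, map_smul, map_sub, map_neg,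
    smul_apply, sub_apply, neg_apply,
    Matrix.cons_val_fin_one, Complex.real_smul]
  have hl' : (l : ℂ) ≠ 0 := by exact_mod_cast hl.ne'
  have hs0' : ((√3 : ℝ) : ℂ) ≠ 0 := by exact_mod_cast hs0
  have hs' : ((√3 : ℝ) : ℂ) ^ 2 = 3 := by exact_mod_cast congrArg (Complex.ofReal) hs
  push_cast
  field_simp
  rw [hs']
  ring

variable (b) in
theorem phaseL_edges (m n : ℤ) : b.phaseL m n (b 1 - b 0) ^ 2 + b.phaseL m n (b 2 - b 1) ^ 2 +
    b.phaseL m n (b 0 - b 2) ^ 2 = 8 * Real.pi ^ 2 / 3 * hexForm m n := by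
  simp only [phaseL, smul_apply, add_apply, smul_eq_mul,
    b.coordL_vertex, hexForm, Fin.reduceEq, if_true, if_false]
  push_cast
  ring

theorem IsEquilateral.laplacian_wave {l : ℝ} (h : b.IsEquilateral l) (hl : 0 < l) (m n : ℤ)
    (x : Plane) : Laplacian.laplacian (b.wave m n) x =
      -((16 * Real.pi ^ 2 / (9 * l ^ 2) * hexForm m n : ℝ) : ℂ) * b.wave m n x := by
  have := congrArg Complex.ofReal (b.phaseL_edges m n)
  push_cast at this
  have hl' : (l : ℂ) ≠ 0 := by exact_mod_cast hl.ne'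
  rw [h.laplacian_eq hl, iteratedFDeriv_wave, iteratedFDeriv_wave, iteratedFDeriv_wave]
  push_cast
  rw [show (16 * (Real.pi : ℂ) ^ 2 / (9 * l ^ 2) * hexForm m n) = 2 / (3 * l ^ 2) *
    (8 * Real.pi ^ 2 / 3 * hexForm m n) by field_simp; ring, ← this]
  ring

variable (b)

/-- The antisymmetrization of a plane wave under the symmetric group of a triangle: Lamé's
trigonometric functions. -/
noncomputable def lame (m n : ℤ) : Plane → ℂ :=
  b.wave m n - b.wave (-m) (m + n) - b.wave (m + n) (-n) + b.wave n (-m - n) +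
    b.wave (-m - n) m - b.wave (-n) (-m)

theorem lame_apply (m n : ℤ) (x : Plane) : b.lame m n x =
    b.wave m n x - b.wave (-m) (m + n) x - b.wave (m + n) (-n) x + b.wave n (-m - n) x +
    b.wave (-m - n) m x - b.wave (-n) (-m) x := rfl

theorem lame_reflect_left (m n : ℤ) : b.lame (-m) (m + n) = -b.lame m n := by
  funext x
  simp only [Pi.neg_apply, lame_apply]
  ring_nf

theorem lame_reflect_right (m n : ℤ) : b.lame (m + n) (-n) = -b.lame m n := by
  funext x
  simp only [Pi.neg_apply, lame_apply]
  ring_nf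

theorem lame_zero_left (n : ℤ) : b.lame 0 n = 0 := by
  funext x
  simp only [lame_apply, Pi.zero_apply]
  ring_nf

theorem lame_zero_right (m : ℤ) : b.lame m 0 = 0 := by
  funext x
  simp only [lame_apply, Pi.zero_apply]
  ring_nf

theorem star_lame (m n : ℤ) : star (b.lame m n) = b.lame (-m) (-n) := by
  funext x
  simp only [Pi.star_apply, lame_apply, star_sub, star_add, star_wave]
  ring_nf

/-- The sum of the three plane waves that generate the trigonometric polynomials invariant under
the symmetric group of a triangle. -/
noncomputable def waveSum : Plane → ℂ := b.wave 1 0 + b.wave (-1) 1 + b.wave 0 (-1)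

/-- A symmetric orbit sum times an antisymmetric one is again antisymmetric. The three weights of
`waveSum` shift the index of the antisymmetrization. -/
theorem waveSum_mul_lame (m n : ℤ) :
    b.waveSum * b.lame m n = b.lame (m + 1) n + b.lame (m - 1) (n + 1) + b.lame m (n - 1) := by
  funext x
  simp only [waveSum, Pi.mul_apply, Pi.add_apply, lame_apply, add_mul, mul_add, mul_sub, wave_mul]
  ring_nf

theorem contDiff_lame (m n : ℤ) : ContDiff ℝ ω (b.lame m n) :=
  (((((b.contDiff_wave _ _).sub (b.contDiff_wave _ _)).sub (b.contDiff_wave _ _)).add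
    (b.contDiff_wave _ _)).add (b.contDiff_wave _ _)).sub (b.contDiff_wave _ _)

theorem wave_congr_of_coord_one {x : Plane} (h : b.coord 1 x = 0) {m n m' n' : ℤ}
    (e : m + 2 * n = m' + 2 * n') : b.wave m n x = b.wave m' n' x := by
  have e' : (m + 2 * n : ℝ) = m' + 2 * n' := by exact_mod_cast e
  simp only [wave, phase, h, e']
  ring_nf

theorem wave_congr_of_coord_two {x : Plane} (h : b.coord 2 x = 0) {m n m' n' : ℤ}
    (e : 2 * m + n = 2 * m' + n') : b.wave m n x = b.wave m' n' x := by
  have e' : (2 * m + n : ℝ) = 2 * m' + n' := by exact_mod_cast e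
  simp only [wave, phase, h, e']
  ring_nf

/-- This edge misses the origin `b 0` of the phase, and the two phases differ by `2π (m + n)` there.
The frequencies were chosen to be integral for this reason. -/
theorem wave_congr_of_coord_zero {x : Plane} (h : b.coord 0 x = 0) (m n : ℤ) :
    b.wave m n x = b.wave (-n) (-m) x := by
  have h2 : b.coord 2 x = 1 - b.coord 1 x := by linarith [b.sum_coord x]
  simp only [wave, phase, h2]
  rw [Complex.exp_eq_exp_iff_exists_int]
  refine ⟨m + n, ?_⟩
  push_cast
  ring

/-- The reflection in an edge pairs the six waves. On that edge paired waves coincide, and their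
signs are opposite. -/
theorem lame_eq_zero {m n : ℤ} {x : Plane} (hx : x ∈ b.triangle) (hx' : x ∉ interior b.triangle) :
    b.lame m n x = 0 := by
  rw [triangle_eq] at hx
  rw [interior_triangle, mem_ofPred_eq] at hx'
  push Not at hx'
  obtain ⟨i, hi⟩ := hx'
  have hi0 : b.coord i x = 0 := le_antisymm hi (hx i)
  rw [lame_apply]
  fin_cases i
  · rw [b.wave_congr_of_coord_zero hi0 m n, b.wave_congr_of_coord_zero hi0 (-m) (m + n),
      b.wave_congr_of_coord_zero hi0 (m + n) (-n)]
    ring_nf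
  · rw [b.wave_congr_of_coord_one hi0 (show m + 2 * n = -m + 2 * (m + n) by ring),
      b.wave_congr_of_coord_one hi0 (show m + n + 2 * (-n) = -m - n + 2 * m by ring),
      b.wave_congr_of_coord_one hi0 (show n + 2 * (-m - n) = -n + 2 * (-m) by ring)]
    ring
  · rw [b.wave_congr_of_coord_two hi0 (show 2 * m + n = 2 * (m + n) + -n by ring),
      b.wave_congr_of_coord_two hi0 (show 2 * (-m) + (m + n) = 2 * n + (-m - n) by ring),
      b.wave_congr_of_coord_two hi0 (show 2 * (-m - n) + m = 2 * (-n) + -m by ring)]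
    ring

end AffineBasis

end

/-! ### Green's formula for dilated functions -/

section

open MeasureTheory Set Filter Topology
open scoped ContDiff

namespace AffineBasis

variable (b : AffineBasis (Fin 3) ℝ Plane)

/-- Contracting towards an interior point moves the closed triangle into the open one, where `u` is
`C²`. Integration by parts is then legitimate up to the boundary. -/
theorem dilate_mem_interior {G x : Plane} (hG : G ∈ interior b.triangle) (hx : x ∈ b.triangle)
    {r : ℝ} (hr0 : 0 < r) (hr1 : r < 1) : G + r • (x - G) ∈ interior b.triangle := by
  rw [interior_triangle] at hG ⊢
  rw [triangle_eq] at hx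
  intro i
  rw [b.coord_add, map_smul, b.coordL_sub, smul_eq_mul]
  have h1 := mul_pos (sub_pos.2 hr1) (hG i)
  have h2 := mul_nonneg hr0.le (hx i)
  linarith

theorem continuousOn_iteratedFDeriv_dilate {u : Plane → ℂ}
    (hu : ContDiffOn ℝ 2 u (interior b.triangle)) {G : Plane} (hG : G ∈ interior b.triangle)
    {r : ℝ} (hr0 : 0 < r) (hr1 : r < 1) (v : Fin 2 → Plane) :
    ContinuousOn (fun x => u (G + r • (x - G))) b.triangle ∧
    ContinuousOn (fun x => iteratedFDeriv ℝ 2 u (G + r • (x - G)) v) b.triangle := by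
  have hz : ContinuousOn (fun x : Plane => G + r • (x - G)) b.triangle := by fun_prop
  have hm : MapsTo (fun x : Plane => G + r • (x - G)) b.triangle (interior b.triangle) :=
    fun x hx => b.dilate_mem_interior hG hx hr0 hr1
  have h2 : ContinuousOn (fun x => iteratedFDeriv ℝ 2 u x v) (interior b.triangle) := by
    intro x hx
    have h := (hu.contDiffAt (isOpen_interior.mem_nhds hx)).iteratedFDeriv_right (i := 2) (m := 0)
      (by norm_num)
    exact ((ContinuousMultilinearMap.apply ℝ (fun _ : Fin 2 => Plane) ℂ
      v).continuous.continuousAt.comp h.continuousAt).continuousWithinAt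
  exact ⟨hu.continuousOn.comp hz hm, h2.comp hz hm⟩

theorem continuous_iteratedFDeriv_apply {f : Plane → ℂ} (hf : ContDiff ℝ 2 f)
    (v : Fin 2 → Plane) : Continuous fun x => iteratedFDeriv ℝ 2 f x v :=
  (ContinuousMultilinearMap.apply ℝ (fun _ : Fin 2 => Plane) ℂ v).continuous.comp
    (hf.continuous_iteratedFDeriv (m := 2) le_rfl)

/-- Green's formula in the direction of an edge for a dilated function, as an estimate. -/
theorem exists_norm_integral_edge_le : ∃ C : ℝ, 0 ≤ C ∧ ∀ (u f : Plane → ℂ) (G : Plane)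
    (r ε K : ℝ), ContDiffOn ℝ 2 u (interior b.triangle) → G ∈ interior b.triangle → 0 < r →
    r < 1 → ContDiff ℝ 2 f → (∀ x ∈ b.triangle, x ∉ interior b.triangle → f x = 0) →
    (∀ x ∈ b.triangle, x ∉ interior b.triangle → ‖u (G + r • (x - G))‖ ≤ ε) →
    (∀ x ∈ b.triangle, ‖fderiv ℝ f x (b 2 - b 0)‖ ≤ K) →
    ‖∫ x in b.triangle, (u (G + r • (x - G)) * iteratedFDeriv ℝ 2 f x ![b 2 - b 0, b 2 - b 0] -
      f x * ((r : ℂ) ^ 2 * iteratedFDeriv ℝ 2 u (G + r • (x - G)) ![b 2 - b 0, b 2 - b 0]))‖ ≤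
      C * (ε * K) := by
  obtain ⟨κ, hκ, hint⟩ := b.exists_setIntegral_triangle
  refine ⟨κ * 2, by positivity, fun u f G r ε K hu hG hr0 hr1 hf hf0 hε hK => ?_⟩
  set e := b 2 - b 0 with he
  obtain ⟨cu, cu2⟩ := b.continuousOn_iteratedFDeriv_dilate hu hG hr0 hr1 ![e, e]
  have cf2 := continuous_iteratedFDeriv_apply hf ![e, e]
  have cF : ContinuousOn (fun x => u (G + r • (x - G)) * iteratedFDeriv ℝ 2 f x ![e, e] -
      f x * ((r : ℂ) ^ 2 * iteratedFDeriv ℝ 2 u (G + r • (x - G)) ![e, e])) b.triangle :=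
    (cu.mul cf2.continuousOn).sub (hf.continuous.continuousOn.mul
    ((continuousOn_const (c := (r : ℂ) ^ 2)).mul cu2))
  rw [hint _ cF, norm_smul, Real.norm_of_nonneg hκ, mul_assoc]
  refine mul_le_mul_of_nonneg_left ?_ hκ
  have hinner : ∀ s ∈ uIoc (0 : ℝ) 1, ‖∫ t in (0 : ℝ)..(1 - s), (u (G + r • (b.edgePoint s t - G)) *
      iteratedFDeriv ℝ 2 f (b.edgePoint s t) ![e, e] - f (b.edgePoint s t) * ((r : ℂ) ^ 2 *
      iteratedFDeriv ℝ 2 u (G + r • (b.edgePoint s t - G)) ![e, e]))‖ ≤ 2 * (ε * K) := by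
    intro s hs
    rw [uIoc_of_le zero_le_one] at hs
    obtain ⟨hs0, hs1⟩ := hs
    have hT : ∀ t ∈ Icc (0 : ℝ) (1 - s), b.edgePoint s t ∈ b.triangle := fun t ht =>
      b.edgePoint_mem_triangle.2 ⟨hs0.le, ht.1, by linarith [ht.2]⟩
    obtain ⟨y, hp⟩ : ∃ y, ∀ t, b.edgePoint s t = y + t • e :=
      ⟨b 0 + s • (b 1 - b 0), fun t => b.edgePoint_eq s t⟩
    have hq : ∀ t, G + r • (b.edgePoint s t - G) =
        G + r • (y - G) + t • (r • e) := fun t => by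
      rw [hp]
      module
    have d1 : ∀ t ∈ Icc (0 : ℝ) (1 - s), HasDerivAt (fun t => u (G + r • (b.edgePoint s t - G)))
        ((r : ℂ) * fderiv ℝ u (G + r • (b.edgePoint s t - G)) e) t ∧
        HasDerivAt (fun t => (r : ℂ) * fderiv ℝ u (G + r • (b.edgePoint s t - G)) e)
        ((r : ℂ) ^ 2 * iteratedFDeriv ℝ 2 u (G + r • (b.edgePoint s t - G)) ![e, e]) t := by
      intro t ht
      have hc := hu.contDiffAt (isOpen_interior.mem_nhds
        (b.dilate_mem_interior hG (hT t ht) hr0 hr1))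
      rw [hq] at hc
      obtain ⟨h1, h2⟩ := hasDerivAt_line hc
      have e1 : ∀ y, fderiv ℝ u y (r • e) = (r : ℂ) * fderiv ℝ u y e := fun y => by
        rw [map_smul, Complex.real_smul]
      have e2 : ∀ y, iteratedFDeriv ℝ 2 u y ![r • e, r • e] =
          (r : ℂ) ^ 2 * iteratedFDeriv ℝ 2 u y ![e, e] := fun y => by
        simp only [iteratedFDeriv_two_apply, Matrix.cons_val_zero, Matrix.cons_val_one,
          Matrix.cons_val_fin_one, map_smul, smul_apply, Complex.real_smul]
        ring
      simp_rw [e1] at h1 h2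
      rw [e2] at h2
      simp_rw [hq]
      exact ⟨h1, h2⟩
    have d2 : ∀ t, HasDerivAt (fun t => f (b.edgePoint s t))
        (fderiv ℝ f (b.edgePoint s t) e) t ∧
        HasDerivAt (fun t => fderiv ℝ f (b.edgePoint s t) e)
        (iteratedFDeriv ℝ 2 f (b.edgePoint s t) ![e, e]) t := by
      intro t
      simp_rw [hp]
      exact hasDerivAt_line hf.contDiffAt
    have h0 : f (b.edgePoint s 0) = 0 := hf0 _ (hT 0 ⟨le_rfl, by linarith⟩) fun h =>
      lt_irrefl _ (b.edgePoint_mem_interior.1 h).2.1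
    have hb0 : ‖u (G + r • (b.edgePoint s 0 - G))‖ ≤ ε := hε _ (hT 0 ⟨le_rfl, by linarith⟩)
      fun h => lt_irrefl _ (b.edgePoint_mem_interior.1 h).2.1
    have hn1 : b.edgePoint s (1 - s) ∉ interior b.triangle := fun h => by
      have := (b.edgePoint_mem_interior.1 h).2.2
      linarith
    have hm1 := hT (1 - s) ⟨by linarith, le_rfl⟩
    have h1 : f (b.edgePoint s (1 - s)) = 0 := hf0 _ hm1 hn1
    have hb1 := hε _ hm1 hn1
    have hcont : ContinuousOn (fun t => u (G + r • (b.edgePoint s t - G)) *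
        iteratedFDeriv ℝ 2 f (b.edgePoint s t) ![e, e] - f (b.edgePoint s t) * ((r : ℂ) ^ 2 *
        iteratedFDeriv ℝ 2 u (G + r • (b.edgePoint s t - G)) ![e, e])) (Icc 0 (1 - s)) :=
      cF.comp (f := fun t => b.edgePoint s t) (by simp_rw [edgePoint_eq]; fun_prop) hT
    -- The primitive is the Wronskian `u f' - f u'` along the segment. Its second term vanishes at
    -- both ends because `f` does, so no bound on the derivative of `u` is needed.
    have hFTC := intervalIntegral.integral_eq_sub_of_hasDerivAt (a := 0) (b := 1 - s)
      (f := fun t => u (G + r • (b.edgePoint s t - G)) * fderiv ℝ f (b.edgePoint s t) e -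
        f (b.edgePoint s t) * ((r : ℂ) * fderiv ℝ u (G + r • (b.edgePoint s t - G)) e))
      (f' := fun t => u (G + r • (b.edgePoint s t - G)) *
        iteratedFDeriv ℝ 2 f (b.edgePoint s t) ![e, e] - f (b.edgePoint s t) * ((r : ℂ) ^ 2 *
        iteratedFDeriv ℝ 2 u (G + r • (b.edgePoint s t - G)) ![e, e]))
      (fun t ht => by
        rw [uIcc_of_le (by linarith)] at ht
        have := ((d1 t ht).1.mul (d2 t).2).sub ((d2 t).1.mul (d1 t ht).2)
        convert! this using 1
        ring)
      (hcont.intervalIntegrable_of_Icc (by linarith))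
    rw [hFTC]
    simp only [h0, h1, zero_mul, sub_zero]
    have n1 : ‖u (G + r • (b.edgePoint s (1 - s) - G)) *
        fderiv ℝ f (b.edgePoint s (1 - s)) e‖ ≤ ε * K := by
      rw [norm_mul]
      exact mul_le_mul hb1 (hK _ hm1) (norm_nonneg _) ((norm_nonneg _).trans hb1)
    have n0 : ‖u (G + r • (b.edgePoint s 0 - G)) *
        fderiv ℝ f (b.edgePoint s 0) e‖ ≤ ε * K := by
      rw [norm_mul]
      exact mul_le_mul hb0 (hK _ (hT 0 ⟨le_rfl, by linarith⟩)) (norm_nonneg _)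
        ((norm_nonneg _).trans hb0)
    exact (norm_sub_le _ _).trans (by linarith)
  have := intervalIntegral.norm_integral_le_of_norm_le_const hinner
  simpa using this

theorem triangle_reindex (e : Fin 3 ≃ Fin 3) : (b.reindex e).triangle = b.triangle := by
  rw [triangle, triangle, b.coe_reindex, e.symm.surjective.range_comp]

/-- Green's formula for a dilated function, as an estimate. -/
theorem exists_norm_integral_edges_le : ∃ C : ℝ, 0 ≤ C ∧ ∀ (u f : Plane → ℂ) (G : Plane)
    (r ε K : ℝ), ContDiffOn ℝ 2 u (interior b.triangle) → G ∈ interior b.triangle → 0 < r →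
    r < 1 → ContDiff ℝ 2 f → (∀ x ∈ b.triangle, x ∉ interior b.triangle → f x = 0) →
    (∀ x ∈ b.triangle, x ∉ interior b.triangle → ‖u (G + r • (x - G))‖ ≤ ε) →
    (∀ i j, ∀ x ∈ b.triangle, ‖fderiv ℝ f x (b i - b j)‖ ≤ K) →
    ‖∫ x in b.triangle, (u (G + r • (x - G)) * (iteratedFDeriv ℝ 2 f x ![b 1 - b 0, b 1 - b 0] +
        iteratedFDeriv ℝ 2 f x ![b 2 - b 1, b 2 - b 1] +
        iteratedFDeriv ℝ 2 f x ![b 0 - b 2, b 0 - b 2]) -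
      f x * ((r : ℂ) ^ 2 * (iteratedFDeriv ℝ 2 u (G + r • (x - G)) ![b 1 - b 0, b 1 - b 0] +
        iteratedFDeriv ℝ 2 u (G + r • (x - G)) ![b 2 - b 1, b 2 - b 1] +
        iteratedFDeriv ℝ 2 u (G + r • (x - G)) ![b 0 - b 2, b 0 - b 2])))‖ ≤ C * (ε * K) := by
  have key : ∀ i j : Fin 3, i ≠ j → ∃ C : ℝ, 0 ≤ C ∧ ∀ (u f : Plane → ℂ) (G : Plane)
      (r ε K : ℝ), ContDiffOn ℝ 2 u (interior b.triangle) → G ∈ interior b.triangle → 0 < r →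
      r < 1 → ContDiff ℝ 2 f → (∀ x ∈ b.triangle, x ∉ interior b.triangle → f x = 0) →
      (∀ x ∈ b.triangle, x ∉ interior b.triangle → ‖u (G + r • (x - G))‖ ≤ ε) →
      (∀ x ∈ b.triangle, ‖fderiv ℝ f x (b i - b j)‖ ≤ K) →
      ‖∫ x in b.triangle, (u (G + r • (x - G)) * iteratedFDeriv ℝ 2 f x ![b i - b j, b i - b j] -
        f x * ((r : ℂ) ^ 2 * iteratedFDeriv ℝ 2 u (G + r • (x - G)) ![b i - b j, b i - b j]))‖ ≤
        C * (ε * K) := by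
    intro i j hij
    -- Relabelling the vertices makes any edge the one from vertex 0 to vertex 2.
    obtain ⟨e, h0, h2⟩ : ∃ e : Fin 3 ≃ Fin 3, e.symm 0 = j ∧ e.symm 2 = i := by
      revert i j
      decide
    have := (b.reindex e).exists_norm_integral_edge_le
    rwa [triangle_reindex, b.reindex_apply, b.reindex_apply, h0, h2] at this
  obtain ⟨C1, hC1, h1⟩ := key 1 0 (by decide)
  obtain ⟨C2, hC2, h2⟩ := key 2 1 (by decide)
  obtain ⟨C3, hC3, h3⟩ := key 0 2 (by decide)
  refine ⟨C1 + C2 + C3, by positivity, fun u f G r ε K hu hG hr0 hr1 hf hf0 hε hK => ?_⟩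
  have i1 := h1 u f G r ε K hu hG hr0 hr1 hf hf0 hε (hK 1 0)
  have i2 := h2 u f G r ε K hu hG hr0 hr1 hf hf0 hε (hK 2 1)
  have i3 := h3 u f G r ε K hu hG hr0 hr1 hf hf0 hε (hK 0 2)
  have hi : ∀ v : Fin 2 → Plane, IntegrableOn (fun x => u (G + r • (x - G)) *
      iteratedFDeriv ℝ 2 f x v - f x * ((r : ℂ) ^ 2 *
      iteratedFDeriv ℝ 2 u (G + r • (x - G)) v)) b.triangle := fun v => by
    obtain ⟨cu, cu2⟩ := b.continuousOn_iteratedFDeriv_dilate hu hG hr0 hr1 v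
    exact ((cu.mul (continuous_iteratedFDeriv_apply hf v).continuousOn).sub
      (hf.continuous.continuousOn.mul ((continuousOn_const (c := (r : ℂ) ^ 2)).mul
      cu2))).integrableOn_compact b.isCompact_triangle
  have hsum := integral_add ((hi ![b 1 - b 0, b 1 - b 0]).add (hi ![b 2 - b 1, b 2 - b 1]))
    (hi ![b 0 - b 2, b 0 - b 2])
  simp only [Pi.add_apply] at hsum
  rw [integral_add (hi ![b 1 - b 0, b 1 - b 0]) (hi ![b 2 - b 1, b 2 - b 1])] at hsum
  refine (congrArg norm ((integral_congr_ae (ae_of_all _ fun x => ?_)).trans hsum)).le.trans ?_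
  · beta_reduce
    ring
  refine (norm_add_le _ _).trans ((add_le_add_left (norm_add_le _ _) _).trans ?_)
  linarith

end AffineBasis

end

/-! ### Orthogonality of solutions -/

section

open MeasureTheory Set Filter Topology
open scoped ContDiff

namespace AffineBasis

variable {b : AffineBasis (Fin 3) ℝ Plane}

theorem exists_dilate_close {u : Plane → ℂ} (hu : ContinuousOn u b.triangle) {G : Plane}
    (hG : G ∈ interior b.triangle) {ε : ℝ} (hε : 0 < ε) :
    ∀ᶠ r in 𝓝[<] (1 : ℝ), ∀ x ∈ b.triangle, ‖u (G + r • (x - G)) - u x‖ ≤ ε := by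
  have huc := b.isCompact_triangle.uniformContinuousOn_of_continuous hu
  obtain ⟨δ, hδ, h⟩ := Metric.uniformContinuousOn_iff.1 huc ε hε
  obtain ⟨D, hD⟩ := b.isCompact_triangle.isBounded.exists_norm_le
  have hGT := interior_subset hG
  have hD0 : 0 ≤ D := (norm_nonneg _).trans (hD G hGT)
  have hlim : Tendsto (fun r : ℝ => (1 - r) * (2 * D)) (𝓝[<] 1) (𝓝 0) := by
    have : Tendsto (fun r : ℝ => (1 - r) * (2 * D)) (𝓝 1) (𝓝 ((1 - 1) * (2 * D))) :=
      Continuous.tendsto (by fun_prop) 1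
    rw [sub_self, zero_mul] at this
    exact this.mono_left nhdsWithin_le_nhds
  filter_upwards [hlim.eventually_lt_const hδ, self_mem_nhdsWithin,
    (eventually_gt_nhds (zero_lt_one' ℝ)).filter_mono nhdsWithin_le_nhds] with r hr hr1 hr0 x hx
  rw [← dist_eq_norm]
  refine (h _ (interior_subset (b.dilate_mem_interior hG hx hr0 hr1)) _ hx ?_).le
  rw [dist_eq_norm]
  have hr1' : r < 1 := hr1
  calc ‖G + r • (x - G) - x‖ = ‖(1 - r) • (G - x)‖ := by congr 1; module
    _ = (1 - r) * ‖G - x‖ := by rw [norm_smul, Real.norm_of_nonneg (by linarith)]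
    _ ≤ (1 - r) * (2 * D) := by
      refine mul_le_mul_of_nonneg_left ?_ (by linarith)
      exact (norm_sub_le _ _).trans (by linarith [hD G hGT, hD x hx])
    _ < δ := hr

/-- Functions that solve the Helmholtz equation in an equilateral triangle with different spectral
parameters and vanish at the boundary are orthogonal. -/
theorem IsEquilateral.integral_mul_eq_zero {l : ℝ} (h : b.IsEquilateral l) (hl : 0 < l)
    {u f : Plane → ℂ} {μ ν : ℝ} (hne : μ ≠ ν) (hu : ContDiffOn ℝ 2 u (interior b.triangle))
    (huc : ContinuousOn u b.triangle)
    (hu0 : ∀ x ∈ b.triangle, x ∉ interior b.triangle → u x = 0)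
    (hΔ : ∀ x ∈ interior b.triangle, Laplacian.laplacian u x + μ * u x = 0)
    (hf : ContDiff ℝ 2 f) (hf0 : ∀ x ∈ b.triangle, x ∉ interior b.triangle → f x = 0)
    (hfΔ : ∀ x, Laplacian.laplacian f x = -(ν : ℂ) * f x) :
    ∫ x in b.triangle, u x * f x = 0 := by
  obtain ⟨C, hC, hbound⟩ := b.exists_norm_integral_edges_le
  obtain ⟨G, hG⟩ := b.exists_mem_interior_triangle
  have hl' : (l : ℂ) ≠ 0 := by exact_mod_cast hl.ne'
  have hVf : ContinuousOn (fun x => ‖fderiv ℝ f x‖) b.triangle :=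
    (hf.continuous_fderiv (by norm_num)).norm.continuousOn
  obtain ⟨K0, hK0⟩ := b.isCompact_triangle.exists_bound_of_continuousOn hVf
  obtain ⟨B, hB⟩ := b.isCompact_triangle.exists_bound_of_continuousOn hf.continuous.continuousOn
  obtain ⟨D, hD⟩ := b.isCompact_triangle.isBounded.exists_norm_le
  have hvert : ∀ i, b i ∈ b.triangle := fun i => subset_convexHull ℝ _ (mem_range_self i)
  have hK : ∀ i j, ∀ x ∈ b.triangle, ‖fderiv ℝ f x (b i - b j)‖ ≤ K0 * (2 * D) := by
    intro i j x hx
    have h1 := hK0 x hx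
    rw [norm_norm] at h1
    have h2 : ‖b i - b j‖ ≤ 2 * D := (norm_sub_le _ _).trans
      (by linarith [hD _ (hvert i), hD _ (hvert j)])
    exact ((fderiv ℝ f x).le_opNorm _).trans (mul_le_mul h1 h2 (norm_nonneg _)
      ((norm_nonneg _).trans h1))
  set K := K0 * (2 * D)
  set V := volume.real b.triangle
  set J : ℝ → ℂ := fun r => ∫ x in b.triangle, u (G + r • (x - G)) * f x with hJ
  have hr01 : ∀ᶠ r in 𝓝[<] (1 : ℝ), 0 < r ∧ r < 1 := by
    filter_upwards [self_mem_nhdsWithin,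
      (eventually_gt_nhds (zero_lt_one' ℝ)).filter_mono nhdsWithin_le_nhds] with r h1 h0
    exact ⟨h0, h1⟩
  have edge : ∀ (g : Plane → ℂ) (x : Plane), iteratedFDeriv ℝ 2 g x ![b 1 - b 0, b 1 - b 0] +
        iteratedFDeriv ℝ 2 g x ![b 2 - b 1, b 2 - b 1] +
        iteratedFDeriv ℝ 2 g x ![b 0 - b 2, b 0 - b 2] =
        3 * l ^ 2 / 2 * Laplacian.laplacian g x := by
    intro g x
    rw [h.laplacian_eq hl]
    push_cast
    field_simp
  -- Green's formula for the dilate of `u`, which solves the equation with parameter `r² μ`. On the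
  -- boundary the dilate is uniformly small as `r → 1`, because `u` is continuous and vanishes
  -- there. Since `J r` tends to the pairing of `u` with `f`, the limit is a nonzero multiple of `μ
  -- - ν` times that pairing.
  have lim1 : Tendsto (fun r : ℝ => 3 * (l : ℂ) ^ 2 / 2 * ((r : ℂ) ^ 2 * μ - ν) * J r)
      (𝓝[<] 1) (𝓝 0) := by
    rw [Metric.tendsto_nhds]
    intro ε hε
    -- Chosen so that the Green bound is at most `ε / 2`; the summand 1 avoids division by zero.
    have hCK : 0 < ε / (2 * (C * |K| + 1)) := by positivity
    filter_upwards [hr01, exists_dilate_close huc hG hCK] with r hr hclose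
    have hb := hbound u f G r (ε / (2 * (C * |K| + 1))) |K| hu hG hr.1 hr.2 hf hf0
      (fun x hx hx' => by
        have := hclose x hx
        rwa [hu0 x hx hx', sub_zero] at this)
      (fun i j x hx => (hK i j x hx).trans (le_abs_self _))
    have heq : ∫ x in b.triangle, (u (G + r • (x - G)) *
          (iteratedFDeriv ℝ 2 f x ![b 1 - b 0, b 1 - b 0] +
          iteratedFDeriv ℝ 2 f x ![b 2 - b 1, b 2 - b 1] +
          iteratedFDeriv ℝ 2 f x ![b 0 - b 2, b 0 - b 2]) -
        f x * ((r : ℂ) ^ 2 * (iteratedFDeriv ℝ 2 u (G + r • (x - G)) ![b 1 - b 0, b 1 - b 0] +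
          iteratedFDeriv ℝ 2 u (G + r • (x - G)) ![b 2 - b 1, b 2 - b 1] +
          iteratedFDeriv ℝ 2 u (G + r • (x - G)) ![b 0 - b 2, b 0 - b 2]))) =
        3 * (l : ℂ) ^ 2 / 2 * ((r : ℂ) ^ 2 * μ - ν) * J r := by
      rw [hJ]
      simp only
      rw [← integral_const_mul]
      refine setIntegral_congr_fun b.measurableSet_triangle fun x hx => ?_
      rw [edge, edge, hfΔ]
      have := hΔ _ (b.dilate_mem_interior hG hx hr.1 hr.2)
      linear_combination (-(f x * (r : ℂ) ^ 2 * (3 * l ^ 2 / 2))) * this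
    rw [heq] at hb
    rw [dist_zero_right]
    refine hb.trans_lt ?_
    have hpos : 0 < C * |K| + 1 := by positivity
    calc C * (ε / (2 * (C * |K| + 1)) * |K|) = (C * |K|) / (C * |K| + 1) * (ε / 2) := by
          field_simp
      _ ≤ 1 * (ε / 2) := by
          refine mul_le_mul_of_nonneg_right ?_ (by positivity)
          rw [div_le_one hpos]
          linarith
      _ < ε := by linarith
  have limJ : Tendsto J (𝓝[<] 1) (𝓝 (∫ x in b.triangle, u x * f x)) := by
    rw [Metric.tendsto_nhds]
    intro ε hε
    have hpos : 0 < |B| * V + 1 := by positivity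
    have hBV : 0 < ε / (2 * (|B| * V + 1)) := by positivity
    filter_upwards [hr01, exists_dilate_close huc hG hBV] with r hr hclose
    obtain ⟨cu, -⟩ := b.continuousOn_iteratedFDeriv_dilate hu hG hr.1 hr.2 ![0, 0]
    have i1 : IntegrableOn (fun x => u (G + r • (x - G)) * f x) b.triangle :=
      (cu.mul hf.continuous.continuousOn).integrableOn_compact b.isCompact_triangle
    have i2 : IntegrableOn (fun x => u x * f x) b.triangle :=
      (huc.mul hf.continuous.continuousOn).integrableOn_compact b.isCompact_triangle
    rw [dist_eq_norm, hJ]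
    simp only
    rw [← integral_sub i1 i2]
    have := norm_setIntegral_le_of_norm_le_const (μ := volume) (s := b.triangle)
      (C := ε / (2 * (|B| * V + 1)) * |B|)
      (f := fun x => u (G + r • (x - G)) * f x - u x * f x)
      b.isCompact_triangle.measure_lt_top (fun x hx => by
        rw [← sub_mul, norm_mul]
        exact mul_le_mul (hclose x hx) ((hB x hx).trans (le_abs_self _)) (norm_nonneg _)
          hBV.le)
    refine this.trans_lt ?_
    calc ε / (2 * (|B| * V + 1)) * |B| * V = (|B| * V) / (|B| * V + 1) * (ε / 2) := by
          field_simp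
      _ ≤ 1 * (ε / 2) := by
          refine mul_le_mul_of_nonneg_right ?_ (by positivity)
          rw [div_le_one hpos]
          linarith
      _ < ε := by linarith
  have lim2 : Tendsto (fun r : ℝ => 3 * (l : ℂ) ^ 2 / 2 * ((r : ℂ) ^ 2 * μ - ν))
      (𝓝[<] 1) (𝓝 (3 * (l : ℂ) ^ 2 / 2 * (((1 : ℝ) : ℂ) ^ 2 * μ - ν))) :=
    (Continuous.tendsto (by fun_prop) 1).mono_left nhdsWithin_le_nhds
  have h0 := tendsto_nhds_unique lim1 (lim2.mul limJ)
  have hne' : (μ : ℂ) - ν ≠ 0 := by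
    rw [← Complex.ofReal_sub]
    exact_mod_cast sub_ne_zero.2 hne
  have h3 : 3 * (l : ℂ) ^ 2 / 2 * (((1 : ℝ) : ℂ) ^ 2 * μ - ν) ≠ 0 := by
    rw [Complex.ofReal_one, one_pow, one_mul]
    exact mul_ne_zero (div_ne_zero (mul_ne_zero three_ne_zero (pow_ne_zero 2 hl')) two_ne_zero) hne'
  exact (mul_eq_zero.1 h0.symm).resolve_left h3

end AffineBasis

end

/-! ### Completeness of Lamé's functions -/

section

open MeasureTheory Set Complex

namespace AffineBasis

variable (b : AffineBasis (Fin 3) ℝ Plane)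

theorem exists_int_of_wave_eq {m n m' n' : ℤ} {x y : Plane} (h : b.wave m n x = b.wave m' n' y) :
    ∃ k : ℤ, (2 * m + n) * b.coord 1 x + (m + 2 * n) * b.coord 2 x =
      (2 * m' + n') * b.coord 1 y + (m' + 2 * n') * b.coord 2 y + 3 * k := by
  rw [wave, wave, Complex.exp_eq_exp_iff_exists_int] at h
  obtain ⟨k, hk⟩ := h
  refine ⟨k, ?_⟩
  have h1 : ((b.phase m n x : ℝ) : ℂ) = ((b.phase m' n' y + k * (2 * Real.pi) : ℝ) : ℂ) := by
    refine mul_right_cancel₀ I_ne_zero ?_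
    rw [hk]
    push_cast
    ring
  have h2 := Complex.ofReal_injective h1
  simp only [phase] at h2
  have hpi := Real.pi_pos
  refine mul_left_cancel₀ (show 2 * Real.pi / 3 ≠ 0 by positivity) ?_
  rw [h2]
  ring

/-- The Weyl denominator formula: this function is the Vandermonde product of the three waves in
`waveSum`. -/
theorem lame_one_one_apply (x : Plane) : b.lame 1 1 x = (b.wave 1 0 x - b.wave (-1) 1 x) *
    (b.wave 1 0 x - b.wave 0 (-1) x) * (b.wave (-1) 1 x - b.wave 0 (-1) x) := by
  simp only [lame_apply, mul_sub, sub_mul, wave_mul]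
  ring_nf

/-- Two of the three waves can agree only if one of `c₁`, `c₂`, `c₁ + c₂` is an integer, where `cᵢ`
are barycentric coordinates; inside the triangle all three lie strictly between 0 and 1. -/
theorem lame_one_one_ne_zero {x : Plane} (hx : x ∈ interior b.triangle) : b.lame 1 1 x ≠ 0 := by
  rw [interior_triangle] at hx
  have h0 : 0 < b.coord 0 x := hx 0
  have h1 : 0 < b.coord 1 x := hx 1
  have h2 : 0 < b.coord 2 x := hx 2
  have hs := b.sum_coord x
  have key : ∀ (k : ℤ) (r : ℝ), 0 < r → r < 1 → r ≠ k := by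
    intro k r hr0 hr1 h
    rw [h] at hr0 hr1
    have h3 : 0 < k := by exact_mod_cast hr0
    have h4 : k < 1 := by exact_mod_cast hr1
    omega
  rw [lame_one_one_apply]
  refine mul_ne_zero (mul_ne_zero ?_ ?_) ?_ <;> refine sub_ne_zero.2 fun h => ?_ <;>
    obtain ⟨k, hk⟩ := b.exists_int_of_wave_eq h <;> push_cast at hk
  · exact key k (b.coord 1 x) h1 (by linarith) (by linarith)
  · exact key k (b.coord 1 x + b.coord 2 x) (by linarith) (by linarith) (by linarith)
  · exact key k (b.coord 2 x) h2 (by linarith) (by linarith)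

theorem star_waveSum_apply (x : Plane) : star (b.waveSum x) =
    b.wave 1 0 x * b.wave (-1) 1 x + b.wave 1 0 x * b.wave 0 (-1) x +
      b.wave (-1) 1 x * b.wave 0 (-1) x := by
  simp only [waveSum, Pi.add_apply, star_add, star_wave, wave_mul]
  ring_nf

theorem wave_mul_wave_mul_wave (x : Plane) :
    b.wave 1 0 x * b.wave (-1) 1 x * b.wave 0 (-1) x = 1 := by
  rw [wave_mul, wave_mul, ← b.wave_zero x]
  rfl

theorem _root_.eq_perm_of_esymm_eq {R : Type*} [CommRing R] [IsDomain R] {a₁ a₂ a₃ b₁ b₂ b₃ : R}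
    (h1 : a₁ + a₂ + a₃ = b₁ + b₂ + b₃)
    (h2 : a₁ * a₂ + a₁ * a₃ + a₂ * a₃ = b₁ * b₂ + b₁ * b₃ + b₂ * b₃)
    (h3 : a₁ * a₂ * a₃ = b₁ * b₂ * b₃) :
    (a₁ = b₁ ∧ a₂ = b₂) ∨ (a₁ = b₁ ∧ a₂ = b₃) ∨ (a₁ = b₂ ∧ a₂ = b₁) ∨ (a₁ = b₂ ∧ a₂ = b₃) ∨
      (a₁ = b₃ ∧ a₂ = b₁) ∨ (a₁ = b₃ ∧ a₂ = b₂) := by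
  have key : ∀ c₁ c₂ c₃ : R, a₁ = c₁ → a₁ + a₂ + a₃ = c₁ + c₂ + c₃ →
      a₁ * a₂ + a₁ * a₃ + a₂ * a₃ = c₁ * c₂ + c₁ * c₃ + c₂ * c₃ → a₂ = c₂ ∨ a₂ = c₃ := by
    rintro _ c₂ c₃ rfl e1 e2
    have : (a₂ - c₂) * (a₂ - c₃) = 0 := by linear_combination (a₁ + a₂) * e1 - e2
    exact (mul_eq_zero.1 this).imp sub_eq_zero.1 sub_eq_zero.1
  have h : (a₁ - b₁) * (a₁ - b₂) * (a₁ - b₃) = 0 := by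
    linear_combination a₁ ^ 2 * h1 - a₁ * h2 + h3
  rcases mul_eq_zero.1 h with h | h
  · rcases mul_eq_zero.1 h with h | h
    · rcases key b₁ b₂ b₃ (sub_eq_zero.1 h) h1 h2 with h' | h' <;> simp [sub_eq_zero.1 h, h']
    · rcases key b₂ b₁ b₃ (sub_eq_zero.1 h) (by linear_combination h1)
        (by linear_combination h2) with h' | h' <;> simp [sub_eq_zero.1 h, h']
  · rcases key b₃ b₁ b₂ (sub_eq_zero.1 h) (by linear_combination h1)
      (by linear_combination h2) with h' | h' <;> simp [sub_eq_zero.1 h, h']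

/-- The three waves have modulus 1 and product 1, so their sum and its conjugate are their first two
elementary symmetric functions. The value of `waveSum` thus determines the waves up to order. In
each of the six orders the coordinates are determined up to small integers, and the inequalities of
the triangle force `x = y`: the triangle is a fundamental alcove. -/
theorem waveSum_injOn : InjOn b.waveSum b.triangle := by
  intro x hx y hy h
  rw [triangle_eq] at hx hy
  have hx0 : 0 ≤ b.coord 0 x := hx 0
  have hx1 : 0 ≤ b.coord 1 x := hx 1
  have hx2 : 0 ≤ b.coord 2 x := hx 2
  have hy0 : 0 ≤ b.coord 0 y := hy 0
  have hy1 : 0 ≤ b.coord 1 y := hy 1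
  have hy2 : 0 ≤ b.coord 2 y := hy 2
  have hxs := b.sum_coord x
  have hys := b.sum_coord y
  have h2 := congrArg star h
  rw [star_waveSum_apply, star_waveSum_apply] at h2
  have h3 := (b.wave_mul_wave_mul_wave x).trans (b.wave_mul_wave_mul_wave y).symm
  have bound : ∀ k : ℤ, (k : ℝ) < 2 → (-2 : ℝ) < k → k = -1 ∨ k = 0 ∨ k = 1 := by
    intro k h1 h2
    have h3 : k < 2 := by exact_mod_cast h1
    have h4 : -2 < k := by exact_mod_cast h2
    omega
  rcases eq_perm_of_esymm_eq h h2 h3 with ⟨e1, e2⟩ | ⟨e1, e2⟩ | ⟨e1, e2⟩ | ⟨e1, e2⟩ | ⟨e1, e2⟩ |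
    ⟨e1, e2⟩ <;>
  · obtain ⟨k1, hk1⟩ := b.exists_int_of_wave_eq e1
    obtain ⟨k2, hk2⟩ := b.exists_int_of_wave_eq e2
    push_cast at hk1 hk2
    rcases bound k1 (by linarith) (by linarith) with rfl | rfl | rfl <;>
    rcases bound k2 (by linarith) (by linarith) with rfl | rfl | rfl <;>
    · push_cast at hk1 hk2
      exact b.ext_coord (by linarith) (by linarith)

/-- The space of trigonometric polynomials that are antisymmetric under the symmetric group of a
triangle. -/
noncomputable def lameSpan : Submodule ℂ (Plane → ℂ) :=
  Submodule.span ℂ (range fun p : ℤ × ℤ => b.lame p.1 p.2)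

theorem lame_mem_lameSpan (m n : ℤ) : b.lame m n ∈ b.lameSpan :=
  Submodule.subset_span ⟨(m, n), rfl⟩

theorem star_mem_lameSpan {f : Plane → ℂ} (hf : f ∈ b.lameSpan) : star f ∈ b.lameSpan := by
  induction hf using Submodule.span_induction with
  | mem f h =>
    obtain ⟨p, rfl⟩ := h
    rw [star_lame]
    exact b.lame_mem_lameSpan _ _
  | zero => simp
  | add f g _ _ hf hg => rw [star_add]; exact add_mem hf hg
  | smul c f _ hf => rw [star_smul]; exact Submodule.smul_mem _ _ hf

theorem waveSum_mul_mem_lameSpan {f : Plane → ℂ} (hf : f ∈ b.lameSpan) :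
    b.waveSum * f ∈ b.lameSpan := by
  induction hf using Submodule.span_induction with
  | mem f h =>
    obtain ⟨p, rfl⟩ := h
    rw [waveSum_mul_lame]
    exact add_mem (add_mem (b.lame_mem_lameSpan _ _) (b.lame_mem_lameSpan _ _))
      (b.lame_mem_lameSpan _ _)
  | zero => simp
  | add f g _ _ hf hg => rw [mul_add]; exact add_mem hf hg
  | smul c f _ hf => rw [mul_smul_comm]; exact Submodule.smul_mem _ _ hf

theorem continuous_waveSum : Continuous b.waveSum :=
  ((b.contDiff_wave _ _).continuous.add (b.contDiff_wave _ _).continuous).add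
    (b.contDiff_wave _ _).continuous

theorem eqOn_zero_of_integral_mul_star {v : Plane → ℂ} (hv : ContinuousOn v b.triangle)
    (h : ∫ x in b.triangle, v x * star (v x) = 0) : ∀ x ∈ interior b.triangle, v x = 0 := by
  have hsq : ∀ x, v x * star (v x) = ((‖v x‖ ^ 2 : ℝ) : ℂ) := by
    intro x
    rw [star_def, mul_conj, normSq_eq_norm_sq]
  simp_rw [hsq] at h
  have hi : IntegrableOn (fun x => ‖v x‖ ^ 2) b.triangle :=
    (hv.norm.pow 2).integrableOn_compact b.isCompact_triangle
  rw [integral_complex_ofReal, ofReal_eq_zero, setIntegral_eq_zero_iff_of_nonneg_ae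
    (Filter.Eventually.of_forall fun x => by positivity) hi] at h
  have hint := ae_restrict_of_ae_restrict_of_subset interior_subset h
  intro x hx
  have := Measure.eqOn_open_of_ae_eq hint isOpen_interior
    ((hv.norm.pow 2).mono interior_subset) continuousOn_const hx
  simpa using this

/-- Let `g` be `lame 1 1`. The span of Lamé's functions is stable under `waveSum` and conjugation,
hence under the star algebra generated by `waveSum`. So `w g` is orthogonal to that algebra, which
is dense by Stone–Weierstrass. Approximating the conjugate of `w g` gives `w g = 0`, and `g` has no
zeros inside. -/
theorem eq_zero_of_integral_mul_lame_eq_zero {w : Plane → ℂ} (hw : ContinuousOn w b.triangle)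
    (h : ∀ m n : ℤ, ∫ x in b.triangle, w x * b.lame m n x = 0) {x : Plane}
    (hx : x ∈ interior b.triangle) : w x = 0 := by
  have : CompactSpace b.triangle := isCompact_iff_compactSpace.1 b.isCompact_triangle
  have hspan : ∀ f ∈ b.lameSpan, Continuous f ∧ ∫ x in b.triangle, w x * f x = 0 := by
    intro f hf
    induction hf using Submodule.span_induction with
    | mem f hf =>
      obtain ⟨p, rfl⟩ := hf
      exact ⟨(b.contDiff_lame _ _).continuous, h _ _⟩
    | zero => exact ⟨continuous_const, by simp⟩
    | add f g _ _ hf hg =>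
      refine ⟨hf.1.add hg.1, ?_⟩
      simp only [Pi.add_apply, mul_add]
      have i1 : IntegrableOn (fun x => w x * f x) b.triangle :=
        (hw.mul hf.1.continuousOn).integrableOn_compact b.isCompact_triangle
      have i2 : IntegrableOn (fun x => w x * g x) b.triangle :=
        (hw.mul hg.1.continuousOn).integrableOn_compact b.isCompact_triangle
      rw [integral_add i1 i2, hf.2, hg.2, add_zero]
    | smul c f _ hf =>
      refine ⟨hf.1.const_smul c, ?_⟩
      simp only [Pi.smul_apply, mul_smul_comm]
      rw [integral_smul, hf.2, smul_zero]
  set z : C(b.triangle, ℂ) := ⟨fun x => b.waveSum x, b.continuous_waveSum.comp continuous_subtype_val⟩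
    with hz
  have hA : ∀ a ∈ StarAlgebra.adjoin ℂ {z}, ∀ f ∈ b.lameSpan, ∃ f' ∈ b.lameSpan,
      ∀ x : b.triangle, f' x = a x * f x := by
    intro a ha
    induction ha using StarAlgebra.adjoin_induction with
    | mem a ha =>
      intro f hf
      rw [mem_singleton_iff.1 ha]
      exact ⟨_, b.waveSum_mul_mem_lameSpan hf, fun x => rfl⟩
    | algebraMap r =>
      intro f hf
      exact ⟨r • f, Submodule.smul_mem _ _ hf, fun x => rfl⟩
    | add a a' _ _ ha ha' =>
      intro f hf
      obtain ⟨f1, h1, e1⟩ := ha f hf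
      obtain ⟨f2, h2, e2⟩ := ha' f hf
      refine ⟨f1 + f2, add_mem h1 h2, fun x => ?_⟩
      rw [Pi.add_apply, e1, e2, ContinuousMap.add_apply, add_mul]
    | mul a a' _ _ ha ha' =>
      intro f hf
      obtain ⟨f1, h1, e1⟩ := ha' f hf
      obtain ⟨f2, h2, e2⟩ := ha f1 h1
      refine ⟨f2, h2, fun x => ?_⟩
      rw [e2, e1, ContinuousMap.mul_apply, mul_assoc]
    | star a _ ha =>
      intro f hf
      -- Multiplication by the conjugate of `a` is the conjugate of multiplying `star f` by `a`.
      obtain ⟨f1, h1, e1⟩ := ha (star f) (b.star_mem_lameSpan hf)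
      refine ⟨star f1, b.star_mem_lameSpan h1, fun x => ?_⟩
      rw [Pi.star_apply, e1, Pi.star_apply, star_mul', star_star, ContinuousMap.star_apply]
  have hdense : (StarAlgebra.adjoin ℂ {z}).topologicalClosure = ⊤ := by
    refine ContinuousMap.starSubalgebra_topologicalClosure_eq_top_of_separatesPoints _ ?_
    intro x y hxy
    refine ⟨z, ⟨z, StarAlgebra.subset_adjoin ℂ _ rfl, rfl⟩, fun e => hxy ?_⟩
    exact Subtype.ext (b.waveSum_injOn x.2 y.2 e)
  set g := b.lame 1 1 with hg
  have hgc : Continuous g := (b.contDiff_lame _ _).continuous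
  set W : C(b.triangle, ℂ) := ⟨fun x => w x * g x,
    (continuousOn_iff_continuous_domRestrict.1 hw).mul (hgc.comp continuous_subtype_val)⟩ with hW
  have hWc : ContinuousOn (fun x => w x * g x) b.triangle := hw.mul hgc.continuousOn
  have hzero : ∫ x in b.triangle, w x * g x * star (w x * g x) = 0 := by
    by_contra hne
    obtain ⟨D, hD⟩ : ∃ D, D = ‖∫ x in b.triangle, w x * g x * star (w x * g x)‖ := ⟨_, rfl⟩
    have hDpos : 0 < D := hD ▸ norm_pos_iff.2 hne
    set V := volume.real b.triangle
    have hV : 0 ≤ V := measureReal_nonneg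
    have hε : 0 < D / (2 * (‖W‖ * V + 1)) := by positivity
    have hcl : star W ∈ closure ((StarAlgebra.adjoin ℂ {z} : StarSubalgebra ℂ _) : Set _) := by
      rw [← StarSubalgebra.topologicalClosure_coe, hdense]
      trivial
    obtain ⟨a, ha, hdist⟩ := Metric.mem_closure_iff.1 hcl _ hε
    obtain ⟨f', hf', e⟩ := hA a ha g (b.lame_mem_lameSpan 1 1)
    obtain ⟨hf'c, hf'0⟩ := hspan f' hf'
    have i1 : IntegrableOn (fun x => w x * g x * star (w x * g x)) b.triangle :=
      (hWc.mul hWc.star).integrableOn_compact b.isCompact_triangle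
    have i2 : IntegrableOn (fun x => w x * f' x) b.triangle :=
      (hw.mul hf'c.continuousOn).integrableOn_compact b.isCompact_triangle
    have hle : D ≤ ‖W‖ * (D / (2 * (‖W‖ * V + 1))) * V := by
      refine hD.le.trans ?_
      rw [← sub_zero (∫ x in b.triangle, w x * g x * star (w x * g x)), ← hf'0,
        ← integral_sub i1 i2]
      refine norm_setIntegral_le_of_norm_le_const b.isCompact_triangle.measure_lt_top ?_
      intro x hx
      have e1 : w x * g x * star (w x * g x) - w x * f' x = W ⟨x, hx⟩ * (star W - a) ⟨x, hx⟩ := by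
        rw [e ⟨x, hx⟩, ContinuousMap.sub_apply, ContinuousMap.star_apply]
        change _ = w x * g x * (star (w x * g x) - a ⟨x, hx⟩)
        ring
      rw [e1, norm_mul]
      refine mul_le_mul (W.norm_coe_le_norm _) ?_ (norm_nonneg _) (norm_nonneg _)
      rw [dist_eq_norm] at hdist
      exact ((star W - a).norm_coe_le_norm _).trans hdist.le
    have hpos : 0 < ‖W‖ * V + 1 := by positivity
    have : ‖W‖ * (D / (2 * (‖W‖ * V + 1))) * V < D := by
      calc ‖W‖ * (D / (2 * (‖W‖ * V + 1))) * V = (‖W‖ * V) / (‖W‖ * V + 1) * (D / 2) := by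
            field_simp
        _ ≤ 1 * (D / 2) := by
            refine mul_le_mul_of_nonneg_right ?_ (by positivity)
            rw [div_le_one hpos]
            linarith
        _ < D := by linarith
    linarith
  exact (mul_eq_zero.1 (b.eqOn_zero_of_integral_mul_star hWc hzero x hx)).resolve_right
    (b.lame_one_one_ne_zero hx)

end AffineBasis

end

/-! ### Determination of the eigenspaces -/

section

open MeasureTheory Set Filter Topology
open scoped ContDiff

namespace AffineBasis

variable (b : AffineBasis (Fin 3) ℝ Plane)

theorem lame_rotate (m n : ℤ) : b.lame n (-m - n) = b.lame m n := by
  funext x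
  simp only [lame_apply]
  ring_nf

theorem lame_rotate' (m n : ℤ) : b.lame (-m - n) m = b.lame m n := by
  funext x
  simp only [lame_apply]
  ring_nf

theorem lame_swap (m n : ℤ) : b.lame (-n) (-m) = -b.lame m n := by
  funext x
  simp only [Pi.neg_apply, lame_apply]
  ring_nf

/-- The span of Lamé's functions for the value `μ`, where `c` is the normalizing constant in the
spectrum. -/
noncomputable def lameSpace (c μ : ℝ) : Submodule ℂ (Plane → ℂ) :=
  Submodule.span ℂ (range fun p : {p : ℤ × ℤ // c * hexForm p.1 p.2 = μ} => b.lame p.1.1 p.1.2)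

theorem lame_mem_lameSpace {c μ : ℝ} {m n : ℤ} (h : c * hexForm m n = μ) :
    b.lame m n ∈ b.lameSpace c μ := Submodule.subset_span ⟨⟨(m, n), h⟩, rfl⟩

/-- The group of order six permutes the six chambers of the index lattice, preserves the form and
changes Lamé's function at most by sign. Indices on the walls give the zero function. -/
theorem lameSpace_eq_span (c μ : ℝ) : b.lameSpace c μ = Submodule.span ℂ
    (range fun p : {p : ℕ+ × ℕ+ // c * hexForm (p.1 : ℕ) (p.2 : ℕ) = μ} =>
      b.lame (p.1.1 : ℕ) (p.1.2 : ℕ)) := by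
  refine le_antisymm (Submodule.span_le.2 ?_) (Submodule.span_le.2 ?_)
  · rintro _ ⟨⟨⟨m, n⟩, h⟩, rfl⟩
    change b.lame m n ∈ _
    have hpos : ∀ m' n' : ℤ, hexForm m' n' = hexForm m n → 0 < m' → 0 < n' →
        b.lame m' n' ∈ Submodule.span ℂ
          (range fun p : {p : ℕ+ × ℕ+ // c * hexForm (p.1 : ℕ) (p.2 : ℕ) = μ} =>
            b.lame (p.1.1 : ℕ) (p.1.2 : ℕ)) := by
      intro m' n' he hm hn
      lift m' to ℕ using hm.le
      lift n' to ℕ using hn.le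
      have hm' : 0 < m' := by exact_mod_cast hm
      have hn' : 0 < n' := by exact_mod_cast hn
      exact Submodule.subset_span ⟨⟨(⟨m', hm'⟩, ⟨n', hn'⟩), by
        change c * ((hexForm (m' : ℤ) (n' : ℤ) : ℤ) : ℝ) = μ
        rw [he]
        exact h⟩, rfl⟩
    rcases eq_or_ne m 0 with rfl | hm
    · rw [lame_zero_left]; exact zero_mem _
    rcases eq_or_ne n 0 with rfl | hn
    · rw [lame_zero_right]; exact zero_mem _
    rcases eq_or_ne (m + n) 0 with hmn | hmn
    · rw [← neg_neg (b.lame m n), ← lame_reflect_left, hmn, lame_zero_right]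
      exact neg_mem (zero_mem _)
    rcases (by omega : (0 < m ∧ 0 < n) ∨ (0 < -m ∧ 0 < m + n) ∨ (0 < m + n ∧ 0 < -n) ∨
      (0 < n ∧ 0 < -m - n) ∨ (0 < -m - n ∧ 0 < m) ∨ (0 < -n ∧ 0 < -m)) with
      h | h | h | h | h | h
    · exact hpos _ _ rfl h.1 h.2
    · rw [← neg_neg (b.lame m n), ← lame_reflect_left]
      exact neg_mem (hpos _ _ (by simp only [hexForm]; ring) h.1 h.2)
    · rw [← neg_neg (b.lame m n), ← lame_reflect_right]
      exact neg_mem (hpos _ _ (by simp only [hexForm]; ring) h.1 h.2)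
    · rw [← lame_rotate]
      exact hpos _ _ (by simp only [hexForm]; ring) h.1 h.2
    · rw [← lame_rotate']
      exact hpos _ _ (by simp only [hexForm]; ring) h.1 h.2
    · rw [← neg_neg (b.lame m n), ← lame_swap]
      exact neg_mem (hpos _ _ (by simp only [hexForm]; ring) h.1 h.2)
  · rintro _ ⟨⟨⟨m, n⟩, h⟩, rfl⟩
    exact b.lame_mem_lameSpace h

theorem _root_.finite_hexForm_eq {c : ℝ} (hc : 0 < c) (μ : ℝ) :
    Finite {p : ℕ+ × ℕ+ // c * hexForm (p.1 : ℕ) (p.2 : ℕ) = μ} := by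
  obtain ⟨N, hN⟩ := exists_nat_ge (μ / c)
  have hle : ∀ p : {p : ℕ+ × ℕ+ // c * hexForm (p.1 : ℕ) (p.2 : ℕ) = μ},
      (p.1.1 : ℕ) < N + 1 ∧ (p.1.2 : ℕ) < N + 1 := by
    rintro ⟨⟨m, n⟩, h⟩
    have h1 : ((hexForm (m : ℕ) (n : ℕ) : ℤ) : ℝ) ≤ N := by
      rw [← h, mul_div_cancel_left₀ _ hc.ne'] at hN
      exact hN
    have h2 : hexForm (m : ℕ) (n : ℕ) ≤ (N : ℤ) := by exact_mod_cast h1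
    have hm : (1 : ℤ) ≤ (m : ℕ) := by exact_mod_cast m.pos
    have hn : (1 : ℤ) ≤ (n : ℕ) := by exact_mod_cast n.pos
    rw [hexForm] at h2
    constructor
    · have : ((m : ℕ) : ℤ) < N + 1 := by nlinarith
      exact_mod_cast this
    · have : ((n : ℕ) : ℤ) < N + 1 := by nlinarith
      exact_mod_cast this
  refine Finite.of_injective (fun p => ((⟨p.1.1, (hle p).1⟩, ⟨p.1.2, (hle p).2⟩) :
    Fin (N + 1) × Fin (N + 1))) ?_
  intro p q h
  simp only [Prod.mk.injEq, Fin.mk.injEq, PNat.coe_inj] at h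
  exact Subtype.ext (Prod.ext h.1 h.2)

theorem finiteDimensional_lameSpace {c : ℝ} (hc : 0 < c) (μ : ℝ) :
    FiniteDimensional ℂ (b.lameSpace c μ) := by
  have := finite_hexForm_eq hc μ
  rw [lameSpace_eq_span]
  exact FiniteDimensional.span_of_finite ℂ (finite_range _)

theorem star_mem_lameSpace {c μ : ℝ} {f : Plane → ℂ} (hf : f ∈ b.lameSpace c μ) :
    star f ∈ b.lameSpace c μ := by
  induction hf using Submodule.span_induction with
  | mem f h =>
    obtain ⟨p, rfl⟩ := h
    rw [star_lame]
    refine b.lame_mem_lameSpace ?_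
    refine Eq.trans ?_ p.2
    simp [hexForm]
  | zero => simp
  | add f g _ _ hf hg => rw [star_add]; exact add_mem hf hg
  | smul c f _ hf => rw [star_smul]; exact Submodule.smul_mem _ _ hf

theorem lameSpace_le_lameSpan (c μ : ℝ) : b.lameSpace c μ ≤ b.lameSpan := by
  refine Submodule.span_le.2 ?_
  rintro _ ⟨p, rfl⟩
  exact b.lame_mem_lameSpan _ _

theorem contDiff_of_mem_lameSpan {f : Plane → ℂ} (hf : f ∈ b.lameSpan) : ContDiff ℝ ω f := by
  induction hf using Submodule.span_induction with
  | mem f h => obtain ⟨p, rfl⟩ := h; exact b.contDiff_lame _ _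
  | zero => exact contDiff_const
  | add f g _ _ hf hg => exact hf.add hg
  | smul c f _ hf => exact hf.const_smul c

theorem eq_zero_of_mem_lameSpan {f : Plane → ℂ} (hf : f ∈ b.lameSpan) {x : Plane}
    (hx : x ∈ b.triangle) (hx' : x ∉ interior b.triangle) : f x = 0 := by
  induction hf using Submodule.span_induction with
  | mem f h => obtain ⟨p, rfl⟩ := h; exact b.lame_eq_zero hx hx'
  | zero => rfl
  | add f g _ _ hf hg => rw [Pi.add_apply, hf, hg, add_zero]
  | smul c f _ hf => rw [Pi.smul_apply, hf, smul_zero]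

theorem eq_zero_of_eqOn_interior {f : Plane → ℂ} (hf : f ∈ b.lameSpan)
    (h : ∀ x ∈ interior b.triangle, f x = 0) : f = 0 := by
  obtain ⟨G, hG⟩ := b.exists_mem_interior_triangle
  have han : AnalyticOnNhd ℝ f univ := (b.contDiff_of_mem_lameSpan hf).analyticOnNhd
  have := han.eqOn_zero_of_preconnected_of_eventuallyEq_zero isPreconnected_univ (mem_univ G)
    (Filter.eventually_of_mem (isOpen_interior.mem_nhds hG) h)
  exact funext fun x => this (mem_univ x)

/-- The space of entire analytic solutions of the Helmholtz equation. -/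
noncomputable def helmholtzSpace (μ : ℝ) : Submodule ℂ (Plane → ℂ) where
  carrier := {f | ContDiff ℝ ω f ∧ ∀ x, Laplacian.laplacian f x = -(μ : ℂ) * f x}
  zero_mem' := by
    refine ⟨contDiff_const, fun x => ?_⟩
    have := congrFun (InnerProductSpace.laplacian_const (E := Plane) (c := (0 : ℂ))) x
    rw [Pi.zero_apply, mul_zero]
    exact this
  add_mem' := by
    rintro f g ⟨hf, hf'⟩ ⟨hg, hg'⟩
    refine ⟨hf.add hg, fun x => ?_⟩
    rw [(hf.of_le le_top).contDiffAt.laplacian_add (hg.of_le le_top).contDiffAt, hf', hg',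
      Pi.add_apply, mul_add]
  smul_mem' := by
    rintro c f ⟨hf, hf'⟩
    refine ⟨hf.const_smul c, fun x => ?_⟩
    rw [InnerProductSpace.laplacian_smul c (hf.of_le le_top).contDiffAt, hf', Pi.smul_apply,
      smul_eq_mul, smul_eq_mul]
    ring

variable {b}

theorem IsEquilateral.wave_mem_helmholtzSpace {l : ℝ} (h : b.IsEquilateral l) (hl : 0 < l)
    {m n : ℤ} {q : ℤ} (hq : hexForm m n = q) :
    b.wave m n ∈ helmholtzSpace (16 * Real.pi ^ 2 / (9 * l ^ 2) * q) :=
  ⟨b.contDiff_wave m n, fun x => by rw [← hq, h.laplacian_wave hl]⟩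

theorem IsEquilateral.lameSpace_le_helmholtzSpace {l : ℝ} (h : b.IsEquilateral l) (hl : 0 < l)
    (μ : ℝ) : b.lameSpace (16 * Real.pi ^ 2 / (9 * l ^ 2)) μ ≤ helmholtzSpace μ := by
  refine Submodule.span_le.2 ?_
  rintro _ ⟨⟨⟨m, n⟩, hp⟩, rfl⟩
  subst hp
  have key : ∀ m' n', hexForm m' n' = hexForm m n → _ :=
    fun m' n' => h.wave_mem_helmholtzSpace hl
  refine sub_mem (add_mem (add_mem (sub_mem (sub_mem ?_ ?_) ?_) ?_) ?_) ?_ <;>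
    exact key _ _ (by unfold hexForm; ring)

theorem IsEquilateral.integral_mul_lame_eq_zero {l : ℝ} (h : b.IsEquilateral l) (hl : 0 < l)
    {u : Plane → ℂ} {μ : ℝ} {m n : ℤ} (hne : 16 * Real.pi ^ 2 / (9 * l ^ 2) * hexForm m n ≠ μ)
    (hu : ContDiffOn ℝ 2 u (interior b.triangle)) (huc : ContinuousOn u b.triangle)
    (hu0 : ∀ x ∈ b.triangle, x ∉ interior b.triangle → u x = 0)
    (hΔ : ∀ x ∈ interior b.triangle, Laplacian.laplacian u x + μ * u x = 0) :
    ∫ x in b.triangle, u x * b.lame m n x = 0 :=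
  h.integral_mul_eq_zero hl hne.symm hu huc hu0 hΔ ((b.contDiff_lame m n).of_le le_top)
    (fun _ => b.lame_eq_zero)
    (h.lameSpace_le_helmholtzSpace hl _ (b.lame_mem_lameSpace rfl)).2

variable (b)

/-- The bilinear pairing of `lameSpace` with itself given by the integral over the triangle. -/
noncomputable def lamePairing (c μ : ℝ) :
    b.lameSpace c μ →ₗ[ℂ] Module.Dual ℂ (b.lameSpace c μ) :=
  have hi : ∀ v f : b.lameSpace c μ, IntegrableOn (fun x => v.1 x * f.1 x) b.triangle :=
    fun v f => (((b.contDiff_of_mem_lameSpan (b.lameSpace_le_lameSpan c μ v.2)).continuous.mul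
      (b.contDiff_of_mem_lameSpan (b.lameSpace_le_lameSpan c μ f.2)).continuous).continuousOn
      ).integrableOn_compact b.isCompact_triangle
  LinearMap.mk₂ ℂ (fun v f => ∫ x in b.triangle, v.1 x * f.1 x)
    (fun v v' f => by
      rw [← integral_add (hi v f) (hi v' f)]
      simp only [Submodule.coe_add, Pi.add_apply, add_mul])
    (fun a v f => by
      rw [← integral_smul]
      simp only [Submodule.coe_smul, Pi.smul_apply, smul_mul_assoc])
    (fun v f f' => by
      rw [← integral_add (hi v f) (hi v f')]
      simp only [Submodule.coe_add, Pi.add_apply, mul_add])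
    (fun a v f => by
      rw [← integral_smul]
      simp only [Submodule.coe_smul, Pi.smul_apply, mul_smul_comm])

theorem lamePairing_apply {c μ : ℝ} (v f : b.lameSpace c μ) :
    b.lamePairing c μ v f = ∫ x in b.triangle, v.1 x * f.1 x := rfl

/-- The pairing is bilinear, yet nondegenerate: the space is closed under conjugation, and `v`
paired with `star v` is the integral of `|v|²`. If that is 0, then `v` vanishes inside and, being
real analytic, everywhere. In finite dimension injectivity suffices. -/
theorem lamePairing_surjective {c : ℝ} (hc : 0 < c) (μ : ℝ) :
    Function.Surjective (b.lamePairing c μ) := by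
  have := b.finiteDimensional_lameSpace hc μ
  rw [← LinearMap.injective_iff_surjective_of_finrank_eq_finrank Subspace.dual_finrank_eq.symm,
    injective_iff_map_eq_zero]
  intro v hv
  have h1 := LinearMap.congr_fun hv ⟨star v.1, b.star_mem_lameSpace v.2⟩
  rw [lamePairing_apply] at h1
  have hv' := b.lameSpace_le_lameSpan c μ v.2
  exact Subtype.ext (b.eq_zero_of_eqOn_interior hv' (b.eqOn_zero_of_integral_mul_star
    (b.contDiff_of_mem_lameSpan hv').continuous.continuousOn h1))

/-- Extension by zero of the restriction of a function to the interior of a triangle. -/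
noncomputable def cutoff : (Plane → ℂ) →ₗ[ℂ] (Plane → ℂ) where
  toFun := (interior b.triangle).indicator
  map_add' f g := indicator_add _ f g
  map_smul' c f := indicator_const_smul _ c f

theorem cutoff_apply (f : Plane → ℂ) : b.cutoff f = (interior b.triangle).indicator f := rfl

variable {b}

theorem IsEquilateral.cutoff_mem {l : ℝ} (h : b.IsEquilateral l) (hl : 0 < l)
    {Ω : TopologicalSpace.Opens Plane} (hΩ : (Ω : Set Plane) = interior b.triangle) {μ : ℝ}
    {f : Plane → ℂ} (hf : f ∈ b.lameSpace (16 * Real.pi ^ 2 / (9 * l ^ 2)) μ) :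
    b.cutoff f ∈ dirichletEigenspace Ω μ := by
  obtain ⟨hfc, hfΔ⟩ := h.lameSpace_le_helmholtzSpace hl _ hf
  have hfs := b.lameSpace_le_lameSpan _ _ hf
  have hev : ∀ x ∈ interior b.triangle, b.cutoff f =ᶠ[𝓝 x] f := fun x hx =>
    Filter.eventually_of_mem (isOpen_interior.mem_nhds hx) fun y hy => indicator_of_mem hy f
  change IsDirichletSolution (Ω : Set Plane) μ (b.cutoff f)
  rw [hΩ]
  constructor
  · exact (hfc.of_le le_top).contDiffOn.congr fun x hx => indicator_of_mem hx f
  · intro k _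
    have hk : Continuous (iteratedFDeriv ℝ k f) := hfc.continuous_iteratedFDeriv le_top
    obtain ⟨K, hK⟩ := b.isCompact_triangle.exists_bound_of_continuousOn hk.continuousOn
    have : IsFiniteMeasure (volume.restrict (interior b.triangle)) := by
      rw [isFiniteMeasure_restrict]
      exact ((measure_mono interior_subset).trans_lt b.isCompact_triangle.measure_lt_top).ne
    have h1 : MemLp (iteratedFDeriv ℝ k f) 2 (volume.restrict (interior b.triangle)) := by
      refine MemLp.of_bound hk.aestronglyMeasurable K ?_
      exact (ae_restrict_iff' isOpen_interior.measurableSet).2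
        (Filter.Eventually.of_forall fun x hx => hK x (interior_subset hx))
    refine h1.ae_eq ((ae_restrict_iff' isOpen_interior.measurableSet).2
      (Filter.Eventually.of_forall fun x hx => ?_))
    exact ((hev x hx).symm.iteratedFDeriv ℝ k).self_of_nhds
  · rw [b.closure_interior_triangle]
    refine hfc.continuous.continuousOn.congr fun x hx => ?_
    by_cases hx' : x ∈ interior b.triangle
    · exact indicator_of_mem hx' f
    · rw [b.eq_zero_of_mem_lameSpan hfs hx hx']
      exact indicator_of_notMem hx' f
  · intro x hx
    rw [(InnerProductSpace.laplacian_congr_nhds (hev x hx)).self_of_nhds, hfΔ,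
      (hev x hx).self_of_nhds]
    ring
  · exact fun x hx => indicator_of_notMem hx f

/-- Let `v` in `lameSpace` represent the functional "integrate against `u`". Then `u - v` is
orthogonal to Lamé's functions of eigenvalue `μ` by the choice of `v`, and to the others by Green's
formula. Completeness gives `u = v` inside. -/
theorem IsEquilateral.dirichletEigenspace_eq {l : ℝ} (h : b.IsEquilateral l) (hl : 0 < l)
    {Ω : TopologicalSpace.Opens Plane} (hΩ : (Ω : Set Plane) = interior b.triangle) (μ : ℝ) :
    dirichletEigenspace Ω μ =
      (b.lameSpace (16 * Real.pi ^ 2 / (9 * l ^ 2)) μ).map b.cutoff := by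
  set c := 16 * Real.pi ^ 2 / (9 * l ^ 2) with hcdef
  have hc : 0 < c := by positivity
  refine le_antisymm ?_ ?_
  · intro u hu
    change IsDirichletSolution (Ω : Set Plane) μ u at hu
    rw [hΩ] at hu
    have huc := hu.continuousOn
    rw [b.closure_interior_triangle] at huc
    have hcont : ∀ f ∈ b.lameSpace c μ, Continuous f := fun f hf =>
      (b.contDiff_of_mem_lameSpan (b.lameSpace_le_lameSpan c μ hf)).continuous
    have hi : ∀ (w f : Plane → ℂ), ContinuousOn w b.triangle → Continuous f →
        IntegrableOn (fun x => w x * f x) b.triangle := fun w f hw hf =>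
      (hw.mul hf.continuousOn).integrableOn_compact b.isCompact_triangle
    let φ : Module.Dual ℂ (b.lameSpace c μ) :=
      { toFun := fun f => ∫ x in b.triangle, u x * f.1 x
        map_add' := fun f g => by
          rw [← integral_add (hi u f.1 huc (hcont f.1 f.2)) (hi u g.1 huc (hcont g.1 g.2))]
          simp only [Submodule.coe_add, Pi.add_apply, mul_add]
        map_smul' := fun a f => by
          rw [RingHom.id_apply, ← integral_smul]
          simp only [Submodule.coe_smul, Pi.smul_apply, mul_smul_comm] }
    obtain ⟨v, hv⟩ := b.lamePairing_surjective hc μ φ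
    refine ⟨v.1, v.2, ?_⟩
    have hvc := hcont v.1 v.2
    have hvs := b.lameSpace_le_lameSpan c μ v.2
    have key : ∀ x ∈ interior b.triangle, u x - v.1 x = 0 := by
      intro x hx
      refine b.eq_zero_of_integral_mul_lame_eq_zero (w := fun x => u x - v.1 x)
        (huc.sub hvc.continuousOn) (fun m n => ?_) hx
      have hmc : Continuous (b.lame m n) := (b.contDiff_lame m n).continuous
      simp only [sub_mul]
      rw [integral_sub (hi _ _ huc hmc) (hi _ _ hvc.continuousOn hmc), sub_eq_zero]
      by_cases hq : c * hexForm m n = μ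
      · exact (LinearMap.congr_fun hv ⟨_, b.lame_mem_lameSpace hq⟩).symm
      · have hv2 := h.lameSpace_le_helmholtzSpace hl _ v.2
        rw [h.integral_mul_lame_eq_zero hl hq hu.contDiffOn huc (fun x _ hx' => hu.eq_zero x hx')
          hu.helmholtz, h.integral_mul_lame_eq_zero hl hq (hv2.1.of_le le_top).contDiffOn
          hvc.continuousOn (fun x hx hx' => b.eq_zero_of_mem_lameSpan hvs hx hx')
          (fun x _ => by rw [hv2.2]; ring)]
    funext x
    by_cases hx : x ∈ interior b.triangle
    · rw [cutoff_apply, indicator_of_mem hx]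
      exact (sub_eq_zero.1 (key x hx)).symm
    · rw [cutoff_apply, indicator_of_notMem hx, hu.eq_zero x hx]
  · rintro _ ⟨f, hf, rfl⟩
    exact h.cutoff_mem hl hΩ hf

end AffineBasis

end

/-! ### Linear independence and multiplicities -/

section

open Set

namespace AffineBasis

/-- The plane waves of a triangle as characters of the plane. -/
noncomputable def waveChar (p : ℤ × ℤ) : Multiplicative (ℝ × ℝ) →* ℂ where
  toFun v := Complex.exp ((2 * Real.pi / 3 * ((2 * p.1 + p.2) * v.toAdd.1 +
    (p.1 + 2 * p.2) * v.toAdd.2) : ℝ) * Complex.I)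
  map_one' := by simp
  map_mul' v w := by
    rw [← Complex.exp_add]
    congr 1
    simp only [toAdd_mul, Prod.fst_add, Prod.snd_add]
    push_cast
    ring

theorem waveChar_injective : Function.Injective waveChar := by
  have key : ∀ d : ℤ, (∀ s : ℝ, Complex.exp ((2 * Real.pi / 3 * (d * s) : ℝ) * Complex.I) = 1) →
      d = 0 := by
    intro d h
    by_contra hd
    have hd' : (d : ℝ) ≠ 0 := by exact_mod_cast hd
    -- At this point the phase equals `π`, so the exponential is -1.
    have h1 := h (3 / (2 * d))
    rw [show 2 * Real.pi / 3 * (d * (3 / (2 * d))) = Real.pi by field_simp, Complex.exp_pi_mul_I]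
      at h1
    norm_num at h1
  intro p q h
  have h1 : ∀ v : ℝ × ℝ, Complex.exp ((2 * Real.pi / 3 * ((2 * p.1 + p.2) * v.1 +
      (p.1 + 2 * p.2) * v.2) : ℝ) * Complex.I) = Complex.exp ((2 * Real.pi / 3 *
      ((2 * q.1 + q.2) * v.1 + (q.1 + 2 * q.2) * v.2) : ℝ) * Complex.I) := fun v =>
    DFunLike.congr_fun h (Multiplicative.ofAdd v)
  have e1 := key ((2 * p.1 + p.2) - (2 * q.1 + q.2)) fun s => by
    have := h1 (s, 0)
    rw [← sub_eq_zero] at this ⊢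
    have h2 := congrArg (fun z => z / Complex.exp ((2 * Real.pi / 3 *
      ((2 * q.1 + q.2) * s + (q.1 + 2 * q.2) * 0) : ℝ) * Complex.I)) this
    simp only [sub_div, div_self (Complex.exp_ne_zero _), ← Complex.exp_sub, zero_div] at h2
    rw [← h2]
    congr 2
    push_cast
    ring
  have e2 := key ((p.1 + 2 * p.2) - (q.1 + 2 * q.2)) fun s => by
    have := h1 (0, s)
    rw [← sub_eq_zero] at this ⊢
    have h2 := congrArg (fun z => z / Complex.exp ((2 * Real.pi / 3 *
      ((2 * q.1 + q.2) * 0 + (q.1 + 2 * q.2) * s) : ℝ) * Complex.I)) this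
    simp only [sub_div, div_self (Complex.exp_ne_zero _), ← Complex.exp_sub, zero_div] at h2
    rw [← h2]
    congr 2
    push_cast
    ring
  exact Prod.ext (by omega) (by omega)

variable (b : AffineBasis (Fin 3) ℝ Plane)

/-- In edge coordinates the waves are distinct characters of the plane, independent by Dedekind's
theorem. -/
theorem linearIndependent_wave : LinearIndependent ℂ fun p : ℤ × ℤ => b.wave p.1 p.2 := by
  have h := (linearIndependent_monoidHom (Multiplicative (ℝ × ℝ)) ℂ).comp _ waveChar_injective
  refine LinearIndependent.of_comp (LinearMap.funLeft ℂ ℂ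
    fun v : Multiplicative (ℝ × ℝ) => b.edgePoint v.toAdd.1 v.toAdd.2) ?_
  convert! h using 1
  funext p v
  obtain ⟨h1, h2, -⟩ := b.coord_edgePoint v.toAdd.1 v.toAdd.2
  change b.wave p.1 p.2 (b.edgePoint v.toAdd.1 v.toAdd.2) = _
  rw [wave, phase, h1, h2]
  rfl

/-- Of the six waves in `lame m n` with `m, n > 0`, only the first has both indices positive.
Restricted to positive indices, the coefficient vectors are therefore the standard basis. -/
theorem linearIndependent_lame :
    LinearIndependent ℂ fun p : ℕ+ × ℕ+ => b.lame (p.1 : ℕ) (p.2 : ℕ) := by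
  set e : ℤ → ℤ → (ℤ × ℤ →₀ ℂ) := fun m n => Finsupp.single (m, n) 1 with he
  set E : ℕ+ × ℕ+ → (ℤ × ℤ →₀ ℂ) := fun p =>
    let m : ℤ := (p.1 : ℕ)
    let n : ℤ := (p.2 : ℕ)
    e m n - e (-m) (m + n) - e (m + n) (-n) + e n (-m - n) + e (-m - n) m - e (-n) (-m) with hE
  have hind : LinearIndependent ℂ E := by
    refine LinearIndependent.of_comp ((LinearMap.funLeft ℂ ℂ fun p : ℕ+ × ℕ+ =>
      (((p.1 : ℕ) : ℤ), ((p.2 : ℕ) : ℤ))) ∘ₗ Finsupp.lcoeFun) ?_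
    convert! Pi.linearIndependent_single_one (ℕ+ × ℕ+) ℂ using 1
    funext p q
    obtain ⟨m, n⟩ := p
    obtain ⟨m', n'⟩ := q
    change E (m, n) (((m' : ℕ) : ℤ), ((n' : ℕ) : ℤ)) = _
    have hm := m.pos
    have hn := n.pos
    have hm' := m'.pos
    have hn' := n'.pos
    simp only [hE, he, Finsupp.sub_apply, Finsupp.add_apply, Finsupp.single_apply, Prod.mk.injEq,
      Pi.single_apply]
    rw [if_neg (c := -((m : ℕ) : ℤ) = _ ∧ _) (by omega), if_neg (c := _ ∧ -((n : ℕ) : ℤ) = _) (by omega),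
      if_neg (c := _ ∧ -((m : ℕ) : ℤ) - ((n : ℕ) : ℤ) = _) (by omega),
      if_neg (c := -((m : ℕ) : ℤ) - ((n : ℕ) : ℤ) = _ ∧ _) (by omega),
      if_neg (c := -((n : ℕ) : ℤ) = _ ∧ _) (by omega)]
    simp only [sub_zero, add_zero, Nat.cast_inj, PNat.coe_inj]
    exact if_congr (by constructor <;> rintro ⟨h1, h2⟩ <;> exact ⟨h1.symm, h2.symm⟩) rfl rfl
  convert! hind.map' (Finsupp.linearCombination ℂ fun p : ℤ × ℤ => b.wave p.1 p.2)
    (LinearMap.ker_eq_bot.2 b.linearIndependent_wave) using 1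
  funext p
  simp [hE, he, lame]

variable {b}

theorem IsEquilateral.finrank_dirichletEigenspace {l : ℝ} (h : b.IsEquilateral l) (hl : 0 < l)
    {Ω : TopologicalSpace.Opens Plane} (hΩ : (Ω : Set Plane) = interior b.triangle) (μ : ℝ) :
    FiniteDimensional ℂ (dirichletEigenspace Ω μ) ∧
    Module.finrank ℂ (dirichletEigenspace Ω μ) = Nat.card {p : ℕ+ × ℕ+ //
      16 * Real.pi ^ 2 / (9 * l ^ 2) * hexForm (p.1 : ℕ) (p.2 : ℕ) = μ} := by
  have hfin := finite_hexForm_eq (show 0 < 16 * Real.pi ^ 2 / (9 * l ^ 2) by positivity) μ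
  have := Fintype.ofFinite {p : ℕ+ × ℕ+ //
      16 * Real.pi ^ 2 / (9 * l ^ 2) * hexForm (p.1 : ℕ) (p.2 : ℕ) = μ}
  have hind := b.linearIndependent_lame.comp (fun p : {p : ℕ+ × ℕ+ //
      16 * Real.pi ^ 2 / (9 * l ^ 2) * hexForm (p.1 : ℕ) (p.2 : ℕ) = μ} => p.1)
      Subtype.val_injective
  have hinj : InjOn b.cutoff (b.lameSpace (16 * Real.pi ^ 2 / (9 * l ^ 2)) μ) := by
    intro f hf g hg hfg
    refine sub_eq_zero.1 (b.eq_zero_of_eqOn_interior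
      (b.lameSpace_le_lameSpan _ _ (sub_mem hf hg)) fun x hx => ?_)
    have := congrFun hfg x
    rw [cutoff_apply, cutoff_apply, indicator_of_mem hx, indicator_of_mem hx] at this
    rw [Pi.sub_apply, this, sub_self]
  rw [h.dirichletEigenspace_eq hl hΩ]
  rw [lameSpace_eq_span] at hinj ⊢
  have hind' := hind.map_injOn b.cutoff hinj
  rw [Submodule.map_span, ← range_comp]
  exact ⟨FiniteDimensional.span_of_finite ℂ (finite_range _),
    (finrank_span_eq_card hind').trans Nat.card_eq_fintype_card.symm⟩

theorem IsEquilateral.mem_dirichletSpectrum {l : ℝ} (h : b.IsEquilateral l) (hl : 0 < l)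
    {Ω : TopologicalSpace.Opens Plane} (hΩ : (Ω : Set Plane) = interior b.triangle) {μ : ℝ} :
    μ ∈ dirichletSpectrum Ω ↔ ∃ p : ℕ+ × ℕ+,
      16 * Real.pi ^ 2 / (9 * l ^ 2) * hexForm (p.1 : ℕ) (p.2 : ℕ) = μ := by
  have hfin := finite_hexForm_eq (show 0 < 16 * Real.pi ^ 2 / (9 * l ^ 2) by positivity) μ
  obtain ⟨hf, hr⟩ := h.finrank_dirichletEigenspace hl hΩ μ
  change dirichletEigenspace Ω μ ≠ ⊥ ↔ _
  rw [ne_eq, ← Submodule.finrank_eq_zero, hr, ← ne_eq, ← Nat.pos_iff_ne_zero, Nat.card_pos_iff,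
    nonempty_subtype]
  exact and_iff_left hfin

end AffineBasis

end

/-! ### The spectral zeta function of the triangle -/

section

open Set Filter Topology

theorem exists_affineBasis_equilateral {A B C : Plane} {l : ℝ} (hl : 0 < l) (hAB : dist A B = l)
    (hBC : dist B C = l) (hCA : dist C A = l) :
    ∃ b : AffineBasis (Fin 3) ℝ Plane, b.IsEquilateral l ∧ range b = {A, B, C} := by
  have hind : AffineIndependent ℝ ![A, B, C] := by
    rw [affineIndependent_iff_not_collinear_set]
    intro h
    rcases h.wbtw_or_wbtw_or_wbtw with h | h | h
    · have := h.dist_add_dist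
      rw [dist_comm A C] at this
      linarith
    · have := h.dist_add_dist
      rw [dist_comm B A] at this
      linarith
    · have := h.dist_add_dist
      rw [dist_comm C B] at this
      linarith
  have hspan : affineSpan ℝ (range ![A, B, C]) = ⊤ := by
    rw [hind.affineSpan_eq_top_iff_card_eq_finrank_add_one]
    simp
  refine ⟨⟨![A, B, C], hind, hspan⟩, ⟨hAB, hBC, hCA⟩, ?_⟩
  change range ![A, B, C] = _
  rw [Matrix.range_cons, Matrix.range_cons, Matrix.range_cons, Matrix.range_empty, union_empty]
  rfl

namespace AffineBasis

variable {b : AffineBasis (Fin 3) ℝ Plane}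

/-- Group the sum over positive pairs by eigenvalue: each fibre is finite, and its cardinality is
the multiplicity. -/
theorem IsEquilateral.isSpectralZeta {l : ℝ} (h : b.IsEquilateral l) (hl : 0 < l)
    {Ω : TopologicalSpace.Opens Plane} (hΩ : (Ω : Set Plane) = interior b.triangle) {Z : ℂ → ℂ}
    (hZ : MeromorphicNFOn Z univ) (hs : ∀ s : ℂ, 1 < s.re → HasSum (fun p : ℕ+ × ℕ+ =>
      ((16 * Real.pi ^ 2 / (9 * l ^ 2) * hexForm (p.1 : ℕ) (p.2 : ℕ) : ℝ) : ℂ) ^ (-s)) (Z s)) :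
    IsSpectralZeta Ω Z where
  pos μ hμ := by
    obtain ⟨p, rfl⟩ := (h.mem_dirichletSpectrum hl hΩ).1 hμ
    have : (0 : ℝ) < hexForm (p.1 : ℕ) (p.2 : ℕ) := by exact_mod_cast hexForm_pnat_pos p
    positivity
  finite μ _ := (h.finrank_dirichletEigenspace hl hΩ μ).1
  meromorphic := hZ
  hasSum s hs1 := by
    set F : ℕ+ × ℕ+ → dirichletSpectrum Ω := fun p =>
      ⟨_, (h.mem_dirichletSpectrum hl hΩ).2 ⟨p, rfl⟩⟩ with hF
    have h1 := (Equiv.sigmaFiberEquiv F).hasSum_iff.2 (hs s hs1)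
    refine h1.sigma fun μ => ?_
    have hfin := finite_hexForm_eq (show 0 < 16 * Real.pi ^ 2 / (9 * l ^ 2) by positivity) μ
    let e : {p // F p = μ} ≃ {p : ℕ+ × ℕ+ //
        16 * Real.pi ^ 2 / (9 * l ^ 2) * hexForm (p.1 : ℕ) (p.2 : ℕ) = (μ : ℝ)} :=
      Equiv.subtypeEquivRight fun p => Subtype.ext_iff
    have hfin' : Finite {p // F p = μ} := Finite.of_equiv _ e.symm
    have := Fintype.ofFinite {p // F p = μ}
    have hcard : Module.finrank ℂ (dirichletEigenspace Ω μ) = Fintype.card {p // F p = μ} := by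
      rw [(h.finrank_dirichletEigenspace hl hΩ μ).2, ← Nat.card_congr e, Nat.card_eq_fintype_card]
    have hconst : ∀ p : {p // F p = μ}, ((16 * Real.pi ^ 2 / (9 * l ^ 2) *
        hexForm (p.1.1 : ℕ) (p.1.2 : ℕ) : ℝ) : ℂ) ^ (-s) = ((μ : ℝ) : ℂ) ^ (-s) := fun p => by
      rw [← congrArg Subtype.val p.2]
    have h2 := hasSum_fintype fun p : {p // F p = μ} => ((16 * Real.pi ^ 2 / (9 * l ^ 2) *
        hexForm (p.1.1 : ℕ) (p.1.2 : ℕ) : ℝ) : ℂ) ^ (-s)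
    simp_rw [hconst] at h2
    rw [Finset.sum_const, Finset.card_univ, ← hcard, nsmul_eq_mul] at h2
    convert! h2 using 1
    funext p
    exact hconst p

end AffineBasis

theorem IsSpectralZeta.unique {Ω : TopologicalSpace.Opens Plane} {ζ ζ' : ℂ → ℂ}
    (h : IsSpectralZeta Ω ζ) (h' : IsSpectralZeta Ω ζ') : ζ = ζ' := by
  refine h.meromorphic.eq_of_eventuallyEq h'.meromorphic (z := 2) ?_
  have hopen : IsOpen {s : ℂ | 1 < s.re} := isOpen_lt continuous_const Complex.continuous_re
  filter_upwards [hopen.mem_nhds (show (1 : ℝ) < (2 : ℂ).re by norm_num)] with s hs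
  exact (h.hasSum s hs).unique (h'.hasSum s hs)

end


/-! ### The determinant formula -/

theorem mainTheorem7 (A B C : EuclideanSpace ℝ (Fin 2)) (l : ℝ) (hl : 0 < l)
    (hAB : dist A B = l) (hBC : dist B C = l) (hCA : dist C A = l) :
    ∃ ζ : ℂ → ℂ,
      IsSpectralZeta (openTriangle A B C) ζ ∧
      (∀ ζ' : ℂ → ℂ, IsSpectralZeta (openTriangle A B C) ζ' → ζ' = ζ) ∧
      AnalyticAt ℂ ζ 0 ∧
      Summable (fun n : ℕ+ => (-1 : ℝ) ^ (n : ℕ) / (n * Real.exp (Real.pi * n * √3)) *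
        ∑ d ∈ (n : ℕ).divisors, (d : ℝ)) ∧
      deriv ζ 0 = ((2 / 3 * Real.log (3 * l / 2) + Real.pi * √3 / 36 +
        2 / 3 * ∑' n : ℕ+, (-1 : ℝ) ^ (n : ℕ) / (n * Real.exp (Real.pi * n * √3)) *
          ∑ d ∈ (n : ℕ).divisors, (d : ℝ) : ℝ) : ℂ) ∧
      deriv ζ 0 = ((2 / 3 * Real.log (3 * l /
        (2 * ‖ModularForm.eta ((-3 + Complex.I * (√3 : ℝ)) / 2)‖)) : ℝ) : ℂ) ∧
      zetaDet ζ = ((Real.exp (-(2 / 3 * Real.log (3 * l /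
        (2 * ‖ModularForm.eta ((-3 + Complex.I * (√3 : ℝ)) / 2)‖)))) : ℝ) : ℂ) := by
  obtain ⟨b, hb, hrange⟩ := exists_affineBasis_equilateral hl hAB hBC hCA
  have hΩ : (openTriangle A B C : Set Plane) = interior b.triangle := by
    rw [AffineBasis.triangle, hrange]
    rfl
  obtain ⟨ζ, hmer, hsum, han, hder⟩ := exists_hexZeta_continuation
    (show 0 < 16 * Real.pi ^ 2 / (9 * l ^ 2) by positivity)
  have hζ := hb.isSpectralZeta hl hΩ hmer hsum
  have hpi := Real.pi_pos
  -- The scale is the square of `2π / (3l/2)`, so the two terms in `log (2π)` cancel.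
  have hlog : -(1 / 3) * Real.log (16 * Real.pi ^ 2 / (9 * l ^ 2)) +
      2 / 3 * Real.log (2 * Real.pi) = 2 / 3 * Real.log (3 * l / 2) := by
    rw [show 16 * Real.pi ^ 2 / (9 * l ^ 2) = (2 * Real.pi / (3 * l / 2)) ^ 2 by field_simp; ring,
      Real.log_pow, Real.log_div (by positivity) (by positivity)]
    push_cast
    ring
  rw [hlog] at hder
  have heta : ‖ModularForm.eta ((-3 + Complex.I * (√3 : ℝ)) / 2)‖ ≠ 0 := by
    rw [norm_ne_zero_iff]
    refine ModularForm.eta_ne_zero ?_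
    simp [UpperHalfPlane.upperHalfPlaneSet]
  have hder' : deriv ζ 0 = ((2 / 3 * Real.log (3 * l /
      (2 * ‖ModularForm.eta ((-3 + Complex.I * (√3 : ℝ)) / 2)‖)) : ℝ) : ℂ) := by
    rw [hder, ← div_div, Real.log_div (by positivity) heta, log_norm_eta]
    push_cast
    ring
  refine ⟨ζ, hζ, fun ζ' h' => h'.unique hζ, han, hasSum_hexNome.summable, hder, hder', ?_⟩
  rw [zetaDet, hder', Complex.ofReal_exp, Complex.ofReal_neg]
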